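/- **Setting.** Let $r\ge 1$. A *smooth marked disk* is a compact Riemann surface $C$, possibly disconnected, each of whose connected components has genus zero, with an antiholomorphic involution $\phi$, a closed subset $\Sigma\subset C$ (the preferred half) such that $\Sigma\cup\phi(\Sigma)=C$ and $\Sigma\cap\phi(\Sigma)=\mathrm{Fix}(\phi)=:\partial\Sigma$, distinct internal marked points $z_i\in\Sigma\setminus\partial\Sigma$ ($i\in I$), with conjugates $\bar z_i=\phi(z_i)$, and distinct boundary marked points $x_j\in\partial\Sigma$ ($j\in B$), with $I,B$ finite. The curve $\partial\Sigma$ is oriented as the boundary of $\Sigma$. A *twisted $r$-spin structure* with twists $a_i,b_j\in\{0,\dots,r-1\}$ is given by a holomorphic line bundle $S$ on $C$, an isomorphism $$\tau: S^{\otimes r}\cong\omega_C\Big(-\sum_i a_i[z_i]-\sum_i a_i[\bar z_i]-\sum_j b_j[x_j]\Big),$$ and an antiholomorphic, fibrewise conjugate-linear involution $\widetilde\phi$ of $S$ lifting $\phi$, such that $\widetilde\phi^{\otimes r}$ agrees under $\tau$ with the involution of $\omega_C$ induced by $\phi$. (Here $S$ is the bundle on the coarse curve; this is the same data as a twisted $r$-spin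 structure on the orbifold curve with isotropy $\mathbb Z/r$ at the marked points.) Put $J=S^\vee\otimes\omega_C$, with the induced involution $\widetilde\phi$. Let $A$ be an open subset of $\partial\Sigma\setminus\{x_j\}$. A section of $\omega_C|_A$ is *positive* if it takes positive real values on the positively oriented tangent vectors of $\partial\Sigma$. A *lifting of $S$ over $A$* is a continuous $\widetilde\phi$-invariant section $v$ of $S|_A$ such that the image of $v^{\otimes r}$ in $\omega_C$ is positive. A *lifting of $J$ over $A$* is a continuous $\widetilde\phi$-invariant section $w$ of $J|_A$ such that $\langle w,v\rangle$ is positive for some lifting $v$ of $S$ over $A$. Two liftings are *equivalent* if they differ by a continuous function $A\to\mathbb R_{>0}$. The structure is *compatible* if it has a lifting over $\partial\Sigma\setminus\{x_j\}_{j\in B}$. For a lifting over $A$, where $A\cup\{x_j\}$ is a neighbourhood of $x_j$ in $\partial\Sigma$, the point $x_j$ is *illegal* if some equivalent lifting extends continuously to $x_j$ without vanishing there; otherwise $x_j$ is *legal*, and the lifting *alternates* at $x_j$. **Proposition.** Let $(S,\tau,\widetilde\phi)$ be a twisted $r$-spin structure with twists $a_i,b_j$ on a smooth marked disk. The statements about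 liftings hold both for liftings of $S$ and for liftings of $J$. 1. If $r$ is odd, the structure is compatible, and its liftings over $\partial\Sigma\setminus\{x_j\}_{j\in B}$ form a single equivalence class. 2. If $r$ is even and the structure is compatible, then all $b_j$ are even. Conversely, suppose that $r$ is even, $C$ is connected, all $b_j$ are even, and either $B\ne\emptyset$ or $(2\sum_i a_i+2)/r$ is an even integer. Let $\xi$ be any complex number with $\xi^r=-1$. Then $(S,\tau,\xi\circ\widetilde\phi\circ\xi^{-1})$ is again a twisted $r$-spin structure with the same twists; multiplication by $\xi$ is an isomorphism from the structure $(S,-\tau,\widetilde\phi)$ to it; and at least one of $(S,\tau,\widetilde\phi)$ and $(S,\tau,\xi\circ\widetilde\phi\circ\xi^{-1})$ is compatible. 3. If $r$ is odd, then for every lifting over an open subset $A$ of $\partial\Sigma\setminus\{x_j\}_{j\in B}$ containing a punctured neighbourhood of $x_j$ in $\partial\Sigma$, the point $x_j$ is legal if and only if $b_j$ is odd. 4. Suppose that $r$ is even and $C$ is connected, and let $D\subseteq B$. If some lifting over $\partial\Sigma\setminus\{x_j\}_{j\in B}$ alternates precisely at the points $x_j$ with $j\in D$, then $$\frac{2\sum_i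 a_i+\sum_j b_j+2}{r}\ \text{ is an integer congruent to } |D| \bmod 2.\qquad(*)$$ Conversely, if the structure is compatible and $(*)$ holds, then up to equivalence there are exactly two liftings that alternate precisely at the points $x_j$ with $j\in D$, and one is the negative of the other. -/

import Mathlib

open Set Filter Topology Bundle
open scoped Manifold ContDiff TensorProduct

noncomputable section

/-! ### Smooth marked disks -/

section Surfaces

variable {X : Type*} [TopologicalSpace X] [ChartedSpace ℂ X]

/-- The subset `K` of the Riemann surface `X` is a copy of the Riemann sphere, i.e. it is
obtained by gluing two holomorphic coordinate charts with image all of `ℂ` along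
`ℂ \ {0}` by `z ↦ 1 / z`. -/
def IsRiemannSphere (K : Set X) : Prop :=
  ∃ e₀ ∈ IsManifold.maximalAtlas 𝓘(ℂ) ω X, ∃ e₁ ∈ IsManifold.maximalAtlas 𝓘(ℂ) ω X,
    e₀.target = univ ∧ e₁.target = univ ∧ e₀.source ∪ e₁.source = K ∧
    (∀ x ∈ e₀.source, x ∈ e₁.source ↔ e₀ x ≠ 0) ∧
    (∀ x ∈ e₁.source, x ∈ e₀.source ↔ e₁ x ≠ 0) ∧
    (∀ x ∈ e₀.source ∩ e₁.source, e₁ x = (e₀ x)⁻¹)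

/-- `φ` is antiholomorphic: it is continuous, and in holomorphic coordinates around any
point and its image, the complex conjugate of `φ` is holomorphic. -/
def IsAntiholomorphic (φ : X → X) : Prop :=
  Continuous φ ∧ ∀ x : X, AnalyticAt ℂ
    (fun ζ : ℂ => (starRingEnd ℂ) (chartAt ℂ (φ x) (φ ((chartAt ℂ x).symm ζ))))
    (chartAt ℂ x x)

/-- The (conjugate-linear) differential at `x` of a conjugation `φ`, as a map between the
holomorphic tangent lines. -/
def conjDeriv (φ : X → X) (x : X) (u : TangentSpace 𝓘(ℂ) x) : TangentSpace 𝓘(ℂ) (φ x) :=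
  mfderiv 𝓘(ℝ, ℂ) 𝓘(ℝ, ℂ) φ x u

/-- A smooth marked disk whose closed surface is `X` (possibly disconnected, each connected
component having genus zero), with internal marked points labelled by `I` and boundary
marked points labelled by `B`. -/
structure MarkedDisk (X : Type*) [TopologicalSpace X] [ChartedSpace ℂ X]
    (I B : Type*) where
  /-- the conjugation -/
  φ : X → X
  /-- the preferred half `Σ` -/
  half : Set X
  /-- internal marked points -/
  z : I → X
  /-- boundary marked points -/
  x : B → X
  genus_zero : ∀ p : X, IsRiemannSphere (connectedComponent p)
  involutive : Function.Involutive φ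
  antiholomorphic : IsAntiholomorphic φ
  isClosed_half : IsClosed half
  /-- `X` is the union of `Σ` and its conjugate ... -/
  half_union : half ∪ φ '' half = univ
  /-- ... which meet exactly along the fixed locus of the conjugation. -/
  half_inter : half ∩ φ '' half = {p | φ p = p}
  z_injective : Function.Injective z
  x_injective : Function.Injective x
  z_mem : ∀ i, z i ∈ half ∧ φ (z i) ≠ z i
  x_mem : ∀ j, φ (x j) = x j

namespace MarkedDisk

variable {I B : Type*} (M : MarkedDisk X I B)

/-- The boundary `∂Σ`, which is the fixed locus of the conjugation. -/
def bdry : Set X := {p | M.φ p = p}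

/-- The boundary without the boundary marked points. -/
def openBdry : Set X := M.bdry \ range M.x

/-- `A` is an open subset of `∂Σ` minus the boundary marked points. -/
def IsOpenArc (A : Set X) : Prop := A ⊆ M.openBdry ∧ ∃ U : Set X, IsOpen U ∧ A = U ∩ M.bdry

/-- `u` is a nonzero tangent vector to `∂Σ` at `p` in the direction of the orientation of
`∂Σ` as the boundary of `Σ`: it is fixed by the differential of the conjugation, and
`i u` points into `Σ`. -/
def IsPositiveTangent (p : X) (u : TangentSpace 𝓘(ℂ) p) : Prop :=
  u ≠ 0 ∧
  (⟨M.φ p, conjDeriv M.φ p u⟩ : TangentBundle 𝓘(ℂ) X) = ⟨p, u⟩ ∧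
  ∀ᶠ t : ℝ in 𝓝[>] 0,
    (chartAt ℂ p).symm (chartAt ℂ p p + (t : ℂ) * (Complex.I * (show ℂ from u))) ∈ M.half

/-- The cotangent vector `η` at the boundary point `p` is positive: it takes positive real
values on the positive tangent vectors of `∂Σ`. -/
def IsPositive (p : X) (η : TangentSpace 𝓘(ℂ) p →L[ℂ] ℂ) : Prop :=
  ∀ u : TangentSpace 𝓘(ℂ) p, M.IsPositiveTangent p u → ∃ c : ℝ, 0 < c ∧ η u = (c : ℂ)

open Classical in
/-- The divisor `∑ aᵢ [zᵢ] + ∑ aᵢ [z̄ᵢ] + ∑ bⱼ [xⱼ]`. -/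
def divisor [Fintype I] [Fintype B] (a : I → ℕ) (b : B → ℕ) (p : X) : ℕ :=
  (∑ i, if M.z i = p then a i else 0) + (∑ i, if M.φ (M.z i) = p then a i else 0) +
    ∑ j, if M.x j = p then b j else 0

end MarkedDisk

end Surfaces

/-! ### Twisted spin structures -/

section Spin

variable {X : Type*} [TopologicalSpace X] [ChartedSpace ℂ X] [IsManifold 𝓘(ℂ) ω X]

/-- The fibres of the canonical bundle `ω`. -/
abbrev CanonicalFiber (X : Type*) [TopologicalSpace X] [ChartedSpace ℂ X] (p : X) : Type :=
  TangentSpace 𝓘(ℂ) p →L[ℂ] ℂ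

instance canonicalFiber_isTopologicalAddGroup (p : X) :
    IsTopologicalAddGroup (CanonicalFiber X p) :=
  inferInstanceAs (IsTopologicalAddGroup (ℂ →L[ℂ] ℂ))

instance canonicalFiber_continuousAdd (p : X) : ContinuousAdd (CanonicalFiber X p) :=
  (canonicalFiber_isTopologicalAddGroup p).toContinuousAdd

variable (S : X → Type*) [∀ p, AddCommGroup (S p)] [∀ p, Module ℂ (S p)]
  [TopologicalSpace (TotalSpace ℂ S)] [∀ p, TopologicalSpace (S p)]
  [FiberBundle ℂ S] [VectorBundle ℂ ℂ S]

/-- The fibres of `J = S^∨ ⊗ ω = Hom(S, ω)`. -/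
abbrev JFiber (p : X) : Type _ := S p →L[ℂ] CanonicalFiber X p

variable {S}

/-- The local section `s` of the line bundle `S` is holomorphic on `U`. -/
def HolomorphicOn (s : ∀ p, S p) (U : Set X) : Prop :=
  ContMDiffOn 𝓘(ℂ) (𝓘(ℂ).prod 𝓘(ℂ, ℂ)) ω (fun p => (⟨p, s p⟩ : TotalSpace ℂ S)) U

/-- The map of total spaces induced by a family of fibrewise maps over `φ`. -/
def totalMap (φ : X → X) (inv : ∀ p, S p →ₛₗ[starRingEnd ℂ] S (φ p))
    (q : TotalSpace ℂ S) : TotalSpace ℂ S := ⟨φ q.1, inv q.1 q.2⟩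

/-- The image `τ(v^{⊗ r})`. -/
def rPow {r : ℕ} (τ : ∀ p, (⨂[ℂ]^r (S p)) →ₗ[ℂ] CanonicalFiber X p) (p : X) (v : S p) :
    CanonicalFiber X p := τ p (PiTensorProduct.tprod ℂ (fun _ : Fin r => v))

/-- The coefficient `f` in `τ(s^{⊗ r}) = f(ζ) dζ`, where `ζ` is the preferred holomorphic
coordinate around `p`. -/
def rPowCoeff {r : ℕ} (τ : ∀ p, (⨂[ℂ]^r (S p)) →ₗ[ℂ] CanonicalFiber X p)
    (s : ∀ p, S p) (p : X) (ζ : ℂ) : ℂ :=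
  rPow τ ((chartAt ℂ p).symm ζ) (s ((chartAt ℂ p).symm ζ))
    (mfderiv 𝓘(ℂ) 𝓘(ℂ) (chartAt ℂ p).symm ζ (1 : ℂ))

/-- A twisted `r`-spin structure with underlying holomorphic line bundle `S`, internal twists
`a` and boundary twists `b`: an isomorphism of `S^{⊗ r}` with
`ω(-∑ aᵢ [zᵢ] - ∑ aᵢ [z̄ᵢ] - ∑ bⱼ [xⱼ])`, given as the injection `S^{⊗ r} → ω` with this
image, and an antiholomorphic involution of `S` lifting the conjugation and compatible with
this isomorphism. -/
structure TwistedSpin {I B : Type*} [Fintype I] [Fintype B] (r : ℕ)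
    (M : MarkedDisk X I B) (a : I → ℕ) (b : B → ℕ)
    (S : X → Type*) [∀ p, AddCommGroup (S p)] [∀ p, Module ℂ (S p)]
    [TopologicalSpace (TotalSpace ℂ S)] [∀ p, TopologicalSpace (S p)]
    [FiberBundle ℂ S] [VectorBundle ℂ ℂ S] where
  a_lt : ∀ i, a i < r
  b_lt : ∀ j, b j < r
  /-- the map `S^{⊗ r} → ω` -/
  τ : ∀ p, (⨂[ℂ]^r (S p)) →ₗ[ℂ] CanonicalFiber X p
  /-- `τ` is holomorphic and its image is `ω` twisted down by the divisor of the twists: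
  the `r`th power of a local holomorphic frame is mapped to a holomorphic differential whose
  order of vanishing at each point is the multiplicity of this point in the divisor. -/
  τ_order : ∀ (U : Set X) (s : ∀ p, S p), IsOpen U → HolomorphicOn s U →
    (∀ p ∈ U, s p ≠ 0) → ∀ p ∈ U,
      AnalyticAt ℂ (rPowCoeff τ s p) (chartAt ℂ p p) ∧
      analyticOrderAt (rPowCoeff τ s p) (chartAt ℂ p p) = (M.divisor a b p : ℕ∞)
  /-- the lift of the conjugation to `S`, conjugate-linear on the fibres -/
  inv : ∀ p, S p →ₛₗ[starRingEnd ℂ] S (M.φ p)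
  inv_involutive : Function.Involutive (totalMap M.φ inv)
  /-- the lift is antiholomorphic: conjugates of holomorphic sections are holomorphic -/
  inv_antiholomorphic : ∀ (U : Set X) (s : ∀ p, S p), IsOpen U → HolomorphicOn s U →
    ContMDiffOn 𝓘(ℂ) (𝓘(ℂ).prod 𝓘(ℂ, ℂ)) ω
      (fun p => totalMap M.φ inv ⟨M.φ p, s (M.φ p)⟩) (M.φ ⁻¹' U)
  /-- the `r`th power of the lift agrees under `τ` with the involution of `ω` -/
  τ_inv : ∀ (p : X) (v : S p) (u : TangentSpace 𝓘(ℂ) p),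
    rPow τ (M.φ p) (inv p v) (conjDeriv M.φ p u) = (starRingEnd ℂ) (rPow τ p v u)

/-! ### Liftings and legality -/

/-- Two sections `s` and `s'` over `A` are equivalent: they differ by a continuous positive
function on `A`. -/
def SectionEquiv {E : X → Type*} [∀ p, AddCommGroup (E p)] [∀ p, Module ℂ (E p)]
    (A : Set X) (s s' : ∀ p, E p) : Prop :=
  ∃ c : X → ℝ, ContinuousOn c A ∧ ∀ p ∈ A, 0 < c p ∧ s p = (c p : ℂ) • s' p

/-- Given the notion `Lift` of liftings over `A` in the bundle `E` (with model fibre `F`), the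
point `q` is illegal for the section `w` if some lifting equivalent to `w` can be extended
continuously to `q` without vanishing there. -/
def IsIllegal (F : Type*) [TopologicalSpace F] {E : X → Type*} [∀ p, AddCommGroup (E p)]
    [∀ p, Module ℂ (E p)] [TopologicalSpace (TotalSpace F E)] (Lift : (∀ p, E p) → Prop)
    (A : Set X) (w : ∀ p, E p) (q : X) : Prop :=
  ∃ w' : ∀ p, E p, Lift w' ∧ SectionEquiv A w' w ∧
    ContinuousOn (fun p => (⟨p, w' p⟩ : TotalSpace F E)) (insert q A) ∧ w' q ≠ 0

namespace TwistedSpin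

variable {I B : Type*} [Fintype I] [Fintype B] {r : ℕ} {M : MarkedDisk X I B}
  {a : I → ℕ} {b : B → ℕ}

/-- `v` is a lifting of `S` over `A`: a continuous invariant section over `A` whose `r`th power
is positive. -/
def IsLiftingS (P : TwistedSpin r M a b S) (A : Set X) (v : ∀ p, S p) : Prop :=
  ContinuousOn (fun p => (⟨p, v p⟩ : TotalSpace ℂ S)) A ∧
  (∀ p ∈ A, P.inv p (v p) = v (M.φ p)) ∧
  ∀ p ∈ A, M.IsPositive p (rPow P.τ p (v p))

/-- `w` is a lifting of `J` over `A`: a continuous invariant section over `A` (for the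
involution of `J = Hom(S, ω)` induced by those of `S` and `ω`) which pairs positively with
some lifting of `S` over `A`. -/
def IsLiftingJ (P : TwistedSpin r M a b S) (A : Set X) (w : ∀ p, JFiber S p) : Prop :=
  ContinuousOn (fun p => (⟨p, w p⟩ : TotalSpace (ℂ →L[ℂ] (ℂ →L[ℂ] ℂ)) (JFiber S))) A ∧
  (∀ p ∈ A, ∀ (s : S p) (u : TangentSpace 𝓘(ℂ) p),
    w (M.φ p) (P.inv p s) (conjDeriv M.φ p u) = (starRingEnd ℂ) (w p s u)) ∧
  ∃ v : ∀ p, S p, P.IsLiftingS A v ∧ ∀ p ∈ A, M.IsPositive p (w p (v p))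

/-- Compatibility: a lifting exists over the whole boundary minus the marked points. -/
def Compatible (P : TwistedSpin r M a b S) : Prop := ∃ v : ∀ p, S p, P.IsLiftingS M.openBdry v

/-- The boundary marked point `x j` is legal for the lifting `v` of `S` over `A`. -/
def IsLegalS (P : TwistedSpin r M a b S) (A : Set X) (v : ∀ p, S p) (j : B) : Prop :=
  ¬ IsIllegal ℂ (P.IsLiftingS A) A v (M.x j)

/-- The boundary marked point `x j` is legal for the lifting `w` of `J` over `A`, i.e. `w`
alternates at it. -/
def IsLegalJ (P : TwistedSpin r M a b S) (A : Set X) (w : ∀ p, JFiber S p) (j : B) : Prop :=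
  ¬ IsIllegal (ℂ →L[ℂ] (ℂ →L[ℂ] ℂ)) (P.IsLiftingJ A) A w (M.x j)

/-- `v` is a lifting of `S` over the whole boundary minus the marked points, alternating
precisely at the marked points with label in `D`. -/
def AlternatesS (P : TwistedSpin r M a b S) (D : Finset B) (v : ∀ p, S p) : Prop :=
  P.IsLiftingS M.openBdry v ∧ ∀ j, P.IsLegalS M.openBdry v j ↔ j ∈ D

/-- `w` is a lifting of `J` over the whole boundary minus the marked points, alternating
precisely at the marked points with label in `D`. -/
def AlternatesJ (P : TwistedSpin r M a b S) (D : Finset B) (w : ∀ p, JFiber S p) : Prop :=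
  P.IsLiftingJ M.openBdry w ∧ ∀ j, P.IsLegalJ M.openBdry w j ↔ j ∈ D

/-- An isomorphism (over the identity of `X`) between two twisted spin structures on `S`: a
holomorphic automorphism of `S` commuting with the involutions and with the maps to `ω`. -/
structure Iso (P Q : TwistedSpin r M a b S) where
  /-- the fibrewise isomorphisms -/
  f : ∀ p, S p ≃ₗ[ℂ] S p
  holomorphic : ∀ (U : Set X) (s : ∀ p, S p), IsOpen U → HolomorphicOn s U →
    HolomorphicOn (fun p => f p (s p)) U
  comm_inv : ∀ p v, f (M.φ p) (P.inv p v) = Q.inv p (f p v)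
  comm_τ : ∀ p v, rPow Q.τ p (f p v) = rPow P.τ p v

end TwistedSpin

/-- There are exactly two sections over `A` with the property `Q` up to equivalence, and they
are negatives of each other. -/
def ExactlyTwoNegatives {E : X → Type*} [∀ p, AddCommGroup (E p)] [∀ p, Module ℂ (E p)]
    (A : Set X) (Q : (∀ p, E p) → Prop) : Prop :=
  ∃ w : ∀ p, E p, Q w ∧ Q (-w) ∧ ¬ SectionEquiv A w (-w) ∧
    ∀ w', Q w' → SectionEquiv A w' w ∨ SectionEquiv A w' (-w)

end Spin

end

/-! Everything reduces to signs of real functions. Around a boundary point the sphere has a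
coordinate in which the conjugation is complex conjugation and the preferred half is the closed
upper half-plane (`MarkedDisk.exists_bdryCharts`). Over such a copy of `ℂ`, simple connectedness
yields a frame `σ` of `S`, invariant under the involution, with `τ(σ^r) = F dz` and `F = ± f`, where
`f` is a real polynomial with zeros prescribed by the twists (`TwistedSpin.exists_isRealFrame`). A
lifting of `S` is then `h σ` with `h` real, continuous and `h ^ r * F > 0`, and a marked point is
illegal exactly when `h` keeps a constant sign around it (`isIllegal_iff`). In the dual frame of
`J`, the coefficient of a lifting paired with `h σ` has the sign of `h`, so every statement about
`J` follows from the one about `S` (`TwistedSpin.Paired`).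

For odd `r` the sign of `h` is that of `F`. Hence liftings are unique up to equivalence, local ones
can be averaged by a partition of unity, and `h` changes sign at `x j` exactly when `F` does, that
is, when `b j` is odd.

For even `r` positivity of `h ^ r * F` only forces `F > 0`, whence the boundary twists are even,
while the sign of `h` on each arc is free. If the surface is connected, an unmarked boundary point
is put at infinity. Comparing the normalizations of the frames in the coordinates `z` and `y = -1 /
z` shows that they differ by `(-y) ^ k` with `r * k = 2 ∑ a + ∑ b + 2`, the final `2` coming from
the double pole of `dz` at infinity (`TwistedSpin.exists_globalFrame`). Around the boundary circle
the sign changes at the points of `D` must compensate the factor `(-1) ^ k`, which is the congruence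
(`even_card_add`). Conversely `∏ (t - e j) / (1 + t ^ 2) ^ n` with `2 n = |D| + k` has the
prescribed sign changes (`exists_alternates`), and the sign pattern is determined up to a global
sign (`sectionEquiv_or_neg`). The sign in `F = ± f` is common to both charts and must be positive
for liftings to exist; multiplying the frames by `ξ` reverses it (`IsRealFrame.rotated`), so one of
the two structures is compatible as soon as some `D` has the right parity. -/

noncomputable section

/-! ### Continuity of sections of vector bundles and of Hom bundles -/

section BundleContinuity

variable {Y X F : Type*} [TopologicalSpace Y] [TopologicalSpace X]
  [NormedAddCommGroup F] [NormedSpace ℂ F] {E : X → Type*}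
  [∀ p, AddCommGroup (E p)] [∀ p, Module ℂ (E p)] [TopologicalSpace (TotalSpace F E)]
  [∀ p, TopologicalSpace (E p)] [FiberBundle F E] [VectorBundle ℂ F E]
  {b : Y → X} {e e' : ∀ y, E (b y)} {h : Y → ℂ} {s : Set Y} {y₀ : Y}

/-- Using `linearMapAt`, which is zero off the base set, instead of the second component of the
trivialization keeps the coordinate linear in `e y` for every `y`, so scalar factors come out
without side conditions. -/
theorem continuousWithinAt_mk_iff :
    ContinuousWithinAt (fun y => (⟨b y, e y⟩ : TotalSpace F E)) s y₀ ↔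
      ContinuousWithinAt b s y₀ ∧ ContinuousWithinAt
        (fun y => (trivializationAt F E (b y₀)).linearMapAt ℂ (b y) (e y)) s y₀ := by
  rw [FiberBundle.continuousWithinAt_totalSpace]
  refine and_congr_right fun hb => ?_
  have hev : ∀ᶠ y in 𝓝[s] y₀, b y ∈ (trivializationAt F E (b y₀)).baseSet :=
    hb ((trivializationAt F E (b y₀)).open_baseSet.mem_nhds
      (FiberBundle.mem_baseSet_trivializationAt' _))
  have hev' : (fun y => (trivializationAt F E (b y₀)).linearMapAt ℂ (b y) (e y)) =ᶠ[𝓝[s] y₀]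
      fun y => ((trivializationAt F E (b y₀)) ⟨b y, e y⟩).2 := by
    filter_upwards [hev] with y hy
    rw [Trivialization.linearMapAt_apply, if_pos hy]
  refine ⟨fun H => H.congr_of_eventuallyEq hev' ?_, fun H => H.congr_of_eventuallyEq hev'.symm ?_⟩
  all_goals rw [Trivialization.linearMapAt_apply,
    if_pos (FiberBundle.mem_baseSet_trivializationAt' _)]

theorem ContinuousWithinAt.smul_total (hh : ContinuousWithinAt h s y₀)
    (he : ContinuousWithinAt (fun y => (⟨b y, e y⟩ : TotalSpace F E)) s y₀) :
    ContinuousWithinAt (fun y => (⟨b y, h y • e y⟩ : TotalSpace F E)) s y₀ := by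
  rw [continuousWithinAt_mk_iff] at he ⊢
  refine ⟨he.1, ?_⟩
  simp only [map_smul]
  exact hh.smul he.2

theorem linearMapAt_ne_zero {e : Trivialization F (π F E)} [MemTrivializationAtlas e] {p : X}
    (hp : p ∈ e.baseSet) {v : E p} (hv : v ≠ 0) : e.linearMapAt ℂ p v ≠ 0 := by
  intro h
  apply hv
  rw [← e.symmₗ_linearMapAt (R := ℂ) hp v, h, map_zero]

/-- The ratio of two continuous sections is continuous where the denominator does not vanish. -/
theorem ContinuousWithinAt.ratio_total
    (he : ContinuousWithinAt (fun y => (⟨b y, e y⟩ : TotalSpace F E)) s y₀)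
    (hhe : ContinuousWithinAt (fun y => (⟨b y, h y • e y⟩ : TotalSpace F E)) s y₀)
    (h0 : e y₀ ≠ 0) : ContinuousWithinAt h s y₀ := by
  rw [continuousWithinAt_mk_iff] at he hhe
  set T := fun y => (trivializationAt F E (b y₀)).linearMapAt ℂ (b y) (e y) with hT
  have hT0 : T y₀ ≠ 0 := linearMapAt_ne_zero (FiberBundle.mem_baseSet_trivializationAt' _) h0
  -- The model fibre `F` is arbitrary (for `J` it is a space of linear maps), so a functional that
  -- does not vanish at `T y₀` is used to turn both sections into scalar functions.
  obtain ⟨l, -, hl⟩ := exists_dual_vector ℂ (T y₀) (norm_ne_zero_iff.2 hT0)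
  have hl0 : l (T y₀) ≠ 0 := by
    rw [hl]; simpa using hT0
  have h1 : ContinuousWithinAt (fun y => l (T y)) s y₀ :=
    l.continuous.continuousAt.comp_continuousWithinAt he.2
  have h2 : ContinuousWithinAt (fun y => h y * l (T y)) s y₀ := by
    have := l.continuous.continuousAt.comp_continuousWithinAt hhe.2
    refine this.congr (fun y _ => ?_) ?_ <;> simp [hT]
  refine (h2.div h1 hl0).congr_of_eventuallyEq ?_ (mul_div_cancel_right₀ _ hl0).symm
  filter_upwards [h1.eventually_ne hl0] with y hy using (mul_div_cancel_right₀ _ hy).symm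

/-- A section of a bundle `Hom(E₁, E₂)`, with `E₁` a line bundle, is continuous if it maps a
continuous frame to a continuous section. -/
theorem continuousWithinAt_hom_of_apply {F₂ : Type*} [NormedAddCommGroup F₂] [NormedSpace ℂ F₂]
    {E₁ : X → Type*} [∀ p, AddCommGroup (E₁ p)] [∀ p, Module ℂ (E₁ p)]
    [TopologicalSpace (TotalSpace ℂ E₁)] [∀ p, TopologicalSpace (E₁ p)] [FiberBundle ℂ E₁]
    [VectorBundle ℂ ℂ E₁]
    {E₂ : X → Type*} [∀ p, AddCommGroup (E₂ p)] [∀ p, Module ℂ (E₂ p)]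
    [TopologicalSpace (TotalSpace F₂ E₂)] [∀ p, TopologicalSpace (E₂ p)] [FiberBundle F₂ E₂]
    [VectorBundle ℂ F₂ E₂] [∀ p, IsTopologicalAddGroup (E₂ p)] [∀ p, ContinuousSMul ℂ (E₂ p)]
    {e₁ : ∀ y, E₁ (b y)} {w : ∀ y, E₁ (b y) →L[ℂ] E₂ (b y)}
    (he : ContinuousWithinAt (fun y => (⟨b y, e₁ y⟩ : TotalSpace ℂ E₁)) s y₀) (h0 : e₁ y₀ ≠ 0)
    (hw : ContinuousWithinAt (fun y => (⟨b y, w y (e₁ y)⟩ : TotalSpace F₂ E₂)) s y₀) :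
    ContinuousWithinAt (fun y => (⟨b y, w y⟩ :
      TotalSpace (ℂ →L[ℂ] F₂) (fun p => E₁ p →L[ℂ] E₂ p))) s y₀ := by
  rw [continuousWithinAt_hom_bundle]
  rw [continuousWithinAt_mk_iff] at he hw
  refine ⟨he.1, ?_⟩
  set T₁ := fun y => (trivializationAt ℂ E₁ (b y₀)).linearMapAt ℂ (b y) (e₁ y) with hT₁
  set T₂ := fun y => (trivializationAt F₂ E₂ (b y₀)).linearMapAt ℂ (b y) (w y (e₁ y)) with hT₂
  have hT0 : T₁ y₀ ≠ 0 := linearMapAt_ne_zero (FiberBundle.mem_baseSet_trivializationAt' _) h0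
  have hb1 : ∀ᶠ y in 𝓝[s] y₀, b y ∈ (trivializationAt ℂ E₁ (b y₀)).baseSet :=
    he.1 ((trivializationAt ℂ E₁ (b y₀)).open_baseSet.mem_nhds
      (FiberBundle.mem_baseSet_trivializationAt' _))
  have hb2 : ∀ᶠ y in 𝓝[s] y₀, b y ∈ (trivializationAt F₂ E₂ (b y₀)).baseSet :=
    he.1 ((trivializationAt F₂ E₂ (b y₀)).open_baseSet.mem_nhds
      (FiberBundle.mem_baseSet_trivializationAt' _))
  -- In coordinates `w y` sends `T₁ y` to `T₂ y`; as the source is one-dimensional, this determines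
  -- it wherever `T₁ y ≠ 0`.
  have key : ∀ y, b y ∈ (trivializationAt ℂ E₁ (b y₀)).baseSet →
      b y ∈ (trivializationAt F₂ E₂ (b y₀)).baseSet → T₁ y ≠ 0 →
      ContinuousLinearMap.inCoordinates ℂ E₁ F₂ E₂ (b y₀) (b y) (b y₀) (b y) (w y) =
      (T₁ y)⁻¹ • (ContinuousLinearMap.toSpanSingleton ℂ (T₂ y)) := by
    intro y h1 h2 h3
    ext
    rw [ContinuousLinearMap.inCoordinates_eq h1 h2]
    have : ((trivializationAt ℂ E₁ (b y₀)).continuousLinearEquivAt ℂ (b y) h1).symm (1 : ℂ) =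
        (T₁ y)⁻¹ • e₁ y := by
      rw [ContinuousLinearEquiv.symm_apply_eq, map_smul]
      have : ((trivializationAt ℂ E₁ (b y₀)).continuousLinearEquivAt ℂ (b y) h1) (e₁ y) = T₁ y := by
        simp [hT₁, Trivialization.linearMapAt_apply, h1]
      rw [this, smul_eq_mul, inv_mul_cancel₀ h3]
    simp only [ContinuousLinearMap.comp_apply, ContinuousLinearEquiv.coe_coe, this, map_smul,
      smul_apply, ContinuousLinearMap.toSpanSingleton_apply, one_smul]
    congr 1
    simp [hT₂, Trivialization.linearMapAt_apply, h2]
  refine ContinuousWithinAt.congr_of_eventuallyEq (f := fun y => (T₁ y)⁻¹ •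
    (ContinuousLinearMap.toSpanSingleton ℂ (T₂ y))) ?_ ?_ ?_
  · refine (he.2.inv₀ hT0).smul ?_
    exact ((ContinuousLinearMap.toSpanSingletonCLE (𝕜 := ℂ) (E := F₂)).continuous).continuousAt.comp_continuousWithinAt hw.2
  · filter_upwards [hb1, hb2, he.2.eventually_ne hT0] with y h1 h2 h3 using key y h1 h2 h3
  · exact key y₀ (FiberBundle.mem_baseSet_trivializationAt' _)
      (FiberBundle.mem_baseSet_trivializationAt' _) hT0

theorem exists_smul_eq_of_ne_zero {E : X → Type*} [∀ p, AddCommGroup (E p)] [∀ p, Module ℂ (E p)]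
    [TopologicalSpace (TotalSpace ℂ E)] [∀ p, TopologicalSpace (E p)] [FiberBundle ℂ E]
    [VectorBundle ℂ ℂ E] {p : X} {w : E p} (hw : w ≠ 0) (v : E p) : ∃ c : ℂ, v = c • w := by
  set T := (trivializationAt ℂ E p).continuousLinearEquivAt ℂ p
    (FiberBundle.mem_baseSet_trivializationAt' _)
  have h0 : T w ≠ 0 := by simpa using hw
  refine ⟨T v / T w, T.injective ?_⟩
  rw [map_smul, smul_eq_mul, div_mul_cancel₀ _ h0]

/-- The linear form on a fibre of a line bundle taking the value `1` at `w ≠ 0`. -/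
def fiberDual {E : X → Type*} [∀ p, AddCommGroup (E p)] [∀ p, Module ℂ (E p)]
    [TopologicalSpace (TotalSpace ℂ E)] [∀ p, TopologicalSpace (E p)] [FiberBundle ℂ E]
    [VectorBundle ℂ ℂ E] {p : X} (w : E p) : E p →L[ℂ] ℂ :=
  ((trivializationAt ℂ E p).continuousLinearEquivAt ℂ p
    (FiberBundle.mem_baseSet_trivializationAt' _) w)⁻¹ •
  ((trivializationAt ℂ E p).continuousLinearEquivAt ℂ p
    (FiberBundle.mem_baseSet_trivializationAt' _)).toContinuousLinearMap

theorem fiberDual_self {E : X → Type*} [∀ p, AddCommGroup (E p)] [∀ p, Module ℂ (E p)]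
    [TopologicalSpace (TotalSpace ℂ E)] [∀ p, TopologicalSpace (E p)] [FiberBundle ℂ E]
    [VectorBundle ℂ ℂ E] {p : X} {w : E p} (hw : w ≠ 0) : fiberDual w w = 1 := by
  set T := (trivializationAt ℂ E p).continuousLinearEquivAt ℂ p
    (FiberBundle.mem_baseSet_trivializationAt' _) with hT
  have h0 : T w ≠ 0 := by simpa using hw
  change (T w)⁻¹ • (T w) = 1
  rw [smul_eq_mul, inv_mul_cancel₀ h0]

end BundleContinuity

/-! ### Holomorphic parametrizations by the complex plane -/

section Parametrizations

variable {X : Type*} [TopologicalSpace X] [ChartedSpace ℂ X]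

/-- The velocity vector of a parametrization. -/
def vel (ψ : ℂ → X) (z : ℂ) : ℂ := mfderiv 𝓘(ℂ) 𝓘(ℂ) ψ z (1 : ℂ)

/-- A holomorphic parametrization of an open subset of a Riemann surface by `ℂ`. -/
structure IsParam (ψ : ℂ → X) : Prop where
  contMDiff : ContMDiff 𝓘(ℂ) 𝓘(ℂ) ω ψ
  injective : Function.Injective ψ
  vel_ne_zero : ∀ z, vel ψ z ≠ 0

/-- The tangent space at `ψ z` is a copy of `ℂ` through the preferred chart at that very point, so
the chart in which the velocity is measured moves with `z`. -/
theorem vel_eq_deriv {ψ : ℂ → X} {z : ℂ} (h : MDifferentiableAt 𝓘(ℂ) 𝓘(ℂ) ψ z) :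
    vel ψ z = deriv (chartAt ℂ (ψ z) ∘ ψ) z := by
  have h1 : HasMFDerivAt 𝓘(ℂ) 𝓘(ℂ) ψ z (fderiv ℂ (chartAt ℂ (ψ z) ∘ ψ) z) := by
    refine ⟨h.continuousAt, ?_⟩
    have h2 := h.differentiableWithinAt_writtenInExtChartAt
    simp only [writtenInExtChartAt, mfld_simps, differentiableWithinAt_univ] at h2 ⊢
    exact h2.hasFDerivAt.hasFDerivWithinAt
  exact congrArg (fun L : ℂ →L[ℂ] ℂ => L 1) h1.mfderiv

theorem vel_comp_of_eventuallyEq {ψ ψ' : ℂ → X} {g : ℂ → ℂ} {w : ℂ}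
    (hψ : MDifferentiableAt 𝓘(ℂ) 𝓘(ℂ) ψ (g w)) (hg : DifferentiableAt ℂ g w)
    (h : ψ' =ᶠ[𝓝 w] ψ ∘ g) : vel ψ' w = deriv g w * vel ψ (g w) := by
  have hgm : MDifferentiableAt 𝓘(ℂ) 𝓘(ℂ) g w := hg.mdifferentiableAt
  have h1 : vel ψ' w = (mfderiv 𝓘(ℂ) 𝓘(ℂ) ψ (g w) : ℂ →L[ℂ] ℂ) (fderiv ℂ g w 1) := by
    refine (congrArg (fun L : ℂ →L[ℂ] ℂ => L 1) (h.mfderiv_eq.trans (mfderiv_comp w hψ hgm))).trans ?_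
    rw [mfderiv_eq_fderiv]
    rfl
  have h2 : fderiv ℂ g w (1 : ℂ) = deriv g w • (1 : ℂ) := by simp
  rw [h1, h2]
  exact (mfderiv 𝓘(ℂ) 𝓘(ℂ) ψ (g w) : ℂ →L[ℂ] ℂ).map_smul _ _

set_option linter.unusedSectionVars false
variable [IsManifold 𝓘(ℂ) ω X]

theorem analyticAt_chart_comp {ψ : ℂ → X} {z : ℂ} (h : ContMDiffAt 𝓘(ℂ) 𝓘(ℂ) ω ψ z) {p : X}
    (hp : ψ z ∈ (chartAt ℂ p).source) : AnalyticAt ℂ (chartAt ℂ p ∘ ψ) z := by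
  have h1 : ContMDiffAt 𝓘(ℂ) 𝓘(ℂ) ω (chartAt ℂ p) (ψ z) :=
    (contMDiffOn_of_mem_maximalAtlas (IsManifold.chart_mem_maximalAtlas p)).contMDiffAt
      ((chartAt ℂ p).open_source.mem_nhds hp)
  have h2 : ContMDiffAt 𝓘(ℂ) 𝓘(ℂ) ω (chartAt ℂ p ∘ ψ) z := h1.comp z h
  exact (contMDiffAt_iff_contDiffAt.1 h2).analyticAt

/-- This passes from the chart at a fixed `p`, used in `rPowCoeff`, to the moving tangent coordinate
implicit in `vel`: it is the chain rule for `ψ = chart⁻¹ ∘ (chart ∘ ψ)`. -/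
theorem mfderiv_chart_symm_deriv {ψ : ℂ → X} {z : ℂ} (h : ContMDiffAt 𝓘(ℂ) 𝓘(ℂ) ω ψ z) {p : X}
    (hp : ψ z ∈ (chartAt ℂ p).source) :
    vel (chartAt ℂ p).symm (chartAt ℂ p (ψ z)) * deriv (chartAt ℂ p ∘ ψ) z = vel ψ z := by
  have h1 : ContMDiffAt 𝓘(ℂ) 𝓘(ℂ) ω (chartAt ℂ p).symm (chartAt ℂ p (ψ z)) :=
    (contMDiffOn_symm_of_mem_maximalAtlas (IsManifold.chart_mem_maximalAtlas p)).contMDiffAt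
      ((chartAt ℂ p).open_target.mem_nhds ((chartAt ℂ p).map_source hp))
  have hd := (analyticAt_chart_comp h hp).differentiableAt
  have hev : ψ =ᶠ[𝓝 z] (chartAt ℂ p).symm ∘ (chartAt ℂ p ∘ ψ) := by
    filter_upwards [h.continuousAt.preimage_mem_nhds
      ((chartAt ℂ p).open_source.mem_nhds hp)] with w hw
    exact ((chartAt ℂ p).left_inv hw).symm
  rw [vel_comp_of_eventuallyEq (h1.mdifferentiableAt (by simp)) hd hev, mul_comm]
  rfl

namespace IsParam

variable {ψ : ℂ → X}

theorem mdifferentiableAt (hψ : IsParam ψ) (z : ℂ) : MDifferentiableAt 𝓘(ℂ) 𝓘(ℂ) ψ z :=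
  hψ.contMDiff.contMDiffAt.mdifferentiableAt (by simp)

theorem deriv_chart_ne_zero (hψ : IsParam ψ) {z : ℂ} {p : X}
    (hp : ψ z ∈ (chartAt ℂ p).source) : deriv (chartAt ℂ p ∘ ψ) z ≠ 0 := by
  intro h0
  have := mfderiv_chart_symm_deriv hψ.contMDiff.contMDiffAt hp
  rw [h0, mul_zero] at this
  exact hψ.vel_ne_zero z this.symm

theorem hasStrictDerivAt (hψ : IsParam ψ) (z : ℂ) :
    HasStrictDerivAt (chartAt ℂ (ψ z) ∘ ψ) (deriv (chartAt ℂ (ψ z) ∘ ψ) z) z :=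
  (analyticAt_chart_comp hψ.contMDiff.contMDiffAt (mem_chart_source ℂ _)).hasStrictDerivAt

theorem map_nhds (hψ : IsParam ψ) (z : ℂ) : map ψ (𝓝 z) = 𝓝 (ψ z) := by
  have h1 := (hψ.hasStrictDerivAt z).map_nhds_eq
    (hψ.deriv_chart_ne_zero (mem_chart_source ℂ _))
  have h2 : ψ =ᶠ[𝓝 z] (chartAt ℂ (ψ z)).symm ∘ (chartAt ℂ (ψ z) ∘ ψ) := by
    filter_upwards [hψ.contMDiff.continuous.continuousAt.preimage_mem_nhds
      ((chartAt ℂ (ψ z)).open_source.mem_nhds (mem_chart_source ℂ _))] with w hw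
    exact ((chartAt ℂ (ψ z)).left_inv hw).symm
  rw [map_congr h2, ← Filter.map_map, h1]
  exact (chartAt ℂ (ψ z)).symm_map_nhds_eq (mem_chart_source ℂ _)

theorem isOpenEmbedding (hψ : IsParam ψ) : IsOpenEmbedding ψ :=
  IsOpenEmbedding.of_continuous_injective_isOpenMap hψ.contMDiff.continuous hψ.injective
    (IsOpenMap.of_nhds_le fun z => (hψ.map_nhds z).ge)

/-- A continuous lift of a holomorphic map through a parametrization is holomorphic. -/
theorem differentiableAt_lift (hψ : IsParam ψ) {χ : ℂ → X} {g : ℂ → ℂ} {z : ℂ}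
    (hχ : DifferentiableAt ℂ (chartAt ℂ (χ z) ∘ χ) z) (hg : ContinuousAt g z)
    (h : ∀ᶠ w in 𝓝 z, χ w = ψ (g w)) : DifferentiableAt ℂ g z := by
  have hz : χ z = ψ (g z) := h.self_of_nhds
  rw [hz] at hχ
  have h0 := hψ.deriv_chart_ne_zero (mem_chart_source ℂ (ψ (g z)))
  have hs := hψ.hasStrictDerivAt (g z)
  have hL := (hs.to_localInverse h0).hasDerivAt.differentiableAt
  have hid := hs.hasStrictFDerivAt_equiv h0 |>.eventually_left_inverse
  have hL' : DifferentiableAt ℂ (hs.localInverse _ _ _ h0)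
      ((chartAt ℂ (ψ (g z)) ∘ χ) z) := by
    simpa [hz] using hL
  -- Near `z` the lift is the local inverse of `chart ∘ ψ` applied to `chart ∘ χ`; continuity of `g`
  -- keeps its values where this inverse is valid.
  refine (hL'.comp z hχ).congr_of_eventuallyEq ?_
  filter_upwards [h, hg.eventually hid] with w hw hw'
  simp only [Function.comp_apply, hw]
  exact hw'.symm

theorem comp_contMDiffAt (hψ : IsParam ψ) {ψ' : ℂ → X} {g : ℂ → ℂ} {w : ℂ}
    (hg : AnalyticAt ℂ g w) (h : ψ' =ᶠ[𝓝 w] ψ ∘ g) : ContMDiffAt 𝓘(ℂ) 𝓘(ℂ) ω ψ' w := by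
  have h1 : ContMDiffAt 𝓘(ℂ) 𝓘(ℂ) ω g w := contMDiffAt_iff_contDiffAt.2 hg.contDiffAt
  exact (hψ.contMDiff.contMDiffAt.comp w h1).congr_of_eventuallyEq h

theorem comp_vel_ne_zero (hψ : IsParam ψ) {ψ' : ℂ → X} {g : ℂ → ℂ} {w : ℂ}
    (hg : AnalyticAt ℂ g w) (hg' : deriv g w ≠ 0) (h : ψ' =ᶠ[𝓝 w] ψ ∘ g) : vel ψ' w ≠ 0 := by
  have := vel_comp_of_eventuallyEq (hψ.mdifferentiableAt (g w)) hg.differentiableAt h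
  intro h0
  rw [h0] at this
  exact mul_ne_zero hg' (hψ.vel_ne_zero (g w)) this.symm

theorem continuous_vel (hψ : IsParam ψ) :
    Continuous (fun z => (⟨ψ z, vel ψ z⟩ : TangentBundle 𝓘(ℂ) X)) := by
  have h1 : Continuous (tangentMap 𝓘(ℂ) 𝓘(ℂ) ψ) :=
    hψ.contMDiff.continuous_tangentMap (by simp)
  have h2 : Continuous (fun z : ℂ => (⟨z, (1 : ℂ)⟩ : TangentBundle 𝓘(ℂ) ℂ)) :=
    (tangentBundleModelSpaceHomeomorph 𝓘(ℂ)).symm.continuous.comp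
      (continuous_id.prodMk continuous_const)
  exact h1.comp h2

theorem of_chart_symm {e : OpenPartialHomeomorph X ℂ}
    (he : e ∈ IsManifold.maximalAtlas 𝓘(ℂ) ω X) (ht : e.target = univ) : IsParam e.symm := by
  have hc : ContMDiff 𝓘(ℂ) 𝓘(ℂ) ω e.symm := by
    rw [← contMDiffOn_univ, ← ht]
    exact contMDiffOn_symm_of_mem_maximalAtlas he
  refine ⟨hc, fun z w h => ?_, fun z h0 => ?_⟩
  · have := congrArg e h
    rwa [e.right_inv (ht ▸ mem_univ z), e.right_inv (ht ▸ mem_univ w)] at this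
  · have h1 : MDifferentiableAt 𝓘(ℂ) 𝓘(ℂ) e (e.symm z) :=
      ((contMDiffOn_of_mem_maximalAtlas he).contMDiffAt
        (e.open_source.mem_nhds (e.map_target (ht ▸ mem_univ z)))).mdifferentiableAt (by simp)
    have h2 := mfderiv_comp z h1 (hc.contMDiffAt.mdifferentiableAt (by simp))
    have h3 : e ∘ e.symm = id := by
      funext w; exact e.right_inv (ht ▸ mem_univ w)
    have h4 : vel (e ∘ e.symm) z = (mfderiv 𝓘(ℂ) 𝓘(ℂ) e (e.symm z) : ℂ →L[ℂ] ℂ) (vel e.symm z) :=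
      congrArg (fun L : ℂ →L[ℂ] ℂ => L 1) h2
    have h5 : vel (id : ℂ → ℂ) z = 1 :=
      congrArg (fun L : ℂ →L[ℂ] ℂ => L 1) (mfderiv_id (I := 𝓘(ℂ)) (x := z))
    rw [h3, h5, h0] at h4
    exact one_ne_zero (α := ℂ) (h4.trans (mfderiv 𝓘(ℂ) 𝓘(ℂ) e (e.symm z) : ℂ →L[ℂ] ℂ).map_zero)

end IsParam

end Parametrizations

/-! ### Pairs of charts of the Riemann sphere -/

section SpherePairs

set_option linter.unusedSectionVars false
variable {X : Type*} [TopologicalSpace X] [ChartedSpace ℂ X] [IsManifold 𝓘(ℂ) ω X]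

/-- Two parametrizations of a Riemann sphere `K`, glued by `z ↦ -1 / z`. -/
structure IsSpherePair (K : Set X) (ψ₀ ψ₁ : ℂ → X) : Prop where
  param₀ : IsParam ψ₀
  param₁ : IsParam ψ₁
  glue : ∀ y, y ≠ 0 → ψ₁ y = ψ₀ (-y⁻¹)
  notMem : ψ₁ 0 ∉ range ψ₀
  cover : range ψ₀ ∪ {ψ₁ 0} = K

theorem analyticAt_neg_inv {y : ℂ} (hy : y ≠ 0) : AnalyticAt ℂ (fun y : ℂ => -y⁻¹) y :=
  (analyticAt_inv hy).neg

theorem deriv_neg_inv_ne_zero {y : ℂ} (hy : y ≠ 0) : deriv (fun y : ℂ => -y⁻¹) y ≠ 0 := by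
  rw [deriv.fun_neg, deriv_inv]
  simpa using hy

namespace IsSpherePair

variable {K : Set X} {ψ₀ ψ₁ : ℂ → X}

theorem symm (h : IsSpherePair K ψ₀ ψ₁) : IsSpherePair K ψ₁ ψ₀ := by
  have hg : ∀ y, y ≠ 0 → ψ₀ y = ψ₁ (-y⁻¹) := fun y hy => by
    rw [h.glue _ (neg_ne_zero.2 (inv_ne_zero hy))]
    simp [inv_neg]
  refine ⟨h.param₁, h.param₀, hg, ?_, ?_⟩
  · rintro ⟨y, hy⟩
    rcases eq_or_ne y 0 with rfl | hy0
    · exact h.notMem ⟨0, hy.symm⟩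
    · rw [h.glue y hy0] at hy
      have := h.param₀.injective hy
      simp [hy0] at this
  · rw [← h.cover]
    ext p
    constructor
    · rintro (⟨y, rfl⟩ | rfl)
      · rcases eq_or_ne y 0 with rfl | hy0
        · exact Or.inr rfl
        · exact Or.inl ⟨_, (h.glue y hy0).symm⟩
      · exact Or.inl ⟨0, rfl⟩
    · rintro (⟨y, rfl⟩ | rfl)
      · rcases eq_or_ne y 0 with rfl | hy0
        · exact Or.inr rfl
        · exact Or.inl ⟨_, (hg y hy0).symm⟩
      · exact Or.inl ⟨0, rfl⟩

/-- Affine maps are coordinate changes of the sphere fixing infinity: near `0` the new second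
parametrization is `ψ₁` composed with `y / (l - m * y)`, which is holomorphic with derivative `l⁻¹`
at `0`. -/
theorem affine (h : IsSpherePair K ψ₀ ψ₁) {l : ℂ} (hl : l ≠ 0) (m : ℂ) :
    ∃ ψ₁' : ℂ → X, IsSpherePair K (fun z => ψ₀ (l * z + m)) ψ₁' ∧ ψ₁' 0 = ψ₁ 0 := by
  set ψ₁' : ℂ → X := fun y => if y = 0 then ψ₁ 0 else ψ₀ (l * (-y⁻¹) + m) with hψ₁'
  have h0 : ψ₁' 0 = ψ₁ 0 := by simp [hψ₁']
  have hne : ∀ y, y ≠ 0 → ψ₁' y = ψ₀ (l * (-y⁻¹) + m) := fun y hy => by simp [hψ₁', hy]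
  have hd : ∀ z, HasDerivAt (fun z : ℂ => l * z + m) l z := fun z => by
    simpa using ((hasDerivAt_id z).const_mul l).add_const m
  have ha : ∀ z, AnalyticAt ℂ (fun z : ℂ => l * z + m) z := fun z =>
    (analyticAt_const.mul analyticAt_id).add analyticAt_const
  have hev : ∀ y, y ≠ 0 → ψ₁' =ᶠ[𝓝 y] ψ₀ ∘ (fun y => l * (-y⁻¹) + m) := fun y hy => by
    filter_upwards [isOpen_ne.mem_nhds hy] with w hw using hne w hw
  have hga : ∀ y, y ≠ 0 → AnalyticAt ℂ (fun y => l * (-y⁻¹) + m) y := fun y hy =>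
    (analyticAt_const.mul (analyticAt_neg_inv hy)).add analyticAt_const
  have hgd : ∀ y, y ≠ 0 → deriv (fun y => l * (-y⁻¹) + m) y ≠ 0 := fun y hy => by
    have : HasDerivAt (fun y => l * (-y⁻¹) + m) (l * deriv (fun y : ℂ => -y⁻¹) y) y :=
      ((analyticAt_neg_inv hy).differentiableAt.hasDerivAt.const_mul l).add_const m
    rw [this.deriv]
    exact mul_ne_zero hl (deriv_neg_inv_ne_zero hy)
  have hev0 : ψ₁' =ᶠ[𝓝 0] ψ₁ ∘ (fun y => y / (l - m * y)) := by
    have hcont : ContinuousAt (fun y : ℂ => l - m * y) 0 := by fun_prop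
    filter_upwards [hcont.eventually_ne (by simpa using hl)] with y hy
    rcases eq_or_ne y 0 with rfl | hy0
    · simp [h0]
    · rw [hne y hy0, Function.comp_apply, h.glue _ (div_ne_zero hy0 hy)]
      congr 1
      field_simp
      ring
  have hq : HasDerivAt (fun y : ℂ => y / (l - m * y)) (l⁻¹) 0 := by
    have h2 : HasDerivAt (fun y : ℂ => l - m * y) (-m) 0 := by
      simpa using ((hasDerivAt_id (0 : ℂ)).const_mul m).const_sub l
    have := (hasDerivAt_id (0 : ℂ)).div h2 (by simpa using hl)
    have hv : (1 * (l - m * 0) - id 0 * -m) / (l - m * 0) ^ 2 = l⁻¹ := by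
      simp only [mul_zero, sub_zero, id, zero_mul, one_mul]
      field_simp
    rw [hv] at this
    exact this
  have hqa : AnalyticAt ℂ (fun y : ℂ => y / (l - m * y)) 0 :=
    analyticAt_id.div (analyticAt_const.sub (analyticAt_const.mul analyticAt_id)) (by simpa using hl)
  refine ⟨ψ₁', ⟨⟨fun z => ?_, fun z w hzw => ?_, fun z => ?_⟩, ⟨fun y => ?_, fun z w hzw => ?_,
    fun y => ?_⟩, fun y hy => hne y hy, ?_, ?_⟩, h0⟩
  · exact h.param₀.comp_contMDiffAt (ha z) (EventuallyEq.refl _ _)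
  · have := h.param₀.injective hzw
    simpa [hl] using this
  · exact h.param₀.comp_vel_ne_zero (ha z) (by rw [(hd z).deriv]; exact hl) (EventuallyEq.refl _ _)
  · rcases eq_or_ne y 0 with rfl | hy0
    · exact h.param₁.comp_contMDiffAt hqa hev0
    · exact h.param₀.comp_contMDiffAt (hga y hy0) (hev y hy0)
  · rcases eq_or_ne z 0 with rfl | hz0 <;> rcases eq_or_ne w 0 with rfl | hw0
    · rfl
    · rw [h0, hne w hw0] at hzw
      exact absurd ⟨_, hzw.symm⟩ h.notMem
    · rw [h0, hne z hz0] at hzw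
      exact absurd ⟨_, hzw⟩ h.notMem
    · rw [hne z hz0, hne w hw0] at hzw
      simpa [hl] using h.param₀.injective hzw
  · rcases eq_or_ne y 0 with rfl | hy0
    · exact h.param₁.comp_vel_ne_zero hqa (by rw [hq.deriv]; exact inv_ne_zero hl) hev0
    · exact h.param₀.comp_vel_ne_zero (hga y hy0) (hgd y hy0) (hev y hy0)
  · rw [h0]
    rintro ⟨z, hz⟩
    exact h.notMem ⟨_, hz⟩
  · rw [h0, ← h.cover]
    congr 1
    ext p
    constructor
    · rintro ⟨z, rfl⟩; exact ⟨_, rfl⟩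
    · rintro ⟨z, rfl⟩
      refine ⟨(z - m) / l, ?_⟩
      simp only
      congr 1
      field_simp
      ring

end IsSpherePair

/-- Reversing the sign of the second coordinate turns the gluing `1 / z` into `-1 / z`, which
preserves the upper half-plane. This allows both charts of a pair to be boundary charts. -/
theorem IsRiemannSphere.exists_pair {K : Set X} (h : IsRiemannSphere K) :
    ∃ ψ₀ ψ₁ : ℂ → X, IsSpherePair K ψ₀ ψ₁ := by
  obtain ⟨e₀, he₀, e₁, he₁, ht₀, ht₁, hK, h01, h10, hinv⟩ := h
  have hp₁ := IsParam.of_chart_symm he₁ ht₁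
  have hd : ∀ z : ℂ, HasDerivAt (fun z : ℂ => -z) (-1) z := fun z => hasDerivAt_neg z
  have ha : ∀ z : ℂ, AnalyticAt ℂ (fun z : ℂ => -z) z := fun z => analyticAt_id.neg
  have hm₀ : ∀ z, e₀.symm z ∈ e₀.source := fun z => e₀.map_target (ht₀ ▸ mem_univ z)
  have hm₁ : ∀ z, e₁.symm z ∈ e₁.source := fun z => e₁.map_target (ht₁ ▸ mem_univ z)
  have hr₀ : ∀ z, e₀ (e₀.symm z) = z := fun z => e₀.right_inv (ht₀ ▸ mem_univ z)
  have hr₁ : ∀ z, e₁ (e₁.symm z) = z := fun z => e₁.right_inv (ht₁ ▸ mem_univ z)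
  have hn : e₁.symm 0 ∉ e₀.source := fun hmem => by
    have := (h10 _ (hm₁ 0)).1 hmem
    exact this (hr₁ 0)
  refine ⟨e₀.symm, fun y => e₁.symm (-y), IsParam.of_chart_symm he₀ ht₀, ⟨fun z => ?_,
    fun z w hzw => ?_, fun z => ?_⟩, fun y hy => ?_, ?_, ?_⟩
  · exact hp₁.comp_contMDiffAt (ha z) (EventuallyEq.refl _ _)
  · simpa using hp₁.injective hzw
  · exact hp₁.comp_vel_ne_zero (ha z) (by rw [(hd z).deriv]; simp) (EventuallyEq.refl _ _)
  · have hmem : e₁.symm (-y) ∈ e₀.source := (h10 _ (hm₁ _)).2 (by rw [hr₁]; simpa using hy)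
    have h1 := hinv _ ⟨hmem, hm₁ _⟩
    rw [hr₁] at h1
    rw [← e₀.left_inv hmem]
    congr 1
    rw [← inv_inv (e₀ _), ← h1, inv_neg]
  · rintro ⟨z, hz⟩
    apply hn
    rw [← neg_zero, ← hz]
    exact hm₀ z
  · rw [← hK]
    ext p
    constructor
    · rintro (⟨z, rfl⟩ | rfl)
      · exact Or.inl (hm₀ z)
      · exact Or.inr (hm₁ _)
    · intro hp
      by_cases hp0 : p ∈ e₀.source
      · exact Or.inl ⟨e₀ p, e₀.left_inv hp0⟩
      · right
        have hp1 : p ∈ e₁.source := hp.resolve_left hp0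
        have : e₁ p = 0 := by
          by_contra hne
          exact hp0 ((h10 p hp1).2 hne)
        rw [mem_singleton_iff, neg_zero, ← this, e₁.left_inv hp1]

/-- The second point of a pair can be placed anywhere. -/
theorem IsRiemannSphere.exists_pair_at {K : Set X} (h : IsRiemannSphere K) {q : X} (hq : q ∈ K) :
    ∃ ψ₀ ψ₁ : ℂ → X, IsSpherePair K ψ₀ ψ₁ ∧ ψ₁ 0 = q := by
  obtain ⟨ψ₀, ψ₁, hp⟩ := h.exists_pair
  rw [← hp.cover] at hq
  rcases hq with ⟨c, rfl⟩ | rfl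
  -- Translating moves the given point to the parameter `0`; then the two charts are exchanged.
  · obtain ⟨ψ₁', hp', -⟩ := hp.affine one_ne_zero c
    exact ⟨ψ₁', _, hp'.symm, by simp⟩
  · exact ⟨ψ₀, ψ₁, hp, rfl⟩

/-- An entire function of at most linear growth is affine. -/
theorem exists_affine_of_linear_growth {g : ℂ → ℂ} (hg : Differentiable ℂ g) {C R : ℝ}
    (h : ∀ z, R ≤ ‖z‖ → ‖g z‖ ≤ C * ‖z‖) : ∃ a b : ℂ, ∀ z, g z = a * z + b := by
  obtain ⟨B, hB⟩ := (isCompact_closedBall (0 : ℂ) |R|).exists_bound_of_continuousOn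
    hg.continuous.continuousOn
  have hB0 : 0 ≤ B := (norm_nonneg _).trans (hB 0 (by simp))
  have hbd : ∀ z, ‖g z‖ ≤ |C| * ‖z‖ + B := fun z => by
    by_cases hz : R ≤ ‖z‖
    · have := h z hz
      have h2 : C * ‖z‖ ≤ |C| * ‖z‖ := mul_le_mul_of_nonneg_right (le_abs_self C) (norm_nonneg z)
      linarith
    · have := hB z (by rw [mem_closedBall_zero_iff]; exact (not_le.1 hz).le.trans (le_abs_self R))
      have : 0 ≤ |C| * ‖z‖ := by positivity
      linarith
  -- Cauchy's estimate on a circle of radius `‖z‖ + 1`, comparable to `‖z‖`, bounds the derivative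
  -- uniformly, and Liouville's theorem makes it constant.
  have hderiv : ∀ z, ‖deriv g z‖ ≤ 2 * |C| + B := fun z => by
    have hr : (0 : ℝ) < ‖z‖ + 1 := by positivity
    have h1 := Complex.norm_deriv_le_of_forall_mem_sphere_norm_le (c := z) (f := g) hr
      hg.diffContOnCl (C := (2 * |C| + B) * (‖z‖ + 1)) (fun w hw => by
        have h2 : ‖w‖ ≤ 2 * ‖z‖ + 1 := by
          have h3 : ‖w - z‖ = ‖z‖ + 1 := by simpa [dist_eq_norm] using hw
          have h4 : ‖w‖ ≤ ‖w - z‖ + ‖z‖ := by simpa using norm_add_le (w - z) z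
          linarith
        have h5 := hbd w
        have h6 : |C| * ‖w‖ ≤ |C| * (2 * ‖z‖ + 1) := mul_le_mul_of_nonneg_left h2 (abs_nonneg C)
        nlinarith [abs_nonneg C, norm_nonneg z, mul_nonneg hB0 (norm_nonneg z)])
    rwa [mul_div_cancel_right₀ _ hr.ne'] at h1
  have hconst : ∀ z w, deriv g z = deriv g w := by
    refine hg.deriv.apply_eq_apply_of_bounded ?_
    rw [isBounded_iff_forall_norm_le]
    exact ⟨_, by rintro _ ⟨z, rfl⟩; exact hderiv z⟩
  refine ⟨deriv g 0, g 0, fun z => ?_⟩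
  have hF : Differentiable ℂ (fun z => g z - deriv g 0 * z) :=
    hg.sub (differentiable_id.const_mul _)
  have h0 : ∀ z, deriv (fun z => g z - deriv g 0 * z) z = 0 := fun z => by
    have h1 : HasDerivAt (fun z => g z - deriv g 0 * z) (deriv g z - deriv g 0 * 1) z :=
      (hg z).hasDerivAt.sub ((hasDerivAt_id z).const_mul _)
    rw [h1.deriv, hconst z 0]; ring
  have := is_const_of_deriv_eq_zero hF h0 z 0
  simp only [mul_zero, sub_zero] at this
  rw [← this]; ring

end SpherePairs

/-! ### Normal form of the conjugation and of the preferred half -/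

section BoundaryCharts

set_option linter.unusedSectionVars false
variable {X : Type*} [TopologicalSpace X] [ChartedSpace ℂ X] [IsManifold 𝓘(ℂ) ω X]
  {I B : Type*}

/-- A parametrization in which the conjugation is the complex conjugation and the preferred half
is the closed upper half-plane. -/
structure IsBdryChart (M : MarkedDisk X I B) (ψ : ℂ → X) : Prop extends IsParam ψ where
  conj : ∀ z, M.φ (ψ z) = ψ (starRingEnd ℂ z)
  half : ∀ z, ψ z ∈ M.half ↔ 0 ≤ z.im

/-- Precomposing with complex conjugation as well makes `φ ∘ ψ` holomorphic, so theorems on entire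
functions become available. -/
theorem IsAntiholomorphic.differentiableAt_chart {φ : X → X} (hφ : IsAntiholomorphic φ)
    {ψ : ℂ → X} (hψ : IsParam ψ) (z : ℂ) :
    DifferentiableAt ℂ (chartAt ℂ (φ (ψ (starRingEnd ℂ z))) ∘
      fun z => φ (ψ (starRingEnd ℂ z))) z := by
  set p := ψ (starRingEnd ℂ z) with hp
  have h1 : DifferentiableAt ℂ (chartAt ℂ p ∘ ψ) (starRingEnd ℂ z) :=
    (analyticAt_chart_comp hψ.contMDiff.contMDiffAt (mem_chart_source ℂ p)).differentiableAt
  have h2 := (hφ.2 p).differentiableAt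
  have h3 := (h2.comp (starRingEnd ℂ z) h1).conj_conj
  rw [Complex.conj_conj] at h3
  refine h3.congr_of_eventuallyEq ?_
  have hc : ContinuousAt (fun z => ψ (starRingEnd ℂ z)) z :=
    (hψ.contMDiff.continuous.comp Complex.continuous_conj).continuousAt
  filter_upwards [hc.preimage_mem_nhds ((chartAt ℂ p).open_source.mem_nhds
    (mem_chart_source ℂ p))] with w hw
  have hw' : ψ (starRingEnd ℂ w) ∈ (chartAt ℂ p).source := hw
  simp only [Function.comp_apply, (chartAt ℂ p).left_inv hw', Complex.conj_conj]

/-- If a conjugation fixes the second point of a sphere pair, it is of the form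
`z ↦ a z̄ + b` in the first parametrization. -/
theorem IsSpherePair.exists_conj_affine {K : Set X} {ψ₀ ψ₁ : ℂ → X} (h : IsSpherePair K ψ₀ ψ₁)
    {φ : X → X} (hφ : IsAntiholomorphic φ) (hinv : Function.Involutive φ) (hK : MapsTo φ K K)
    (hq : φ (ψ₁ 0) = ψ₁ 0) :
    ∃ a b : ℂ, ∀ z, φ (ψ₀ z) = ψ₀ (a * starRingEnd ℂ z + b) := by
  -- The conjugation is injective and fixes the point at infinity, so it maps the finite part of the
  -- sphere to itself.
  have hlift : ∀ z, ∃ w, ψ₀ w = φ (ψ₀ (starRingEnd ℂ z)) := fun z => by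
    have h1 : ψ₀ (starRingEnd ℂ z) ∈ K := h.cover ▸ Or.inl ⟨_, rfl⟩
    have h2 := hK h1
    rw [← h.cover] at h2
    rcases h2 with ⟨w, hw⟩ | h2
    · exact ⟨w, hw⟩
    · rw [mem_singleton_iff, ← hq] at h2
      exact absurd ⟨_, hinv.injective h2⟩ h.notMem
  choose g hg using hlift
  have hgc : Continuous g := by
    rw [h.param₀.isOpenEmbedding.isInducing.continuous_iff]
    have : ψ₀ ∘ g = fun z => φ (ψ₀ (starRingEnd ℂ z)) := funext hg
    rw [this]
    exact hφ.1.comp (h.param₀.contMDiff.continuous.comp Complex.continuous_conj)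
  have hgd : Differentiable ℂ g := fun z =>
    h.param₀.differentiableAt_lift (hφ.differentiableAt_chart h.param₀ z) hgc.continuousAt
      (Eventually.of_forall fun w => (hg w).symm)
  have hginv : ∀ z, g (starRingEnd ℂ (g (starRingEnd ℂ z))) = z := fun z => by
    apply h.param₀.injective
    rw [hg, Complex.conj_conj, hg, Complex.conj_conj, hinv]
  -- The same map in the chart at infinity; it is meaningful only near `0`, where the image stays in
  -- that chart.
  set k : ℂ → ℂ := fun y => Function.invFun ψ₁ (φ (ψ₁ (starRingEnd ℂ y))) with hk
  have hχ : Continuous fun y => φ (ψ₁ (starRingEnd ℂ y)) :=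
    hφ.1.comp (h.param₁.contMDiff.continuous.comp Complex.continuous_conj)
  have hkev : ∀ᶠ y in 𝓝 (0 : ℂ), φ (ψ₁ (starRingEnd ℂ y)) = ψ₁ (k y) := by
    have : range ψ₁ ∈ 𝓝 (φ (ψ₁ (starRingEnd ℂ 0))) :=
      h.param₁.isOpenEmbedding.isOpen_range.mem_nhds (by rw [map_zero, hq]; exact ⟨0, rfl⟩)
    filter_upwards [hχ.continuousAt.preimage_mem_nhds this] with y hy
    exact (Function.invFun_eq hy).symm
  have hk0 : k 0 = 0 := h.param₁.injective (by rw [← hkev.self_of_nhds, map_zero, hq])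
  have hkc : ContinuousAt k 0 := by
    rw [h.param₁.isOpenEmbedding.isInducing.continuousAt_iff]
    exact hχ.continuousAt.congr hkev
  have hkd : DifferentiableAt ℂ k 0 :=
    h.param₁.differentiableAt_lift (hφ.differentiableAt_chart h.param₁ 0) hkc hkev
  obtain ⟨L, hL⟩ := hkd.hasDerivAt.isBigO_sub.bound
  simp only [hk0, sub_zero] at hL
  have hkconj : Tendsto (fun y => starRingEnd ℂ (k y)) (𝓝 0) (𝓝 0) := by
    have := (Complex.continuous_conj.continuousAt (x := k 0)).comp hkc
    simpa [ContinuousAt, hk0, Function.comp_def] using this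
  have hconj0 : Tendsto (fun y => starRingEnd ℂ y) (𝓝 (0 : ℂ)) (𝓝 0) := by
    simpa using Complex.continuous_conj.tendsto 0
  -- Differentiability gives `‖k y‖ ≤ L * ‖y‖`. Applied to the conjugate of `k y`, which `k` sends
  -- back to the conjugate of `y`, it becomes a lower bound for `k`; under `g z = -1 / k (-1 / z)`
  -- this is linear growth of `g`.
  have hlow : ∀ᶠ y in 𝓝 (0 : ℂ), ‖y‖ ≤ L * ‖k y‖ := by
    filter_upwards [hkev, hkconj.eventually hkev, hkconj.eventually hL] with y h1 h2 h3
    have h4 : k (starRingEnd ℂ (k y)) = starRingEnd ℂ y := by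
      apply h.param₁.injective
      rw [← h2, Complex.conj_conj, ← h1, hinv]
    rw [h4] at h3
    simpa using h3
  obtain ⟨δ, hδ, hball⟩ := Metric.eventually_nhds_iff.1 (hlow.and hkev)
  obtain ⟨a, b, hab⟩ := exists_affine_of_linear_growth (C := L) (R := 2 / δ) hgd fun z hz => by
    have hz0 : 0 < ‖z‖ := (by positivity : (0 : ℝ) < 2 / δ).trans_le hz
    have hzne : z ≠ 0 := norm_pos_iff.1 hz0
    have hyd : dist (-z⁻¹) 0 < δ := by
      rw [dist_zero_right, norm_neg, norm_inv, inv_lt_comm₀ hz0 hδ]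
      refine lt_of_lt_of_le ?_ hz
      rw [inv_eq_one_div]
      gcongr
      norm_num
    obtain ⟨h1, h2⟩ := hball hyd
    have hyne : -z⁻¹ ≠ 0 := neg_ne_zero.2 (inv_ne_zero hzne)
    have hkne : k (-z⁻¹) ≠ 0 := by
      intro h0
      rw [h0, norm_zero, mul_zero] at h1
      exact hyne (norm_le_zero_iff.1 h1)
    have h3 : g z = -(k (-z⁻¹))⁻¹ := by
      apply h.param₀.injective
      rw [← h.glue _ hkne, ← h2, hg, h.glue _ (by simpa using hzne)]
      simp [inv_neg]
    have hkpos := norm_pos_iff.2 hkne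
    rw [h3, norm_neg, norm_inv]
    rw [norm_neg, norm_inv] at h1
    have h5 : 1 ≤ L * ‖k (-z⁻¹)‖ * ‖z‖ := by
      calc 1 = ‖z‖⁻¹ * ‖z‖ := (inv_mul_cancel₀ hz0.ne').symm
        _ ≤ _ := by gcongr
    rw [inv_eq_one_div, div_le_iff₀ hkpos]
    linarith
  exact ⟨a, b, fun z => by rw [← hab, hg, Complex.conj_conj]⟩

/-- Involutivity of `a * z̄ + b` forces `a * ā = 1` and `a * b̄ + b = 0`. If `l ^ 2 = a`, the fixed
line passes through `b / 2` in the direction `l`, and the coordinate change `l * z + b / 2` makes it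
the real axis. -/
theorem IsSpherePair.exists_conj {K : Set X} {ψ₀ ψ₁ : ℂ → X} (h : IsSpherePair K ψ₀ ψ₁)
    {φ : X → X} (hφ : IsAntiholomorphic φ) (hinv : Function.Involutive φ) (hK : MapsTo φ K K)
    (hq : φ (ψ₁ 0) = ψ₁ 0) :
    ∃ ψ₀' ψ₁' : ℂ → X, IsSpherePair K ψ₀' ψ₁' ∧ ψ₁' 0 = ψ₁ 0 ∧
      ∀ z, φ (ψ₀' z) = ψ₀' (starRingEnd ℂ z) := by
  obtain ⟨a, b, hab⟩ := h.exists_conj_affine hφ hinv hK hq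
  have h2 : ∀ z, a * (starRingEnd ℂ a * z + starRingEnd ℂ b) + b = z := fun z => by
    apply h.param₀.injective
    have := hab (a * starRingEnd ℂ z + b)
    rw [← hab, hinv] at this
    rw [this]
    simp
  have hb : a * starRingEnd ℂ b + b = 0 := by simpa using h2 0
  have ha : a * starRingEnd ℂ a = 1 := by linear_combination h2 1 - hb
  obtain ⟨l, hl⟩ := IsAlgClosed.exists_pow_nat_eq a (n := 2) (by norm_num)
  have hl1 : l * starRingEnd ℂ l = 1 := by
    rw [Complex.mul_conj] at ha ⊢
    rw [← hl, map_pow] at ha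
    norm_cast at ha ⊢
    exact (pow_eq_one_iff_of_nonneg (Complex.normSq_nonneg l) (by norm_num)).1 ha
  have hl0 : l ≠ 0 := by rintro rfl; simp at hl1
  obtain ⟨ψ₁', hp, h0⟩ := h.affine hl0 (b / 2)
  refine ⟨_, ψ₁', hp, h0, fun z => ?_⟩
  simp only [hab]
  congr 1
  rw [← hl] at hb ⊢
  simp only [map_add, map_mul, map_div₀, map_ofNat]
  linear_combination l * starRingEnd ℂ z * hl1 + hb / 2

/-- A point of the lower half-plane lying in the preferred half would belong to both halves, as its
conjugate is in the preferred half too; it would then be fixed, hence real. Real points are fixed,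
so they lie in both halves. -/
theorem isBdryChart_of_upper {M : MarkedDisk X I B} {ψ : ℂ → X} (hψ : IsParam ψ)
    (hconj : ∀ z, M.φ (ψ z) = ψ (starRingEnd ℂ z)) (hup : ∀ z : ℂ, 0 < z.im → ψ z ∈ M.half) :
    IsBdryChart M ψ := by
  refine ⟨hψ, hconj, fun z => ⟨fun hz => ?_, fun hz => ?_⟩⟩
  · by_contra hneg
    have h1 : ψ z ∈ M.half ∩ M.φ '' M.half := by
      refine ⟨hz, ψ (starRingEnd ℂ z), hup _ (by simpa using hneg), ?_⟩
      rw [hconj, Complex.conj_conj]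
    rw [M.half_inter, mem_ofPred_eq, hconj] at h1
    have := congrArg Complex.im (hψ.injective h1)
    simp only [Complex.conj_im] at this
    linarith
  · rcases hz.lt_or_eq with h | h
    · exact hup z h
    · have h1 : ψ z ∈ {p | M.φ p = p} := by
        rw [mem_ofPred_eq, hconj, Complex.conj_eq_iff_im.2 h.symm]
      rw [← M.half_inter] at h1
      exact h1.1

theorem image_phi_half (M : MarkedDisk X I B) : M.φ '' M.half = M.φ ⁻¹' M.half :=
  congrFun (image_eq_preimage_of_inverse M.involutive M.involutive) _

/-- The upper half-plane is connected and covered by the two closed halves, which meet only in fixed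
points, that is, at real parameters. -/
theorem upper_or_upper (M : MarkedDisk X I B) {ψ : ℂ → X} (hψ : IsParam ψ)
    (hconj : ∀ z, M.φ (ψ z) = ψ (starRingEnd ℂ z)) :
    (∀ z : ℂ, 0 < z.im → ψ z ∈ M.half) ∨ (∀ z : ℂ, 0 < z.im → M.φ (ψ z) ∈ M.half) := by
  have hconn : IsPreconnected (ψ '' {z : ℂ | 0 < z.im}) :=
    (convex_halfSpace_im_gt 0).isPreconnected.image _ hψ.contMDiff.continuous.continuousOn
  have hcl : IsClosed (M.φ ⁻¹' M.half) := M.isClosed_half.preimage M.antiholomorphic.1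
  have hcov : ∀ p, p ∈ M.half ∨ p ∈ M.φ ⁻¹' M.half := fun p => by
    have : p ∈ M.half ∪ M.φ '' M.half := M.half_union ▸ mem_univ p
    rwa [image_phi_half] at this
  by_contra hcon
  push Not at hcon
  obtain ⟨⟨z, hz, hzn⟩, ⟨w, hw, hwn⟩⟩ := hcon
  obtain ⟨p, ⟨u, hu, rfl⟩, hp1, hp2⟩ := isPreconnected_closed_iff.1 hconn _ _ M.isClosed_half hcl
    (fun p _ => hcov p) ⟨_, ⟨w, hw, rfl⟩, (hcov _).resolve_right hwn⟩
    ⟨_, ⟨z, hz, rfl⟩, (hcov _).resolve_left hzn⟩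
  have h1 : ψ u ∈ M.half ∩ M.φ '' M.half := by rw [image_phi_half]; exact ⟨hp1, hp2⟩
  rw [M.half_inter, mem_ofPred_eq, hconj] at h1
  have := congrArg Complex.im (hψ.injective h1)
  simp only [Complex.conj_im] at this
  have hu' : 0 < u.im := hu
  linarith

/-- Every boundary point `q` is the point at infinity of a boundary chart of the Riemann sphere
containing it, and the origin of the opposite boundary chart. -/
theorem MarkedDisk.exists_bdryCharts (M : MarkedDisk X I B) {q : X} (hq : M.φ q = q) :
    ∃ ψ₀ ψ₁ : ℂ → X, IsSpherePair (connectedComponent q) ψ₀ ψ₁ ∧ ψ₁ 0 = q ∧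
      IsBdryChart M ψ₀ ∧ IsBdryChart M ψ₁ := by
  obtain ⟨χ₀, χ₁, hχ, hχq⟩ := (M.genus_zero q).exists_pair_at mem_connectedComponent
  have hK : MapsTo M.φ (connectedComponent q) (connectedComponent q) := by
    have h1 : M.φ '' connectedComponent q ⊆ connectedComponent q :=
      (isPreconnected_connectedComponent.image _
        M.antiholomorphic.1.continuousOn).subset_connectedComponent
        ⟨q, mem_connectedComponent, hq⟩
    exact fun p hp => h1 ⟨p, hp, rfl⟩
  obtain ⟨ψ₀, ψ₁, hψ, h0, hconj⟩ := hχ.exists_conj M.antiholomorphic M.involutive hK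
    (by rw [hχq, hq])
  have key : ∃ ψ₀ ψ₁ : ℂ → X, IsSpherePair (connectedComponent q) ψ₀ ψ₁ ∧ ψ₁ 0 = q ∧
      IsBdryChart M ψ₀ := by
    rcases upper_or_upper M hψ.param₀ hconj with hup | hup
    · exact ⟨ψ₀, ψ₁, hψ, h0.trans hχq, isBdryChart_of_upper hψ.param₀ hconj hup⟩
    -- If the preferred half is the lower half-plane, `z ↦ -z` exchanges the two while preserving
    -- the form of the conjugation.
    · obtain ⟨ψ₁', hψ', h0'⟩ := hψ.affine (l := -1) (by simp) 0
      refine ⟨_, ψ₁', hψ', h0'.trans (h0.trans hχq), isBdryChart_of_upper hψ'.param₀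
        (fun z => by simp [hconj]) fun z hz => ?_⟩
      have := hup (starRingEnd ℂ (-1 * z + 0)) (by simpa using hz)
      rwa [hconj, Complex.conj_conj] at this
  obtain ⟨ψ₀, ψ₁, hψ, h0, hb⟩ := key
  refine ⟨ψ₀, ψ₁, hψ, h0, hb, isBdryChart_of_upper hψ.param₁ (fun y => ?_) fun y hy => ?_⟩
  · rcases eq_or_ne y 0 with rfl | hy
    · rw [map_zero, h0, hq]
    · rw [hψ.glue y hy, hψ.glue _ (by simpa using hy), hb.conj]
      simp
  · have hy0 : y ≠ 0 := by rintro rfl; simp at hy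
    rw [hψ.glue y hy0, hb.half, Complex.neg_im, Complex.inv_im, neg_div, neg_neg]
    have := Complex.normSq_nonneg y
    positivity

end BoundaryCharts

/-! ### Positive tangent and cotangent vectors in boundary charts -/

section PositiveTangents

set_option linter.unusedSectionVars false
variable {X : Type*} [TopologicalSpace X] [ChartedSpace ℂ X] [IsManifold 𝓘(ℂ) ω X]
  {I B : Type*}

/-- Ensures that the real `mfderiv` in `conjDeriv` is the true differential rather than the default
value `0`. -/
theorem IsAntiholomorphic.mdifferentiableAt {φ : X → X} (hφ : IsAntiholomorphic φ) (p : X) :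
    MDifferentiableAt 𝓘(ℝ, ℂ) 𝓘(ℝ, ℂ) φ p := by
  rw [mdifferentiableAt_iff]
  refine ⟨hφ.1.continuousAt, ?_⟩
  have h1 : DifferentiableAt ℝ (fun ζ : ℂ => starRingEnd ℂ (chartAt ℂ (φ p)
      (φ ((chartAt ℂ p).symm ζ)))) (chartAt ℂ p p) := (hφ.2 p).differentiableAt.restrictScalars ℝ
  have h2 := (Complex.conjCLE.differentiableAt (x := _)).comp _ h1
  simp only [writtenInExtChartAt, mfld_simps, differentiableWithinAt_univ]
  refine h2.congr_of_eventuallyEq (Eventually.of_forall fun ζ => ?_)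
  simp

theorem hasMFDerivAt_real {ψ : ℂ → X} {z : ℂ} (h : MDifferentiableAt 𝓘(ℂ) 𝓘(ℂ) ψ z) :
    HasMFDerivAt 𝓘(ℝ, ℂ) 𝓘(ℝ, ℂ) ψ z
      ((ContinuousLinearMap.toSpanSingleton ℂ (vel ψ z)).restrictScalars ℝ) := by
  refine ⟨h.continuousAt, ?_⟩
  have h2 := h.differentiableWithinAt_writtenInExtChartAt
  have hv := vel_eq_deriv h
  simp only [writtenInExtChartAt, mfld_simps, differentiableWithinAt_univ] at h2 ⊢
  have h3 := (h2.hasDerivAt.hasFDerivAt.restrictScalars ℝ).hasFDerivWithinAt (s := univ)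
  rw [hv]
  exact h3

/-- The differential of the conjugation in a parametrization in which it is the complex
conjugation. -/
theorem conjDeriv_vel {φ : X → X} (hφ : IsAntiholomorphic φ) {ψ : ℂ → X} (hψ : IsParam ψ)
    (hconj : ∀ z, φ (ψ z) = ψ (starRingEnd ℂ z)) (z c : ℂ) :
    (conjDeriv φ (ψ z) (c * vel ψ z : ℂ) : ℂ) =
      starRingEnd ℂ c * vel ψ (starRingEnd ℂ z) := by
  have h1 := (hφ.mdifferentiableAt (ψ z)).hasMFDerivAt.comp z
    (hasMFDerivAt_real (hψ.mdifferentiableAt z))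
  have hc : HasMFDerivAt 𝓘(ℝ, ℂ) 𝓘(ℝ, ℂ) (fun z : ℂ => starRingEnd ℂ z) z
      (Complex.conjCLE : ℂ →L[ℝ] ℂ) :=
    (Complex.conjCLE.toContinuousLinearMap.hasFDerivAt (x := z)).hasMFDerivAt
  have h2 := (hasMFDerivAt_real (hψ.mdifferentiableAt (starRingEnd ℂ z))).comp z hc
  have h3 : φ ∘ ψ = ψ ∘ fun z => starRingEnd ℂ z := funext hconj
  have h4 := congrArg (fun L : ℂ →L[ℝ] ℂ => L c) h1.mfderiv
  have h5 := congrArg (fun L : ℂ →L[ℝ] ℂ => L c) h2.mfderiv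
  have h6 := congrArg (fun χ : ℂ → X => (mfderiv 𝓘(ℝ, ℂ) 𝓘(ℝ, ℂ) χ z : ℂ →L[ℝ] ℂ) c) h3
  exact h4.symm.trans (h6.trans h5)

/-- In a boundary chart, the straight line (in the preferred coordinate) in the direction `i u`
is the image of a path with velocity `i c`. -/
theorem IsParam.eventually_chart_symm_eq {ψ : ℂ → X} (hψ : IsParam ψ) (x c : ℂ) :
    ∃ w : ℝ → ℂ, HasDerivAt w (Complex.I * c) 0 ∧ w 0 = x ∧ ∀ᶠ t : ℝ in 𝓝 0,
      (chartAt ℂ (ψ x)).symm (chartAt ℂ (ψ x) (ψ x) + (t : ℂ) * (Complex.I * (c * vel ψ x))) =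
        ψ (w t) := by
  set e := chartAt ℂ (ψ x) with he
  have h0 := hψ.deriv_chart_ne_zero (mem_chart_source ℂ (ψ x))
  have hs := hψ.hasStrictDerivAt x
  rw [← vel_eq_deriv (hψ.mdifferentiableAt x)] at h0 hs
  set L := hs.localInverse _ _ _ h0 with hL
  have hLd : HasDerivAt L (vel ψ x)⁻¹ (e (ψ x)) := (hs.to_localInverse h0).hasDerivAt
  have hLx : L (e (ψ x)) = x := (hs.hasStrictFDerivAt_equiv h0).eventually_left_inverse.self_of_nhds
  have hright := (hs.hasStrictFDerivAt_equiv h0).eventually_right_inverse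
  set γ : ℝ → ℂ := fun t => e (ψ x) + (t : ℂ) * (Complex.I * (c * vel ψ x)) with hγ
  have hγd : HasDerivAt γ (Complex.I * (c * vel ψ x)) 0 := by
    have := ((Complex.ofRealCLM.hasDerivAt (x := (0 : ℝ))).mul_const
      (Complex.I * (c * vel ψ x))).const_add (e (ψ x))
    simp only [Complex.ofRealCLM_apply, Complex.ofReal_one, one_mul] at this
    exact this
  have hγ0 : γ 0 = e (ψ x) := by simp [hγ]
  have hLd' : HasDerivAt L (vel ψ x)⁻¹ (γ 0) := hγ0 ▸ hLd
  refine ⟨L ∘ γ, ?_, by simp [hγ0, hLx], ?_⟩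
  · have := hLd'.comp (0 : ℝ) hγd
    have hv := hψ.vel_ne_zero x
    have h2 : (vel ψ x)⁻¹ * (Complex.I * (c * vel ψ x)) = Complex.I * c := by field_simp
    rwa [h2] at this
  · have hγt : Tendsto γ (𝓝 0) (𝓝 (e (ψ x))) := hγ0 ▸ hγd.continuousAt.tendsto
    have hsrc : ∀ᶠ ζ in 𝓝 (e (ψ x)), ψ (L ζ) ∈ e.source := by
      have hc : ContinuousAt (ψ ∘ L) (e (ψ x)) :=
        hψ.contMDiff.continuous.continuousAt.comp hLd.continuousAt
      exact hc.preimage_mem_nhds (e.open_source.mem_nhds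
        (by rw [Function.comp_apply, hLx]; exact mem_chart_source ℂ _))
    filter_upwards [hγt.eventually hright, hγt.eventually hsrc] with t h1 h2
    have h3 : e (ψ (L (γ t))) = γ t := h1
    change e.symm (γ t) = ψ (L (γ t))
    exact (congrArg e.symm h3).symm.trans (e.left_inv h2)

/-- For `u = c * vel ψ x`, invariance under the differential of the conjugation means that `c` is
real. The line in the direction `i u` then has parameters whose imaginary part has derivative `c` at
`0`, so it enters the upper half-plane exactly when `c > 0`. -/
theorem IsBdryChart.isPositiveTangent_iff {M : MarkedDisk X I B} {ψ : ℂ → X}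
    (hψ : IsBdryChart M ψ) (x : ℝ) (u : ℂ) :
    M.IsPositiveTangent (ψ x) u ↔ ∃ c : ℝ, 0 < c ∧ u = c * vel ψ x := by
  have hv := hψ.vel_ne_zero x
  have hpos : ∀ c : ℝ, c ≠ 0 → ((∀ᶠ t : ℝ in 𝓝[>] 0, (chartAt ℂ (ψ x)).symm (chartAt ℂ (ψ x) (ψ x) +
      (t : ℂ) * (Complex.I * ((c : ℂ) * vel ψ x))) ∈ M.half) ↔ 0 < c) := by
    intro c hc
    obtain ⟨w, hwd, hw0, hw⟩ := hψ.toIsParam.eventually_chart_symm_eq x c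
    have h1 : HasDerivAt (fun t => (w t).im) c 0 := by
      have := Complex.imCLM.hasFDerivAt.comp_hasDerivAt (0 : ℝ) hwd
      have h2 : Complex.imCLM (Complex.I * c) = c := by simp
      rw [h2] at this
      exact this
    have h2 : Tendsto (fun t : ℝ => t⁻¹ * (w t).im) (𝓝[>] 0) (𝓝 c) := by
      have := h1.tendsto_slope_zero_right
      simpa [hw0] using this
    have hev : ∀ᶠ t : ℝ in 𝓝[>] 0, ((chartAt ℂ (ψ x)).symm (chartAt ℂ (ψ x) (ψ x) +
      (t : ℂ) * (Complex.I * ((c : ℂ) * vel ψ x))) ∈ M.half ↔ 0 ≤ (w t).im) := by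
      filter_upwards [hw.filter_mono nhdsWithin_le_nhds] with t ht
      rw [ht, hψ.half]
    rw [eventually_congr hev]
    constructor
    · intro h
      by_contra hneg
      have hc' : c < 0 := lt_of_le_of_ne (not_lt.1 hneg) hc
      obtain ⟨t, h3, h4, h5⟩ := (h.and ((h2.eventually_lt_const hc').and self_mem_nhdsWithin)).exists
      have h5' : (0 : ℝ) < t := h5
      have : 0 ≤ t⁻¹ * (w t).im := mul_nonneg (inv_nonneg.2 h5'.le) h3
      linarith
    · intro h
      filter_upwards [h2.eventually_const_lt h, self_mem_nhdsWithin] with t h3 h4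
      have h4' : (0 : ℝ) < t := h4
      exact (pos_of_mul_pos_right h3 (inv_nonneg.2 h4'.le)).le
  have hfix : M.φ (ψ x) = ψ x := by rw [hψ.conj, Complex.conj_ofReal]
  have htan : ∀ c : ℂ, ((⟨M.φ (ψ x), conjDeriv M.φ (ψ x) (c * vel ψ x : ℂ)⟩ : TangentBundle 𝓘(ℂ) X) =
      ⟨ψ x, (c * vel ψ x : ℂ)⟩) ↔ starRingEnd ℂ c = c := by
    intro c
    have h1 := conjDeriv_vel M.antiholomorphic hψ.toIsParam hψ.conj x c
    rw [Complex.conj_ofReal] at h1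
    constructor
    · intro h
      have h2 : (conjDeriv M.φ (ψ x) (c * vel ψ x : ℂ) : ℂ) = c * vel ψ x :=
        eq_of_heq (Bundle.TotalSpace.mk.inj h).2
      rw [h1] at h2
      exact mul_right_cancel₀ hv h2
    · intro h
      have h2 : (conjDeriv M.φ (ψ x) (c * vel ψ x : ℂ) : ℂ) = c * vel ψ x := by rw [h1, h]
      exact Bundle.TotalSpace.ext hfix (heq_of_eq h2)
  constructor
  · rintro ⟨hu, hfixu, hhalf⟩
    have hu' : u = (u / vel ψ x) * vel ψ x := (div_mul_cancel₀ _ hv).symm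
    rw [hu'] at hfixu
    obtain ⟨c, hc⟩ := Complex.conj_eq_iff_real.1 ((htan _).1 hfixu)
    rw [hc] at hu'
    refine ⟨c, (hpos c ?_).1 ?_, hu'⟩
    · rintro rfl
      exact hu (by rw [hu']; simp; rfl)
    · rw [hu'] at hhalf
      exact hhalf
  · rintro ⟨c, hc, rfl⟩
    refine ⟨?_, (htan _).2 (Complex.conj_ofReal c), (hpos c hc.ne').2 hc⟩
    exact mul_ne_zero (M₀ := ℂ) (Complex.ofReal_ne_zero.2 hc.ne') hv

theorem IsBdryChart.isPositive_iff {M : MarkedDisk X I B} {ψ : ℂ → X}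
    (hψ : IsBdryChart M ψ) (x : ℝ) (η : CanonicalFiber X (ψ x)) :
    M.IsPositive (ψ x) η ↔ ∃ c : ℝ, 0 < c ∧ η (vel ψ x) = (c : ℂ) := by
  constructor
  · intro h
    exact h (vel ψ x) ((hψ.isPositiveTangent_iff x _).2 ⟨1, one_pos, by simp⟩)
  · rintro ⟨c, hc, hη⟩ u hu
    obtain ⟨d, hd, rfl⟩ := (hψ.isPositiveTangent_iff x u).1 hu
    refine ⟨d * c, mul_pos hd hc, ?_⟩
    have h1 : η ((d : ℂ) • (vel ψ x) : ℂ) = (d : ℂ) • η (vel ψ x) :=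
      (η : ℂ →L[ℂ] ℂ).map_smul (d : ℂ) (vel ψ x)
    rw [hη] at h1
    push_cast
    exact h1

theorem IsBdryChart.mem_bdry_iff {M : MarkedDisk X I B} {ψ : ℂ → X}
    (hψ : IsBdryChart M ψ) (z : ℂ) : ψ z ∈ M.bdry ↔ ∃ t : ℝ, z = t := by
  rw [MarkedDisk.bdry, mem_ofPred_eq, hψ.conj, hψ.injective.eq_iff, Complex.conj_eq_iff_real]

/-- Local statements along the boundary thereby become statements about functions of a real
variable. -/
theorem IsBdryChart.map_nhds_real {M : MarkedDisk X I B} {ψ : ℂ → X}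
    (hψ : IsBdryChart M ψ) (x : ℝ) : map (fun t : ℝ => ψ t) (𝓝 x) = 𝓝[M.bdry] (ψ x) := by
  have h1 : map (fun t : ℝ => (t : ℂ)) (𝓝 x) = 𝓝[range ((↑) : ℝ → ℂ)] (x : ℂ) :=
    Complex.isUniformEmbedding_ofReal.isEmbedding.map_nhds_eq x
  have h2 : range ((↑) : ℝ → ℂ) = ψ ⁻¹' M.bdry := by
    ext z
    rw [mem_preimage, hψ.mem_bdry_iff]
    exact ⟨fun ⟨t, ht⟩ => ⟨t, ht.symm⟩, fun ⟨t, ht⟩ => ⟨t, ht.symm⟩⟩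
  have h3 : (fun t : ℝ => ψ t) = ψ ∘ fun t : ℝ => (t : ℂ) := rfl
  rw [h3, ← Filter.map_map, h1, h2]
  have := hψ.isOpenEmbedding.map_nhdsWithin_preimage_eq M.bdry (x : ℂ)
  exact this

end PositiveTangents

/-! ### Normalized frames of `S` over a copy of the plane -/

section Frames

set_option linter.unusedSectionVars false
variable {X : Type*} [TopologicalSpace X] [ChartedSpace ℂ X] [IsManifold 𝓘(ℂ) ω X]
  {I B : Type*} [Fintype I] [Fintype B] {r : ℕ} {M : MarkedDisk X I B} {a : I → ℕ} {b : B → ℕ}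
  {S : X → Type*} [∀ p, AddCommGroup (S p)] [∀ p, Module ℂ (S p)]
  [TopologicalSpace (TotalSpace ℂ S)] [∀ p, TopologicalSpace (S p)]
  [FiberBundle ℂ S] [VectorBundle ℂ ℂ S]

/-- The value of `τ(v^{⊗ r})` on the tangent vector with preferred coordinate `u`. -/
def rVal (τ : ∀ p, (⨂[ℂ]^r (S p)) →ₗ[ℂ] CanonicalFiber X p) (p : X) (v : S p) (u : ℂ) : ℂ :=
  rPow τ p v u

theorem rPow_smul (τ : ∀ p, (⨂[ℂ]^r (S p)) →ₗ[ℂ] CanonicalFiber X p) (p : X) (c : ℂ) (v : S p) :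
    rPow τ p (c • v) = c ^ r • rPow τ p v := by
  have h : PiTensorProduct.tprod ℂ (fun _ : Fin r => c • v) =
      c ^ r • PiTensorProduct.tprod ℂ (fun _ : Fin r => v) := by
    rw [MultilinearMap.map_smul_univ, Finset.prod_const, Finset.card_univ, Fintype.card_fin]
  rw [rPow, h, map_smul, rPow]

theorem rVal_smul (τ : ∀ p, (⨂[ℂ]^r (S p)) →ₗ[ℂ] CanonicalFiber X p) (p : X) (c : ℂ) (v : S p)
    (u : ℂ) : rVal τ p (c • v) u = c ^ r * rVal τ p v u :=
  congrArg (fun η : ℂ →L[ℂ] ℂ => η u) (rPow_smul τ p c v)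

theorem rVal_mul (τ : ∀ p, (⨂[ℂ]^r (S p)) →ₗ[ℂ] CanonicalFiber X p) (p : X) (c : ℂ) (v : S p)
    (u : ℂ) : rVal τ p v (c * u) = c * rVal τ p v u :=
  (rPow τ p v : ℂ →L[ℂ] ℂ).map_smul c u

/-- Vectors over base points that agree only propositionally, such as `φ (ψ z)` and `ψ z̄`, are
compared in the total space, which avoids transport between fibres. -/
theorem rVal_congr (τ : ∀ p, (⨂[ℂ]^r (S p)) →ₗ[ℂ] CanonicalFiber X p) {p p' : X} {v : S p}
    {v' : S p'} (h : (⟨p, v⟩ : TotalSpace ℂ S) = ⟨p', v'⟩) (u : ℂ) :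
    rVal τ p v u = rVal τ p' v' u :=
  congrArg (fun q : TotalSpace ℂ S => rVal τ q.1 q.2 u) h

/-- `s` is a continuous frame of `S` over the part of the parametrization `ψ` with parameters
in `U`, normalized by `τ(s^{⊗ r}) = f(z) dz`. -/
def IsFrameOn (τ : ∀ p, (⨂[ℂ]^r (S p)) →ₗ[ℂ] CanonicalFiber X p) (ψ : ℂ → X) (f : ℂ → ℂ)
    (U : Set ℂ) (s : ∀ z, S (ψ z)) : Prop :=
  ContinuousOn (fun z => (⟨ψ z, s z⟩ : TotalSpace ℂ S)) U ∧
    ∀ z ∈ U, s z ≠ 0 ∧ rVal τ (ψ z) (s z) (vel ψ z) = f z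

theorem IsFrameOn.mono {τ : ∀ p, (⨂[ℂ]^r (S p)) →ₗ[ℂ] CanonicalFiber X p} {ψ : ℂ → X} {f : ℂ → ℂ}
    {U V : Set ℂ} {s : ∀ z, S (ψ z)} (h : IsFrameOn τ ψ f U s) (hV : V ⊆ U) :
    IsFrameOn τ ψ f V s := ⟨h.1.mono hV, fun z hz => h.2 z (hV hz)⟩

/-- After division by its value at `z₀` the function is close to `1`, where the principal logarithm
is holomorphic. -/
theorem exists_analyticAt_root {u : ℂ → ℂ} {z₀ : ℂ} (hu : AnalyticAt ℂ u z₀) (h0 : u z₀ ≠ 0)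
    (hr : 0 < r) :
    ∃ ρ : ℂ → ℂ, AnalyticAt ℂ ρ z₀ ∧ ρ z₀ ≠ 0 ∧ ∀ᶠ z in 𝓝 z₀, ρ z ^ r = u z := by
  obtain ⟨c, hc⟩ := IsAlgClosed.exists_pow_nat_eq (u z₀) hr
  have hr' : (r : ℂ) ≠ 0 := Nat.cast_ne_zero.2 hr.ne'
  have hq : AnalyticAt ℂ (fun z => u z / u z₀) z₀ := hu.div analyticAt_const h0
  have hslit : u z₀ / u z₀ ∈ Complex.slitPlane := by
    rw [div_self h0]; exact Complex.one_mem_slitPlane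
  refine ⟨fun z => c * Complex.exp (Complex.log (u z / u z₀) / r), ?_, ?_, ?_⟩
  · exact analyticAt_const.mul ((hq.clog hslit).div analyticAt_const hr').cexp
  · refine mul_ne_zero ?_ (Complex.exp_ne_zero _)
    rintro rfl
    rw [zero_pow hr.ne'] at hc
    exact h0 hc.symm
  · filter_upwards [hu.continuousAt.eventually_ne h0] with z hz
    rw [mul_pow, hc, ← Complex.exp_nat_mul, mul_div_cancel₀ _ hr', Complex.exp_log (div_ne_zero hz h0),
      mul_div_cancel₀ _ h0]

variable [ContMDiffVectorBundle ω ℂ S 𝓘(ℂ)]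

theorem exists_holomorphic_frame (S : X → Type*) [∀ p, AddCommGroup (S p)] [∀ p, Module ℂ (S p)]
    [TopologicalSpace (TotalSpace ℂ S)] [∀ p, TopologicalSpace (S p)]
    [FiberBundle ℂ S] [VectorBundle ℂ ℂ S] [ContMDiffVectorBundle ω ℂ S 𝓘(ℂ)] (p : X) :
    ∃ (U : Set X) (t : ∀ q, S q), IsOpen U ∧ p ∈ U ∧ HolomorphicOn t U ∧ ∀ q ∈ U, t q ≠ 0 := by
  set e := trivializationAt ℂ S p
  refine ⟨e.baseSet, fun q => e.symm q 1, e.open_baseSet,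
    FiberBundle.mem_baseSet_trivializationAt' p, ?_, fun q hq h0 => ?_⟩
  · rw [HolomorphicOn, e.contMDiffOn_section_baseSet_iff]
    refine (contMDiffOn_const (c := (1 : ℂ))).congr fun q hq => ?_
    rw [e.apply_mk_symm hq]
  · have := e.apply_mk_symm hq (1 : ℂ)
    have h0' : e.symm q (1 : ℂ) = 0 := h0
    rw [h0'] at this
    exact one_ne_zero (congrArg Prod.snd ((e.zeroSection ℂ hq).symm.trans this)).symm

namespace TwistedSpin

/-- A holomorphic frame `t` gives a coefficient `F` of the same order at `z₀` as `f`, by `τ_order`.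
Hence `f / F` extends to a unit, and an `r`th root of it rescales `t` to a normalized frame. -/
theorem exists_local_frame (P : TwistedSpin r M a b S) (hr : 0 < r) {ψ : ℂ → X} (hψ : IsParam ψ)
    {f : ℂ → ℂ} {z₀ : ℂ} (hf : AnalyticAt ℂ f z₀)
    (hord : analyticOrderAt f z₀ = (M.divisor a b (ψ z₀) : ℕ∞)) :
    ∃ U : Set ℂ, IsOpen U ∧ z₀ ∈ U ∧ ∃ s : ∀ z, S (ψ z), IsFrameOn P.τ ψ f U s := by
  obtain ⟨V, t, hVo, hpV, ht, ht0⟩ := exists_holomorphic_frame S (ψ z₀)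
  obtain ⟨hRa, hRo⟩ := P.τ_order V t hVo ht ht0 (ψ z₀) hpV
  set R := rPowCoeff P.τ t (ψ z₀) with hR
  set e := chartAt ℂ (ψ z₀) with he
  have hψc := hψ.contMDiff.continuous
  have hG := analyticAt_chart_comp (hψ.contMDiff.contMDiffAt (x := z₀)) (mem_chart_source ℂ (ψ z₀))
  have hG' := hψ.deriv_chart_ne_zero (mem_chart_source ℂ (ψ z₀))
  set F : ℂ → ℂ := fun z => rVal P.τ (ψ z) (t (ψ z)) (vel ψ z) with hF
  have hFev : F =ᶠ[𝓝 z₀] deriv (e ∘ ψ) * (R ∘ (e ∘ ψ)) := by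
    filter_upwards [hψc.continuousAt.preimage_mem_nhds
      (e.open_source.mem_nhds (mem_chart_source ℂ (ψ z₀)))] with z hz
    have hz' : ψ z ∈ e.source := hz
    have h1 := mfderiv_chart_symm_deriv (hψ.contMDiff.contMDiffAt (x := z)) hz'
    have h2 : e.symm (e (ψ z)) = ψ z := e.left_inv hz'
    have h3 : R (e (ψ z)) = rVal P.τ (ψ z) (t (ψ z)) (vel e.symm (e (ψ z))) := by
      conv_rhs => rw [← h2]
      exact congrArg (fun w => rVal P.τ (e.symm (e (ψ z))) (t (e.symm (e (ψ z))))
        (vel e.symm w)) (congrArg e h2).symm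
    rw [hF, Pi.mul_apply, Function.comp_apply, Function.comp_apply, h3, ← rVal_mul, mul_comm, h1]
  have hRG : AnalyticAt ℂ (R ∘ (e ∘ ψ)) z₀ := AnalyticAt.comp (f := e ∘ ψ) hRa hG
  have hFa : AnalyticAt ℂ F z₀ := (hG.deriv.mul hRG).congr hFev.symm
  have hFo : analyticOrderAt F z₀ = (M.divisor a b (ψ z₀) : ℕ∞) := by
    rw [analyticOrderAt_congr hFev, analyticOrderAt_mul hG.deriv hRG,
      hG.deriv.analyticOrderAt_eq_zero.2 hG', zero_add,
      analyticOrderAt_comp_of_deriv_ne_zero hG hG', ← hRo]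
    rfl
  obtain ⟨F₁, hF₁a, hF₁0, hF₁⟩ := (hFa.analyticOrderAt_eq_natCast).1 hFo
  obtain ⟨f₁, hf₁a, hf₁0, hf₁⟩ := (hf.analyticOrderAt_eq_natCast).1 hord
  obtain ⟨ρ, hρa, hρ0, hρ⟩ := exists_analyticAt_root (r := r) (hf₁a.div hF₁a hF₁0)
    (div_ne_zero hf₁0 hF₁0) hr
  have hgood : ∀ᶠ z in 𝓝 z₀, AnalyticAt ℂ ρ z ∧ ρ z ≠ 0 ∧ ψ z ∈ V ∧ ρ z ^ r * F z = f z := by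
    filter_upwards [hρa.eventually_analyticAt, hρa.continuousAt.eventually_ne hρ0,
      hψc.continuousAt.preimage_mem_nhds (hVo.mem_nhds hpV), hρ, hF₁, hf₁,
      hF₁a.continuousAt.eventually_ne hF₁0] with z h1 h2 h3 h4 h5 h6 h7
    refine ⟨h1, h2, h3, ?_⟩
    rw [h4, h5, h6, smul_eq_mul, smul_eq_mul, Pi.div_apply]
    field_simp
  obtain ⟨U, hU, hUo, hzU⟩ := eventually_nhds_iff.1 hgood
  refine ⟨U, hUo, hzU, fun z => ρ z • t (ψ z), fun z hz => ?_, fun z hz => ?_⟩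
  · have h1 : ContinuousWithinAt (fun z => (⟨ψ z, t (ψ z)⟩ : TotalSpace ℂ S)) U z :=
      ((ht.continuousOn.continuousAt (hVo.mem_nhds (hU z hz).2.2.1)).comp
        (hψc.continuousAt (x := z))).continuousWithinAt
    exact (hU z hz).1.continuousAt.continuousWithinAt.smul_total h1
  · obtain ⟨-, h2, h3, h4⟩ := hU z hz
    exact ⟨smul_ne_zero h2 (ht0 _ h3), by rw [rVal_smul]; exact h4⟩

end TwistedSpin

/-- Two normalized frames over a connected set differ by a root of unity. -/
theorem IsFrameOn.eq_smul {τ : ∀ p, (⨂[ℂ]^r (S p)) →ₗ[ℂ] CanonicalFiber X p} (hr : 0 < r)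
    {ψ : ℂ → X} {f : ℂ → ℂ} (hf : ∀ z, ∀ᶠ w in 𝓝[≠] z, f w ≠ 0) {V : Set ℂ} (hV : IsOpen V)
    (hVc : IsPreconnected V) {s s' : ∀ z, S (ψ z)} (hs : IsFrameOn τ ψ f V s)
    (hs' : IsFrameOn τ ψ f V s') : ∃ η : ℂ, η ^ r = 1 ∧ ∀ z ∈ V, s' z = η • s z := by
  rcases V.eq_empty_or_nonempty with rfl | ⟨z₁, hz₁⟩
  · exact ⟨1, one_pow _, fun z hz => hz.elim⟩
  have hex : ∀ z, ∃ c : ℂ, z ∈ V → s' z = c • s z := fun z => by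
    by_cases hz : z ∈ V
    · obtain ⟨c, hc⟩ := exists_smul_eq_of_ne_zero (hs.2 z hz).1 (s' z)
      exact ⟨c, fun _ => hc⟩
    · exact ⟨0, fun h => absurd h hz⟩
  choose c hc using hex
  have hcc : ContinuousOn c V := fun z hz =>
    (hs.1 z hz).ratio_total ((hs'.1 z hz).congr (fun w hw => by rw [hc w hw])
      (by rw [hc z hz])) (hs.2 z hz).1
  have hroot : ∀ z ∈ V, f z ≠ 0 → c z ^ r = 1 := fun z hz hfz => by
    have h1 := (hs'.2 z hz).2
    rw [hc z hz, rVal_smul, (hs.2 z hz).2] at h1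
    exact mul_right_cancel₀ hfz (by rw [h1, one_mul])
  -- At the zeros of `f` the normalization says nothing about the ratio; these are isolated, so
  -- continuity extends the equation.
  have hroot' : ∀ z ∈ V, c z ^ r = 1 := fun z hz => by
    have h1 : Tendsto (fun w => c w ^ r) (𝓝[≠] z) (𝓝 (c z ^ r)) :=
      ((hcc.continuousAt (hV.mem_nhds hz)).pow r).tendsto.mono_left nhdsWithin_le_nhds
    refine tendsto_nhds_unique h1 (tendsto_const_nhds.congr' ?_)
    filter_upwards [hf z, nhdsWithin_le_nhds (hV.mem_nhds hz)] with w h2 h3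
    exact (hroot w h3 h2).symm
  have hfin : {x : ℂ | x ^ r = 1}.Finite := by
    refine (Polynomial.nthRoots r (1 : ℂ)).toFinset.finite_toSet.subset fun x hx => ?_
    simpa [Polynomial.mem_nthRoots hr] using hx
  refine ⟨c z₁, hroot' z₁ hz₁, fun z hz => ?_⟩
  rw [hc z hz, hVc.constant_of_mapsTo hfin.isDiscrete hcc hroot' hz hz₁]

theorem IsFrameOn.smul {τ : ∀ p, (⨂[ℂ]^r (S p)) →ₗ[ℂ] CanonicalFiber X p} {ψ : ℂ → X} {f : ℂ → ℂ}
    {U : Set ℂ} {s : ∀ z, S (ψ z)} (h : IsFrameOn τ ψ f U s) {c : ℂ} (hc : c ≠ 0) :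
    IsFrameOn τ ψ (fun z => c ^ r * f z) U (fun z => c • s z) :=
  ⟨fun z hz => continuousWithinAt_const.smul_total (h.1 z hz), fun z hz =>
    ⟨smul_ne_zero hc (h.2 z hz).1, by rw [rVal_smul, (h.2 z hz).2]⟩⟩

theorem IsFrameOn.smul_root {τ : ∀ p, (⨂[ℂ]^r (S p)) →ₗ[ℂ] CanonicalFiber X p} {ψ : ℂ → X}
    {f : ℂ → ℂ} {U : Set ℂ} {s : ∀ z, S (ψ z)} (h : IsFrameOn τ ψ f U s) (hr : 0 < r) {c : ℂ}
    (hc : c ^ r = 1) : IsFrameOn τ ψ f U (fun z => c • s z) := by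
  have hc0 : c ≠ 0 := by
    rintro rfl
    rw [zero_pow hr.ne'] at hc
    exact zero_ne_one hc
  have := h.smul hc0
  simpa only [hc, one_mul] using this

theorem IsFrameOn.congr {τ : ∀ p, (⨂[ℂ]^r (S p)) →ₗ[ℂ] CanonicalFiber X p} {ψ : ℂ → X} {f : ℂ → ℂ}
    {U : Set ℂ} {s s' : ∀ z, S (ψ z)} (h : IsFrameOn τ ψ f U s) (hs : ∀ z ∈ U, s' z = s z) :
    IsFrameOn τ ψ f U s' :=
  ⟨h.1.congr fun z hz => by rw [hs z hz], fun z hz => by rw [hs z hz]; exact h.2 z hz⟩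

theorem IsFrameOn.union {τ : ∀ p, (⨂[ℂ]^r (S p)) →ₗ[ℂ] CanonicalFiber X p} {ψ : ℂ → X} {f : ℂ → ℂ}
    {U V : Set ℂ} {s : ∀ z, S (ψ z)} (hU : IsOpen U) (hV : IsOpen V) (h : IsFrameOn τ ψ f U s)
    (h' : IsFrameOn τ ψ f V s) : IsFrameOn τ ψ f (U ∪ V) s := by
  refine ⟨h.1.union_of_isOpen h'.1 hU hV, ?_⟩
  rintro z (hz | hz)
  exacts [h.2 z hz, h'.2 z hz]

/-- There is a normalized frame over a neighbourhood of `K`. -/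
def HasFrameNear (τ : ∀ p, (⨂[ℂ]^r (S p)) →ₗ[ℂ] CanonicalFiber X p) (ψ : ℂ → X) (f : ℂ → ℂ)
    (K : Set ℂ) : Prop :=
  ∃ U : Set ℂ, IsOpen U ∧ K ⊆ U ∧ ∃ s : ∀ z, S (ψ z), IsFrameOn τ ψ f U s

/-- Thickenings of convex sets are convex, so the overlap is connected and the two frames differ
there by a constant root of unity, which can be absorbed into one of them. -/
theorem HasFrameNear.union {τ : ∀ p, (⨂[ℂ]^r (S p)) →ₗ[ℂ] CanonicalFiber X p} (hr : 0 < r)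
    {ψ : ℂ → X} {f : ℂ → ℂ} (hf : ∀ z, ∀ᶠ w in 𝓝[≠] z, f w ≠ 0) {K L : Set ℂ}
    (hK : IsCompact K) (hKc : Convex ℝ K) (hL : IsCompact L) (hLc : Convex ℝ L)
    (h : HasFrameNear τ ψ f K) (h' : HasFrameNear τ ψ f L) : HasFrameNear τ ψ f (K ∪ L) := by
  classical
  obtain ⟨U, hU, hKU, s, hs⟩ := h
  obtain ⟨V, hV, hLV, t, ht⟩ := h'
  obtain ⟨δ, hδ, hδU⟩ := hK.exists_thickening_subset_open hU hKU
  obtain ⟨ε, hε, hεV⟩ := hL.exists_thickening_subset_open hV hLV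
  have h1 := Metric.isOpen_thickening (δ := δ) (E := K)
  have h2 := Metric.isOpen_thickening (δ := ε) (E := L)
  obtain ⟨η, hη, hst⟩ := IsFrameOn.eq_smul hr hf (h1.inter h2)
    ((hKc.thickening δ).inter (hLc.thickening ε)).isPreconnected
    (ht.mono (inter_subset_right.trans hεV)) (hs.mono (inter_subset_left.trans hδU))
  refine ⟨_, h1.union h2, union_subset_union (Metric.self_subset_thickening hδ K)
    (Metric.self_subset_thickening hε L),
    fun z => if z ∈ Metric.thickening δ K then s z else η • t z, ?_⟩
  refine IsFrameOn.union h1 h2 ((hs.mono hδU).congr fun z hz => if_pos hz)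
    (((ht.mono hεV).smul_root hr hη).congr fun z hz => ?_)
  split_ifs with hz'
  · exact hst z ⟨hz', hz⟩
  · rfl

/-- A property of compact intervals which is additive and holds locally holds for all
compact intervals. -/
theorem interval_induction {Q : ℝ → ℝ → Prop}
    (hadd : ∀ x y z, x ≤ y → y ≤ z → Q x y → Q y z → Q x z)
    (hloc : ∀ t, ∃ δ > 0, ∀ x y, t - δ < x → x ≤ y → y < t + δ → Q x y) {x y : ℝ} (hxy : x ≤ y) :
    Q x y := by
  choose δ hδ hQ using hloc
  obtain ⟨t, ht0, htm, ⟨m, hm⟩, ht⟩ := exists_monotone_Icc_subset_open_cover_Icc hxy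
    (c := fun u : ℝ => {v : Icc x y | u - δ u < v ∧ v < u + δ u})
    (fun u => (isOpen_lt continuous_const continuous_subtype_val).inter
      (isOpen_lt continuous_subtype_val continuous_const))
    (fun v _ => mem_iUnion.2 ⟨v, by have := hδ v; constructor <;> linarith⟩)
  have hstep : ∀ n, Q (t n) (t (n + 1)) := fun n => by
    obtain ⟨u, hu⟩ := ht n
    exact hQ u _ _ (hu ⟨le_rfl, htm n.le_succ⟩).1 (htm n.le_succ) (hu ⟨htm n.le_succ, le_rfl⟩).2
  have hall : ∀ n, Q (t 0) (t (n + 1)) := fun n => by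
    induction n with
    | zero => exact hstep 0
    | succ n ih => exact hadd _ _ _ (htm (Nat.zero_le _)) (htm (n + 1).le_succ) ih (hstep (n + 1))
  have := hall m
  rwa [ht0, hm (m + 1) m.le_succ] at this

theorem HasFrameNear.mono {τ : ∀ p, (⨂[ℂ]^r (S p)) →ₗ[ℂ] CanonicalFiber X p} {ψ : ℂ → X}
    {f : ℂ → ℂ} {K L : Set ℂ} (h : HasFrameNear τ ψ f K) (hLK : L ⊆ K) : HasFrameNear τ ψ f L := by
  obtain ⟨U, hU, hKU, s⟩ := h
  exact ⟨U, hU, hLK.trans hKU, s⟩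

theorem convex_reProdIm {s t : Set ℝ} (hs : Convex ℝ s) (ht : Convex ℝ t) :
    Convex ℝ (s ×ℂ t) :=
  (hs.is_linear_preimage Complex.reLm.isLinear).inter (ht.is_linear_preimage Complex.imLm.isLinear)

/-- A segment is covered by small intervals and the square by thin strips around segments,
compactness of a segment supplying the width of its strip. This is where the absence of monodromy on
the plane enters. -/
theorem hasFrameNear_square {τ : ∀ p, (⨂[ℂ]^r (S p)) →ₗ[ℂ] CanonicalFiber X p} (hr : 0 < r)
    {ψ : ℂ → X} {f : ℂ → ℂ} (hf : ∀ z, ∀ᶠ w in 𝓝[≠] z, f w ≠ 0)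
    (hloc : ∀ z, HasFrameNear τ ψ f {z}) {R : ℝ} (hR : 0 ≤ R) :
    HasFrameNear τ ψ f (Icc (-R) R ×ℂ Icc (-R) R) := by
  have hseg : ∀ t, HasFrameNear τ ψ f (Icc (-R) R ×ℂ {t}) := fun t => by
    refine interval_induction (Q := fun x y => HasFrameNear τ ψ f (Icc x y ×ℂ {t})) ?_ ?_
      (by linarith : -R ≤ R)
    · intro x y z hxy hyz h1 h2
      refine (HasFrameNear.union hr hf (isCompact_Icc.reProdIm isCompact_singleton)
        (convex_reProdIm (convex_Icc x y) (convex_singleton t))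
        (isCompact_Icc.reProdIm isCompact_singleton)
        (convex_reProdIm (convex_Icc y z) (convex_singleton t)) h1 h2).mono ?_
      rintro w ⟨hw1, hw2⟩
      rcases le_total w.re y with h | h
      · exact Or.inl ⟨⟨hw1.1, h⟩, hw2⟩
      · exact Or.inr ⟨⟨h, hw1.2⟩, hw2⟩
    · intro u
      obtain ⟨U, hU, huU, hs⟩ := hloc ⟨u, t⟩
      obtain ⟨δ, hδ, hball⟩ := Metric.isOpen_iff.1 hU _ (huU rfl)
      refine ⟨δ, hδ, fun x y hx hxy hy => ⟨U, hU, fun w hw => hball ?_, hs⟩⟩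
      obtain ⟨hw1, hw2⟩ := hw
      have h2 : w.im = t := hw2
      rw [Metric.mem_ball, Complex.dist_of_im_eq h2, Real.dist_eq, abs_lt]
      have h3 : x ≤ w.re := hw1.1
      have h4 : w.re ≤ y := hw1.2
      constructor <;> simp <;> linarith
  refine interval_induction (Q := fun x y => HasFrameNear τ ψ f (Icc (-R) R ×ℂ Icc x y)) ?_ ?_
      (by linarith : -R ≤ R)
  · intro x y z hxy hyz h1 h2
    refine (HasFrameNear.union hr hf (isCompact_Icc.reProdIm isCompact_Icc)
      (convex_reProdIm (convex_Icc _ _) (convex_Icc _ _))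
      (isCompact_Icc.reProdIm isCompact_Icc)
      (convex_reProdIm (convex_Icc _ _) (convex_Icc _ _)) h1 h2).mono ?_
    rintro w ⟨hw1, hw2⟩
    rcases le_total w.im y with h | h
    · exact Or.inl ⟨hw1, ⟨hw2.1, h⟩⟩
    · exact Or.inr ⟨hw1, ⟨h, hw2.2⟩⟩
  · intro t
    obtain ⟨U, hU, hKU, hs⟩ := hseg t
    obtain ⟨δ, hδ, hthick⟩ :=
      (isCompact_Icc.reProdIm isCompact_singleton).exists_thickening_subset_open hU hKU
    refine ⟨δ, hδ, fun x y hx hxy hy => ⟨U, hU, fun w hw => hthick ?_, hs⟩⟩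
    obtain ⟨hw1, hw2⟩ := hw
    rw [Metric.mem_thickening_iff]
    refine ⟨⟨w.re, t⟩, ⟨hw1, rfl⟩, ?_⟩
    rw [Complex.dist_of_re_eq (z := w) (w := ⟨w.re, t⟩) rfl, Real.dist_eq, abs_lt]
    have h3 : x ≤ w.im := hw2.1
    have h4 : w.im ≤ y := hw2.2
    constructor <;> simp <;> linarith

/-- Frames over growing balls are rescaled by roots of unity to agree with the first one on the unit
ball; since two normalized frames on a ball differ by a constant, they then agree wherever both are
defined. -/
theorem exists_isFrameOn_univ {τ : ∀ p, (⨂[ℂ]^r (S p)) →ₗ[ℂ] CanonicalFiber X p} (hr : 0 < r)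
    {ψ : ℂ → X} {f : ℂ → ℂ} (hf : ∀ z, ∀ᶠ w in 𝓝[≠] z, f w ≠ 0)
    (hloc : ∀ z, HasFrameNear τ ψ f {z}) : ∃ s : ∀ z, S (ψ z), IsFrameOn τ ψ f univ s := by
  have hball : ∀ n : ℕ, ∃ s : ∀ z, S (ψ z), IsFrameOn τ ψ f (Metric.ball 0 n) s := fun n => by
    obtain ⟨U, hU, hKU, s, hs⟩ := hasFrameNear_square hr hf hloc (Nat.cast_nonneg n)
    refine ⟨s, hs.mono fun z hz => hKU ?_⟩
    rw [mem_ball_zero_iff] at hz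
    exact ⟨abs_le.1 ((Complex.abs_re_le_norm z).trans hz.le),
      abs_le.1 ((Complex.abs_im_le_norm z).trans hz.le)⟩
  choose s hs using hball
  have hsub : ∀ {m n : ℕ}, m ≤ n → Metric.ball (0 : ℂ) m ⊆ Metric.ball 0 n := fun h =>
    Metric.ball_subset_ball (Nat.cast_le.2 h)
  have hη : ∀ n : ℕ, ∃ η : ℂ, η ^ r = 1 ∧
      ∀ z ∈ Metric.ball (0 : ℂ) (1 : ℕ), s 1 z = η • s (n + 1) z := fun n =>
    IsFrameOn.eq_smul hr hf Metric.isOpen_ball (convex_ball _ _).isPreconnected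
      ((hs (n + 1)).mono (hsub (by omega))) (hs 1)
  choose η hη1 hη2 using hη
  have hs' : ∀ n, IsFrameOn τ ψ f (Metric.ball 0 (n + 1 : ℕ)) fun z => η n • s (n + 1) z := fun n =>
    (hs (n + 1)).smul_root hr (hη1 n)
  have h0 : (0 : ℂ) ∈ Metric.ball (0 : ℂ) (1 : ℕ) := by simp
  have hagree : ∀ m n, m ≤ n → ∀ z ∈ Metric.ball (0 : ℂ) (m + 1 : ℕ),
      η n • s (n + 1) z = η m • s (m + 1) z := fun m n hmn z hz => by
    obtain ⟨c, -, hc⟩ := IsFrameOn.eq_smul hr hf Metric.isOpen_ball (convex_ball _ _).isPreconnected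
      (hs' m) ((hs' n).mono (hsub (by omega)))
    have h1 := hc 0 (hsub (by omega) h0)
    rw [← hη2 n 0 h0, ← hη2 m 0 h0] at h1
    have hne := ((hs 1).2 0 h0).1
    have hc1 : c = 1 := by
      have : (c - 1) • s 1 0 = 0 := by rw [sub_smul, one_smul, ← h1, sub_self]
      exact sub_eq_zero.1 ((smul_eq_zero.1 this).resolve_right hne)
    rw [hc z hz, hc1, one_smul]
  -- The index `⌊‖z‖⌋₊ + 1` is the radius of a ball certain to contain `z`.
  set t : ∀ z, S (ψ z) := fun z => η ⌊‖z‖⌋₊ • s (⌊‖z‖⌋₊ + 1) z with ht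
  have hball' : ∀ z : ℂ, ∀ n : ℕ, z ∈ Metric.ball (0 : ℂ) (n + 1 : ℕ) →
      t z = η n • s (n + 1) z := fun z n hz => by
    rw [mem_ball_zero_iff] at hz
    have h1 : ⌊‖z‖⌋₊ ≤ n := by
      have := (Nat.floor_lt (norm_nonneg z)).2 hz
      omega
    refine (hagree _ _ h1 z ?_).symm
    rw [mem_ball_zero_iff]
    push_cast
    exact Nat.lt_floor_add_one _
  have hfr : ∀ n : ℕ, IsFrameOn τ ψ f (Metric.ball 0 (n + 1 : ℕ)) t := fun n =>
    (hs' n).congr fun z hz => hball' z n hz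
  have hmem : ∀ z : ℂ, z ∈ Metric.ball (0 : ℂ) (⌊‖z‖⌋₊ + 1 : ℕ) := fun z => by
    rw [mem_ball_zero_iff]
    push_cast
    exact Nat.lt_floor_add_one _
  exact ⟨t, fun z _ => (((hfr _).1.continuousAt
    (Metric.isOpen_ball.mem_nhds (hmem z))).continuousWithinAt), fun z _ => (hfr _).2 z (hmem z)⟩

end Frames

/-! ### Invariant frames and a real polynomial with the divisor of the twists -/

section RealFrames

set_option linter.unusedSectionVars false
variable {X : Type*} [TopologicalSpace X] [ChartedSpace ℂ X] [IsManifold 𝓘(ℂ) ω X]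
  {I B : Type*} [Fintype I] [Fintype B] {r : ℕ} {M : MarkedDisk X I B} {a : I → ℕ} {b : B → ℕ}
  {S : X → Type*} [∀ p, AddCommGroup (S p)] [∀ p, Module ℂ (S p)]
  [TopologicalSpace (TotalSpace ℂ S)] [∀ p, TopologicalSpace (S p)]
  [FiberBundle ℂ S] [VectorBundle ℂ ℂ S]
  [ContMDiffVectorBundle ω ℂ S 𝓘(ℂ)]

namespace TwistedSpin

/-- `inv_antiholomorphic` only concerns sections. Writing each vector as a continuous multiple of a
local holomorphic frame transfers continuity to the total space. -/
theorem continuous_totalMap (P : TwistedSpin r M a b S) : Continuous (totalMap M.φ P.inv) := by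
  rw [continuous_iff_continuousAt]
  intro q₀
  obtain ⟨U, t, hU, hq₀, ht, ht0⟩ := exists_holomorphic_frame S q₀.1
  have hφ := M.antiholomorphic.1
  have hproj : Continuous (π ℂ S) := FiberBundle.continuous_proj ℂ S
  have hUn : π ℂ S ⁻¹' U ∈ 𝓝 q₀ := (hU.preimage hproj).mem_nhds hq₀
  have hex : ∀ q : TotalSpace ℂ S, ∃ c : ℂ, q.1 ∈ U → q.2 = c • t q.1 := fun q => by
    by_cases hq : q.1 ∈ U
    · obtain ⟨c, hc⟩ := exists_smul_eq_of_ne_zero (ht0 _ hq) q.2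
      exact ⟨c, fun _ => hc⟩
    · exact ⟨0, fun h => absurd h hq⟩
  choose c hc using hex
  have ht1 : ContinuousAt (fun q : TotalSpace ℂ S => (⟨q.1, t q.1⟩ : TotalSpace ℂ S)) q₀ :=
    (ht.continuousOn.continuousAt (hU.mem_nhds hq₀)).comp hproj.continuousAt
  have hcc : ContinuousAt c q₀ := by
    rw [← continuousWithinAt_univ] at ht1 ⊢
    refine ht1.ratio_total ?_ (ht0 _ hq₀)
    rw [continuousWithinAt_univ]
    refine continuousAt_id.congr ?_
    filter_upwards [hUn] with q hq
    rw [← hc q hq]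
    rfl
  have hinv : ContinuousAt (fun q : TotalSpace ℂ S =>
      (⟨M.φ q.1, P.inv q.1 (t q.1)⟩ : TotalSpace ℂ S)) q₀ := by
    have h1 : ContinuousAt (fun p => totalMap M.φ P.inv ⟨M.φ p, t (M.φ p)⟩) (M.φ q₀.1) :=
      (P.inv_antiholomorphic U t hU ht).continuousOn.continuousAt
        ((hU.preimage hφ).mem_nhds (by rw [mem_preimage, M.involutive]; exact hq₀))
    have h2 := (ContinuousAt.comp (f := M.φ) h1 hφ.continuousAt).comp (hproj.continuousAt (x := q₀))
    refine h2.congr (Eventually.of_forall fun q => ?_)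
    exact congrArg (fun p => totalMap M.φ P.inv ⟨p, t p⟩) (M.involutive q.1)
  rw [← continuousWithinAt_univ] at hinv hcc ⊢
  have h3 := (Complex.continuous_conj.continuousAt.comp_continuousWithinAt hcc).smul_total hinv
  rw [continuousWithinAt_univ] at h3 ⊢
  refine h3.congr ?_
  filter_upwards [hUn] with q hq
  rw [totalMap]
  congr 1
  conv_rhs => rw [hc q hq, map_smulₛₗ]
  rfl

theorem totalMap_smul (P : TwistedSpin r M a b S) {p p' : X} {v : S p} {v' : S p'} (c : ℂ)
    (h : totalMap M.φ P.inv ⟨p, v⟩ = ⟨p', v'⟩) :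
    totalMap M.φ P.inv ⟨p, c • v⟩ = ⟨p', starRingEnd ℂ c • v'⟩ := by
  rw [totalMap]
  dsimp only
  rw [map_smulₛₗ]
  exact congrArg (fun q : TotalSpace ℂ S => (⟨q.1, starRingEnd ℂ c • q.2⟩ : TotalSpace ℂ S)) h

theorem rVal_inv (P : TwistedSpin r M a b S) {ψ : ℂ → X} (hψ : IsParam ψ)
    (hconj : ∀ z, M.φ (ψ z) = ψ (starRingEnd ℂ z)) {z : ℂ} {v : S (ψ z)}
    {v' : S (ψ (starRingEnd ℂ z))} (h : totalMap M.φ P.inv ⟨ψ z, v⟩ = ⟨_, v'⟩) :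
    rVal P.τ (ψ (starRingEnd ℂ z)) v' (vel ψ (starRingEnd ℂ z)) =
      starRingEnd ℂ (rVal P.τ (ψ z) v (vel ψ z)) := by
  have h1 := P.τ_inv (ψ z) v (vel ψ z)
  have h2 := conjDeriv_vel M.antiholomorphic hψ hconj z 1
  rw [one_mul, map_one, one_mul] at h2
  have h3 : rVal P.τ (M.φ (ψ z)) (P.inv (ψ z) v) (conjDeriv M.φ (ψ z) (vel ψ z)) =
    starRingEnd ℂ (rVal P.τ (ψ z) v (vel ψ z)) := h1
  have h4 : rVal P.τ (M.φ (ψ z)) (P.inv (ψ z) v) (conjDeriv M.φ (ψ z) (vel ψ z)) =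
      rVal P.τ (M.φ (ψ z)) (P.inv (ψ z) v) (vel ψ (starRingEnd ℂ z)) :=
    congrArg (rVal P.τ (M.φ (ψ z)) (P.inv (ψ z) v)) h2
  rw [← h3, h4]
  exact (rVal_congr P.τ h _).symm

/-- `σ` is a continuous frame over the whole parametrization, normalized by
`τ(σ^{⊗ r}) = F(z) dz` and invariant under the conjugation. -/
structure IsRealFrame (P : TwistedSpin r M a b S) (ψ : ℂ → X) (F : ℂ → ℂ)
    (σ : ∀ z, S (ψ z)) : Prop where
  frame : IsFrameOn P.τ ψ F univ σ
  inv : ∀ z, totalMap M.φ P.inv ⟨ψ z, σ z⟩ = ⟨ψ (starRingEnd ℂ z), σ (starRingEnd ℂ z)⟩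

/-- As `f` is real, the conjugate of a normalized frame `s` is again normalized, hence equals `η •
s` with `η ^ r = 1`. If `l ^ 2 = η`, then `l • s` is invariant, but it is normalized by `l ^ r =
±1`. This is the origin of the sign `ε`, which governs compatibility for even `r`. -/
theorem exists_isRealFrame (P : TwistedSpin r M a b S) (hr : 0 < r) {ψ : ℂ → X}
    (hψ : IsBdryChart M ψ) {f : ℂ → ℂ} (hf : ∀ z, AnalyticAt ℂ f z)
    (hord : ∀ z, analyticOrderAt f z = (M.divisor a b (ψ z) : ℕ∞))
    (hfc : ∀ z, f (starRingEnd ℂ z) = starRingEnd ℂ (f z)) :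
    ∃ (ε : ℝ) (σ : ∀ z, S (ψ z)), (ε = 1 ∨ ε = -1) ∧
      P.IsRealFrame ψ (fun z => (ε : ℂ) * f z) σ := by
  have hne : ∀ z, ∀ᶠ w in 𝓝[≠] z, f w ≠ 0 := fun z => by
    refine (hf z).eventually_eq_zero_or_eventually_ne_zero.resolve_left fun h => ?_
    rw [← analyticOrderAt_eq_top, hord z] at h
    exact ENat.natCast_ne_top _ h
  obtain ⟨s, hs⟩ := exists_isFrameOn_univ (τ := P.τ) hr hne fun z => by
    obtain ⟨U, hU, hzU, hs⟩ := P.exists_local_frame hr hψ.toIsParam (hf z) (hord z)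
    exact ⟨U, hU, singleton_subset_iff.2 hzU, hs⟩
  have hex : ∀ z, ∃ v : S (ψ z), totalMap M.φ P.inv
      ⟨ψ (starRingEnd ℂ z), s (starRingEnd ℂ z)⟩ = ⟨ψ z, v⟩ := fun z => by
    have h1 : (totalMap M.φ P.inv ⟨ψ (starRingEnd ℂ z), s (starRingEnd ℂ z)⟩).1 = ψ z := by
      change M.φ (ψ (starRingEnd ℂ z)) = ψ z
      rw [hψ.conj, Complex.conj_conj]
    rw [← h1]
    exact ⟨_, rfl⟩
  choose s' hs' using hex
  have hs'' : ∀ z, totalMap M.φ P.inv ⟨ψ z, s z⟩ =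
      ⟨ψ (starRingEnd ℂ z), s' (starRingEnd ℂ z)⟩ := fun z => by
    rw [← hs' (starRingEnd ℂ z), Complex.conj_conj]
  have hsc : Continuous fun z => (⟨ψ z, s z⟩ : TotalSpace ℂ S) := continuousOn_univ.1 hs.1
  have hframe' : IsFrameOn P.τ ψ f univ s' := by
    refine ⟨?_, fun z _ => ?_⟩
    · refine Continuous.continuousOn ?_
      have h1 := P.continuous_totalMap.comp (hsc.comp Complex.continuous_conj)
      refine h1.congr fun z => ?_
      exact hs' z
    · have h1 := P.rVal_inv hψ.toIsParam hψ.conj (hs'' (starRingEnd ℂ z))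
      rw [Complex.conj_conj, (hs.2 _ trivial).2, hfc, Complex.conj_conj] at h1
      refine ⟨fun h0 => ?_, h1⟩
      have h2 := congrArg (totalMap M.φ P.inv) (hs' z)
      rw [P.inv_involutive, h0] at h2
      have h3 := P.totalMap_smul (p := ψ z) (v := (0 : S (ψ z))) 0 h2.symm
      rw [zero_smul, map_zero, zero_smul] at h3
      have h4 := h2.trans h3
      exact (hs.2 (starRingEnd ℂ z) trivial).1 (eq_of_heq (TotalSpace.mk.inj h4).2)
  obtain ⟨η, hη, hss'⟩ := IsFrameOn.eq_smul hr hne isOpen_univ isPreconnected_univ hs hframe'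
  obtain ⟨l, hl⟩ := IsAlgClosed.exists_pow_nat_eq η (n := 2) (by norm_num)
  have hl1 : l * starRingEnd ℂ l = 1 := by
    have h1 : ‖l‖ = 1 := by
      have h2 : ‖l‖ ^ (2 * r) = 1 := by rw [← norm_pow, pow_mul, hl, hη, norm_one]
      exact (pow_eq_one_iff_of_nonneg (norm_nonneg l) (by omega)).1 h2
    rw [Complex.mul_conj, Complex.normSq_eq_norm_sq, h1]
    simp
  have hl0 : l ≠ 0 := left_ne_zero_of_mul_eq_one hl1
  have hlr : l ^ r = 1 ∨ l ^ r = -1 := by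
    rw [← sq_eq_one_iff, ← pow_mul, mul_comm, pow_mul, hl, hη]
  obtain ⟨ε, hε, hεl⟩ : ∃ ε : ℝ, (ε = 1 ∨ ε = -1) ∧ l ^ r = (ε : ℂ) := by
    rcases hlr with h | h
    · exact ⟨1, Or.inl rfl, by simp [h]⟩
    · exact ⟨-1, Or.inr rfl, by simp [h]⟩
  refine ⟨ε, fun z => l • s z, hε, by simpa only [hεl] using hs.smul hl0, fun z => ?_⟩
  rw [P.totalMap_smul l (hs'' z), hss' _ trivial, smul_smul]
  congr 2
  rw [← hl]
  linear_combination l * hl1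

end TwistedSpin

theorem analyticOrderAt_affine {α β : ℂ} (h : α ≠ 0 ∨ β ≠ 0) (z : ℂ) [Decidable (α * z + β = 0)] :
    analyticOrderAt (fun z => α * z + β) z = if α * z + β = 0 then 1 else 0 := by
  have ha : AnalyticAt ℂ (fun z => α * z + β) z :=
    (analyticAt_const.mul analyticAt_id).add analyticAt_const
  split_ifs with h0
  · have hα : α ≠ 0 := by
      rintro rfl
      simp at h h0
      exact h h0
    have hd : HasDerivAt (fun z => α * z + β) α z := by
      simpa using ((hasDerivAt_id z).const_mul α).add_const β
    have := ha.analyticOrderAt_sub_eq_one_of_deriv_ne_zero (by rw [hd.deriv]; exact hα)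
    simpa [h0] using this
  · exact ha.analyticOrderAt_eq_zero.2 h0

theorem analyticOrderAt_finset_prod {ι : Type*} (t : Finset ι) {f : ι → ℂ → ℂ} {z : ℂ}
    (hf : ∀ i, AnalyticAt ℂ (f i) z) :
    analyticOrderAt (fun w => ∏ i ∈ t, f i w) z = ∑ i ∈ t, analyticOrderAt (f i) z := by
  classical
  induction t using Finset.induction_on with
  | empty =>
    simp only [Finset.prod_empty, Finset.sum_empty]
    exact analyticAt_const.analyticOrderAt_eq_zero.2 one_ne_zero
  | insert i t hi ih =>
    simp only [Finset.prod_insert hi, Finset.sum_insert hi]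
    rw [← ih]
    exact analyticOrderAt_mul (hf i) (t.analyticAt_fun_prod fun j _ => hf j)

/-- The product of powers of the functions `g p` with the exponents prescribed by the twists. -/
def divisorProd (M : MarkedDisk X I B) (a : I → ℕ) (b : B → ℕ) (g : X → ℂ → ℂ) (z : ℂ) : ℂ :=
  (∏ i, g (M.z i) z ^ a i) * (∏ i, g (M.φ (M.z i)) z ^ a i) * ∏ j, g (M.x j) z ^ b j

theorem analyticAt_divisorProd (M : MarkedDisk X I B) (a : I → ℕ) (b : B → ℕ) {g : X → ℂ → ℂ}
    (hg : ∀ p z, AnalyticAt ℂ (g p) z) (z : ℂ) : AnalyticAt ℂ (divisorProd M a b g) z :=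
  ((Finset.univ.analyticAt_fun_prod fun _ _ => (hg _ z).pow _).mul
    (Finset.univ.analyticAt_fun_prod fun _ _ => (hg _ z).pow _)).mul
    (Finset.univ.analyticAt_fun_prod fun _ _ => (hg _ z).pow _)

open Classical in
theorem analyticOrderAt_prod_pow {ι : Type*} [Fintype ι] {g : X → ℂ → ℂ} {p : X} {z : ℂ}
    (hg : ∀ p, AnalyticAt ℂ (g p) z)
    (hord : ∀ p', analyticOrderAt (g p') z = if p' = p then 1 else 0) (q : ι → X) (n : ι → ℕ) :
    analyticOrderAt (fun w => ∏ i, g (q i) w ^ n i) z =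
      ((∑ i, if q i = p then n i else 0 : ℕ) : ℕ∞) := by
  rw [analyticOrderAt_finset_prod (f := fun i w => g (q i) w ^ n i) _ fun i => (hg _).pow _,
    Nat.cast_sum]
  refine Finset.sum_congr rfl fun i _ => ?_
  refine (analyticOrderAt_pow (hg (q i)) (n i)).trans ?_
  rw [hord]
  split_ifs <;> simp

theorem analyticOrderAt_divisorProd (M : MarkedDisk X I B) (a : I → ℕ) (b : B → ℕ) {ψ : ℂ → X}
    {g : X → ℂ → ℂ} {z : ℂ} [DecidableEq X] (hg : ∀ p, AnalyticAt ℂ (g p) z)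
    (hord : ∀ p, analyticOrderAt (g p) z = if p = ψ z then 1 else 0) :
    analyticOrderAt (divisorProd M a b g) z = (M.divisor a b (ψ z) : ℕ∞) := by
  have hord' : ∀ p, analyticOrderAt (g p) z =
      @ite _ (p = ψ z) (Classical.propDecidable _) 1 0 := fun p => by
    rw [hord]; congr
  have hA : ∀ (q : I → X) (n : I → ℕ), AnalyticAt ℂ (fun w => ∏ i, g (q i) w ^ n i) z :=
    fun q n => Finset.univ.analyticAt_fun_prod fun _ _ => (hg _).pow _
  have hB : ∀ (q : B → X) (n : B → ℕ), AnalyticAt ℂ (fun w => ∏ i, g (q i) w ^ n i) z :=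
    fun q n => Finset.univ.analyticAt_fun_prod fun _ _ => (hg _).pow _
  have h2 := analyticOrderAt_mul ((hA M.z a).mul (hA (fun i => M.φ (M.z i)) a)) (hB M.x b)
  refine h2.trans ?_
  rw [analyticOrderAt_mul (hA M.z a) (hA (fun i => M.φ (M.z i)) a),
    analyticOrderAt_prod_pow hg hord', analyticOrderAt_prod_pow hg hord',
    analyticOrderAt_prod_pow hg hord', MarkedDisk.divisor]
  push_cast
  rfl

/-- Conjugation exchanges the factors at the internal points with those at their conjugates and
preserves the boundary factors. -/
theorem divisorProd_conj (M : MarkedDisk X I B) (a : I → ℕ) (b : B → ℕ) {g : X → ℂ → ℂ}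
    (hg : ∀ p z, g (M.φ p) (starRingEnd ℂ z) = starRingEnd ℂ (g p z)) (z : ℂ) :
    divisorProd M a b g (starRingEnd ℂ z) = starRingEnd ℂ (divisorProd M a b g z) := by
  have h1 : ∀ i, g (M.z i) (starRingEnd ℂ z) = starRingEnd ℂ (g (M.φ (M.z i)) z) := fun i => by
    rw [← hg, M.involutive]
  have h2 : ∀ j, g (M.x j) (starRingEnd ℂ z) = starRingEnd ℂ (g (M.x j) z) := fun j => by
    rw [← hg, M.x_mem]
  simp only [divisorProd, map_mul, map_prod, map_pow, h1, h2, hg]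
  ring

open Classical in
/-- The linear factor vanishing at `p` in the parametrization `ψ`. -/
def paramFactor (ψ : ℂ → X) (p : X) (z : ℂ) : ℂ :=
  if h : ∃ w, ψ w = p then z - h.choose else 1

theorem paramFactor_apply {ψ : ℂ → X} (hψ : Function.Injective ψ) (w z : ℂ) :
    paramFactor ψ (ψ w) z = z - w := by
  have h : ∃ w', ψ w' = ψ w := ⟨w, rfl⟩
  rw [paramFactor, dif_pos h, hψ h.choose_spec]

theorem paramFactor_of_notMem {ψ : ℂ → X} {p : X} (hp : p ∉ range ψ) (z : ℂ) :
    paramFactor ψ p z = 1 := dif_neg hp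

open Classical in
theorem paramFactor_spec {ψ : ℂ → X} (hψ : Function.Injective ψ) (p : X) (z : ℂ) :
    AnalyticAt ℂ (paramFactor ψ p) z ∧
      analyticOrderAt (paramFactor ψ p) z = if p = ψ z then 1 else 0 := by
  by_cases hp : p ∈ range ψ
  · obtain ⟨w, rfl⟩ := hp
    have h1 : paramFactor ψ (ψ w) = fun z => 1 * z + (-w) := by
      funext z; rw [paramFactor_apply hψ]; ring
    rw [h1]
    refine ⟨(analyticAt_const.mul analyticAt_id).add analyticAt_const, ?_⟩
    rw [analyticOrderAt_affine (Or.inl one_ne_zero)]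
    refine if_congr ?_ rfl rfl
    rw [hψ.eq_iff, one_mul, ← sub_eq_add_neg, sub_eq_zero, eq_comm]
  · have h1 : paramFactor ψ p = fun z => 0 * z + 1 := by
      funext z; rw [paramFactor_of_notMem hp]; ring
    rw [h1]
    refine ⟨(analyticAt_const.mul analyticAt_id).add analyticAt_const, ?_⟩
    rw [analyticOrderAt_affine (Or.inr one_ne_zero)]
    refine if_congr ?_ rfl rfl
    simp only [zero_mul, zero_add, one_ne_zero, false_iff]
    rintro rfl
    exact hp ⟨z, rfl⟩

theorem paramFactor_conj {ψ : ℂ → X} (hψ : IsBdryChart M ψ) (p : X) (z : ℂ) :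
    paramFactor ψ (M.φ p) (starRingEnd ℂ z) = starRingEnd ℂ (paramFactor ψ p z) := by
  by_cases hp : p ∈ range ψ
  · obtain ⟨w, rfl⟩ := hp
    rw [hψ.conj, paramFactor_apply hψ.injective, paramFactor_apply hψ.injective, map_sub]
  · rw [paramFactor_of_notMem hp, paramFactor_of_notMem, map_one]
    rintro ⟨w, hw⟩
    apply hp
    rw [← M.involutive p, ← hw, hψ.conj]
    exact ⟨_, rfl⟩

/-- Real frames exist over every boundary chart. -/
theorem TwistedSpin.exists_isRealFrame_divisorProd (P : TwistedSpin r M a b S) (hr : 0 < r)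
    {ψ : ℂ → X} (hψ : IsBdryChart M ψ) :
    ∃ (ε : ℝ) (σ : ∀ z, S (ψ z)), (ε = 1 ∨ ε = -1) ∧
      P.IsRealFrame ψ (fun z => (ε : ℂ) * divisorProd M a b (paramFactor ψ) z) σ := by
  classical
  exact P.exists_isRealFrame hr hψ
    (analyticAt_divisorProd M a b fun p z => (paramFactor_spec hψ.injective p z).1)
    (fun z => analyticOrderAt_divisorProd M a b (fun p => (paramFactor_spec hψ.injective p z).1)
      fun p => by rw [(paramFactor_spec hψ.injective p z).2])
    (divisorProd_conj M a b (paramFactor_conj hψ))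

end RealFrames

/-! ### Dual frames of `ω` and `J` -/

section DualFrames

set_option linter.unusedSectionVars false
variable {X : Type*} [TopologicalSpace X] [ChartedSpace ℂ X] [IsManifold 𝓘(ℂ) ω X]
  {I B : Type*} [Fintype I] [Fintype B] {r : ℕ} {M : MarkedDisk X I B} {a : I → ℕ} {b : B → ℕ}
  {S : X → Type*} [∀ p, AddCommGroup (S p)] [∀ p, Module ℂ (S p)]
  [TopologicalSpace (TotalSpace ℂ S)] [∀ p, TopologicalSpace (S p)]
  [FiberBundle ℂ S] [VectorBundle ℂ ℂ S]

/-- The coordinate differential of a parametrization. -/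
def coform (ψ : ℂ → X) (z : ℂ) : CanonicalFiber X (ψ z) :=
  ((vel ψ z)⁻¹ • ContinuousLinearMap.id ℂ ℂ : ℂ →L[ℂ] ℂ)

theorem coform_vel {ψ : ℂ → X} (hψ : IsParam ψ) (z : ℂ) : coform ψ z (vel ψ z) = (1 : ℂ) :=
  inv_mul_cancel₀ (hψ.vel_ne_zero z)

theorem eq_smul_coform {ψ : ℂ → X} (hψ : IsParam ψ) (z : ℂ) (η : CanonicalFiber X (ψ z)) :
    η = (η (vel ψ z) : ℂ) • coform ψ z := by
  have h : ∀ u : ℂ, (η : ℂ →L[ℂ] ℂ) u =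
      ((η : ℂ →L[ℂ] ℂ) (vel ψ z) : ℂ) * ((vel ψ z)⁻¹ * u) := fun u => by
    have h1 : u = (u * (vel ψ z)⁻¹) • (vel ψ z) := by
      rw [smul_eq_mul, mul_assoc, inv_mul_cancel₀ (hψ.vel_ne_zero z), mul_one]
    refine (congrArg (η : ℂ →L[ℂ] ℂ) h1).trans
      (((η : ℂ →L[ℂ] ℂ).map_smul (u * (vel ψ z)⁻¹) (vel ψ z)).trans ?_)
    change (u * (vel ψ z)⁻¹) * (η : ℂ →L[ℂ] ℂ) (vel ψ z) = _
    ring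
  exact ContinuousLinearMap.ext h

/-- The frame of `J = Hom(S, ω)` mapping the frame `σ` of `S` to the coordinate differential. -/
def jFrame (ψ : ℂ → X) (σ : ∀ z, S (ψ z)) (z : ℂ) : JFiber S (ψ z) :=
  (fiberDual (σ z)).smulRight (coform ψ z)

theorem jFrame_apply {ψ : ℂ → X} {σ : ∀ z, S (ψ z)} {z : ℂ} (h0 : σ z ≠ 0) :
    jFrame ψ σ z (σ z) = coform ψ z := by
  rw [jFrame, ContinuousLinearMap.smulRight_apply, fiberDual_self h0, one_smul]

theorem coform_ne_zero {ψ : ℂ → X} (hψ : IsParam ψ) (z : ℂ) : coform ψ z ≠ 0 := fun h => by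
  have := coform_vel hψ z
  rw [h] at this
  exact zero_ne_one this

theorem jFrame_ne_zero {ψ : ℂ → X} (hψ : IsParam ψ) {σ : ∀ z, S (ψ z)} {z : ℂ} (h0 : σ z ≠ 0) :
    jFrame ψ σ z ≠ 0 := fun h => by
  have := jFrame_apply (ψ := ψ) h0
  rw [h] at this
  exact coform_ne_zero hψ z this.symm

theorem eq_smul_jFrame {ψ : ℂ → X} (hψ : IsParam ψ) {σ : ∀ z, S (ψ z)} {z : ℂ} (h0 : σ z ≠ 0)
    (w : JFiber S (ψ z)) : w = (w (σ z) (vel ψ z) : ℂ) • jFrame ψ σ z := by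
  refine ContinuousLinearMap.ext fun s => ?_
  obtain ⟨c, rfl⟩ := exists_smul_eq_of_ne_zero h0 s
  rw [map_smul, map_smul, smul_apply, jFrame_apply h0, ← eq_smul_coform hψ]

/-- The canonical bundle is the Hom bundle from the tangent bundle to the trivial one, and this
section sends the continuous frame `vel ψ` to the constant `1`. -/
theorem continuous_coform {ψ : ℂ → X} (hψ : IsParam ψ) :
    Continuous (fun z => (⟨ψ z, coform ψ z⟩ : TotalSpace (ℂ →L[ℂ] ℂ) (CanonicalFiber X))) := by
  rw [← continuousOn_univ]
  intro z hz
  refine continuousWithinAt_hom_of_apply (E₁ := fun p : X => TangentSpace 𝓘(ℂ) p)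
    (E₂ := Trivial X ℂ) (F₂ := ℂ) (e₁ := fun z => vel ψ z) (w := coform ψ)
    hψ.continuous_vel.continuousWithinAt (hψ.vel_ne_zero z) ?_
  rw [FiberBundle.continuousWithinAt_totalSpace]
  refine ⟨hψ.contMDiff.continuous.continuousWithinAt, ?_⟩
  refine (continuousWithinAt_const (b := (1 : ℂ))).congr (fun y _ => ?_) ?_
  · exact coform_vel hψ y
  · exact coform_vel hψ z

theorem continuous_jFrame {ψ : ℂ → X} (hψ : IsParam ψ) {σ : ∀ z, S (ψ z)}
    (hσ : Continuous fun z => (⟨ψ z, σ z⟩ : TotalSpace ℂ S)) (h0 : ∀ z, σ z ≠ 0) :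
    Continuous (fun z => (⟨ψ z, jFrame ψ σ z⟩ :
      TotalSpace (ℂ →L[ℂ] (ℂ →L[ℂ] ℂ)) (JFiber S))) := by
  rw [← continuousOn_univ]
  intro z hz
  refine continuousWithinAt_hom_of_apply (E₁ := S) (E₂ := CanonicalFiber X) (e₁ := σ)
    (w := jFrame ψ σ) hσ.continuousWithinAt (h0 z) ?_
  simp only [jFrame_apply (h0 _)]
  exact (continuous_coform hψ).continuousWithinAt

end DualFrames

/-! ### Illegality as constancy of sign -/

section Legality

set_option linter.unusedSectionVars false

/-- `h` has eventually a constant sign along `l`. -/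
def EvSign {α : Type*} (l : Filter α) (h : α → ℝ) : Prop :=
  (∀ᶠ x in l, 0 < h x) ∨ (∀ᶠ x in l, h x < 0)

theorem EvSign.congr_sign {α : Type*} {l : Filter α} {h g : α → ℝ} (hh : EvSign l h)
    (hg : ∀ᶠ x in l, 0 < h x * g x) : EvSign l g := by
  rcases hh with h1 | h1
  · exact Or.inl (by filter_upwards [h1, hg] with x h2 h3 using pos_of_mul_pos_right h3 h2.le)
  · exact Or.inr (by filter_upwards [h1, hg] with x h2 h3 using by nlinarith)

theorem EvSign.mul {α : Type*} {l : Filter α} {h g : α → ℝ} (hh : EvSign l h)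
    (hg : EvSign l g) : EvSign l (fun x => h x * g x) := by
  rcases hh with h1 | h1 <;> rcases hg with h2 | h2
  · exact Or.inl (by filter_upwards [h1, h2] with x h3 h4 using mul_pos h3 h4)
  · exact Or.inr (by filter_upwards [h1, h2] with x h3 h4 using mul_neg_of_pos_of_neg h3 h4)
  · exact Or.inr (by filter_upwards [h1, h2] with x h3 h4 using mul_neg_of_neg_of_pos h3 h4)
  · exact Or.inl (by filter_upwards [h1, h2] with x h3 h4 using mul_pos_of_neg_of_neg h3 h4)

theorem evSign_of_tendsto {α : Type*} {l : Filter α} {h : α → ℝ} {c : ℝ} (hh : Tendsto h l (𝓝 c))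
    (hc : c ≠ 0) : EvSign l h := by
  rcases hc.lt_or_gt with h1 | h1
  · exact Or.inr (hh.eventually_lt_const h1)
  · exact Or.inl (hh.eventually_const_lt h1)

variable {X : Type*} [TopologicalSpace X] [ChartedSpace ℂ X] [IsManifold 𝓘(ℂ) ω X]
  {I B : Type*} {M : MarkedDisk X I B}

theorem continuousWithinAt_bdry_iff {Y : Type*} [TopologicalSpace Y] {ψ : ℂ → X}
    (hψ : IsBdryChart M ψ) {f : X → Y} {x : ℝ} {A : Set X} (hA : A ⊆ M.bdry)
    (hAx : A ∈ 𝓝[M.bdry] (ψ x)) :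
    ContinuousWithinAt f A (ψ x) ↔ ContinuousAt (fun t : ℝ => f (ψ t)) x := by
  have h1 : 𝓝[A] (ψ x) = 𝓝[M.bdry] (ψ x) := le_antisymm (nhdsWithin_mono _ hA)
    (nhdsWithin_le_of_mem hAx)
  rw [ContinuousWithinAt, h1, ← hψ.map_nhds_real, tendsto_map'_iff]
  rfl

/-- Serves to extend a positive function prescribed near `q`. Vanishing on a whole neighbourhood of
each point outside `V` makes products with functions that are continuous only inside `V` continuous
everywhere. -/
theorem exists_bump [T2Space X] [CompactSpace X] {V : Set X} {q : X} (hV : V ∈ 𝓝 q) :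
    ∃ χ : X → ℝ, Continuous χ ∧ (∀ p, 0 ≤ χ p ∧ χ p ≤ 1) ∧ (∀ᶠ p in 𝓝 q, χ p = 1) ∧
      ∀ p, p ∉ V → ∀ᶠ p' in 𝓝 p, χ p' = 0 := by
  obtain ⟨N₂, hN₂, hN₂c, hN₂V⟩ := exists_mem_nhds_isClosed_subset hV
  obtain ⟨N₁, hN₁, hN₁c, hN₁N⟩ := exists_mem_nhds_isClosed_subset (interior_mem_nhds.2 hN₂)
  obtain ⟨χ, h0, h1, h01⟩ := exists_continuous_zero_one_of_isClosed
    (isClosed_compl_iff.2 isOpen_interior) hN₁c (disjoint_compl_left_iff_subset.2 hN₁N)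
  refine ⟨χ, χ.continuous, h01, ?_, fun p hp => ?_⟩
  · filter_upwards [hN₁] with p hp using h1 hp
  · filter_upwards [hN₂c.isOpen_compl.mem_nhds fun h => hp (hN₂V h)] with p' hp'
    exact h0 fun h => hp' (interior_subset h)

/-- Criterion for illegality in terms of the coefficient with respect to a local frame. -/
theorem isIllegal_iff [T2Space X] [CompactSpace X] {F : Type*} [NormedAddCommGroup F]
    [NormedSpace ℂ F] {E : X → Type*} [∀ p, AddCommGroup (E p)] [∀ p, Module ℂ (E p)]
    [TopologicalSpace (TotalSpace F E)] [∀ p, TopologicalSpace (E p)] [FiberBundle F E]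
    [VectorBundle ℂ F E] {Lift : (∀ p, E p) → Prop} {A : Set X} {w : ∀ p, E p} {ψ : ℂ → X}
    (hψ : IsBdryChart M ψ) {x : ℝ} (hA : A ⊆ M.bdry)
    (hAx : insert (ψ x) A ∈ 𝓝[M.bdry] (ψ x)) (hxA : ψ x ∉ A) {e : ∀ z, E (ψ z)}
    (he : Continuous fun z => (⟨ψ z, e z⟩ : TotalSpace F E)) (he0 : ∀ z, e z ≠ 0)
    (hspan : ∀ v : E (ψ x), ∃ c : ℂ, v = c • e x) {g : ℝ → ℝ}
    (hg : ∀ t : ℝ, ψ t ∈ A → w (ψ t) = (g t : ℂ) • e t ∧ g t ≠ 0)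
    (hw : ContinuousOn (fun p => (⟨p, w p⟩ : TotalSpace F E)) A)
    (hLift : ∀ (w' : ∀ p, E p) (c : X → ℝ), ContinuousOn c A →
      (∀ p ∈ A, 0 < c p ∧ w' p = (c p : ℂ) • w p) → Lift w') :
    IsIllegal F Lift A w (ψ x) ↔ EvSign (𝓝[≠] x) g := by
  classical
  have hinsb : insert (ψ x) A ⊆ M.bdry := insert_subset ((hψ.mem_bdry_iff x).2 ⟨x, rfl⟩) hA
  have heR : Continuous fun t : ℝ => (⟨ψ t, e t⟩ : TotalSpace F E) := he.comp Complex.continuous_ofReal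
  have hAev : ∀ᶠ t : ℝ in 𝓝 x, t ≠ x → ψ t ∈ A := by
    rw [← hψ.map_nhds_real, mem_map] at hAx
    filter_upwards [hAx] with t ht htx
    exact (mem_insert_iff.1 ht).resolve_left fun h =>
      htx (Complex.ofReal_injective (hψ.injective h))
  constructor
  · rintro ⟨w', -, ⟨c, -, hc⟩, hw'c, hw'0⟩
    obtain ⟨c₀, hc₀⟩ := hspan (w' (ψ x))
    have hc₀0 : c₀ ≠ 0 := by
      rintro rfl
      exact hw'0 (by rw [hc₀, zero_smul])
    -- The coefficient of the extended section. It is continuous at `x` and real elsewhere, so its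
    -- nonzero value at `x` is a real limit, whose sign is that of `g` on both sides.
    set G : ℝ → ℂ := fun t : ℝ => if t = x then c₀ else ((c (ψ t) * g t : ℝ) : ℂ) with hG
    have h1 : ContinuousAt (fun t : ℝ => (⟨ψ t, w' (ψ t)⟩ : TotalSpace F E)) x :=
      (continuousWithinAt_bdry_iff hψ hinsb hAx).1 (hw'c _ (mem_insert _ _))
    have h2 : ContinuousAt (fun t : ℝ => (⟨ψ t, G t • e t⟩ : TotalSpace F E)) x := by
      refine h1.congr ?_
      filter_upwards [hAev] with t ht
      rcases eq_or_ne t x with rfl | htx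
      · simp [hG, hc₀]
      · rw [(hc _ (ht htx)).2, (hg t (ht htx)).1, smul_smul]
        simp [hG, htx]
    have h3 : ContinuousAt G x := by
      rw [← continuousWithinAt_univ] at h2 ⊢
      exact heR.continuousWithinAt.ratio_total h2 (he0 _)
    have h4 : Tendsto (fun t : ℝ => ((c (ψ t) * g t : ℝ) : ℂ)) (𝓝[≠] x) (𝓝 c₀) := by
      have h5 : Tendsto G (𝓝[≠] x) (𝓝 c₀) := by
        have := h3.tendsto.mono_left (nhdsWithin_le_nhds (s := {x}ᶜ))
        simpa [hG] using this
      refine h5.congr' ?_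
      filter_upwards [self_mem_nhdsWithin] with t ht
      have : t ≠ x := ht
      simp [hG, this]
    have him : c₀.im = 0 := by
      have h5 := (Complex.continuous_im.tendsto c₀).comp h4
      have h6 : Tendsto (fun _ : ℝ => (0 : ℝ)) (𝓝[≠] x) (𝓝 c₀.im) := h5.congr fun t => by simp
      exact (tendsto_nhds_unique tendsto_const_nhds h6).symm
    have hre : c₀.re ≠ 0 := fun h => hc₀0 (Complex.ext h him)
    have h5 : Tendsto (fun t : ℝ => c (ψ t) * g t) (𝓝[≠] x) (𝓝 c₀.re) :=
      ((Complex.continuous_re.tendsto c₀).comp h4).congr fun t => by simp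
    refine (evSign_of_tendsto h5 hre).congr_sign ?_
    filter_upwards [nhdsWithin_le_nhds hAev, self_mem_nhdsWithin] with t ht htx
    have h6 := hc _ (ht htx)
    have h7 := (hg t (ht htx)).2
    rw [mul_assoc]
    exact mul_pos h6.1 (mul_self_pos.2 h7)
  · intro hsign
    obtain ⟨δ, hδ, hδg⟩ : ∃ δ : ℝ, |δ| = 1 ∧ ∀ᶠ t in 𝓝[≠] x, 0 < δ * g t := by
      rcases hsign with h | h
      · exact ⟨1, abs_one, by simpa using h⟩
      · exact ⟨-1, by simp, by simpa using h⟩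
    have hev : ∀ᶠ p in 𝓝[M.bdry] (ψ x), ∃ t : ℝ, ψ t = p ∧ (t ≠ x → ψ t ∈ A ∧ 0 < δ * g t) := by
      rw [← hψ.map_nhds_real, eventually_map]
      filter_upwards [hAev, eventually_nhdsWithin_iff.1 hδg] with t h1 h2
      exact ⟨t, rfl, fun h => ⟨h1 h, h2 h⟩⟩
    rw [eventually_nhdsWithin_iff] at hev
    obtain ⟨χ, hχc, hχ01, hχ1, hχ0⟩ := exists_bump hev
    have hinj : Function.Injective fun t : ℝ => ψ t := hψ.injective.comp Complex.ofReal_injective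
    set T : X → ℝ := Function.invFun fun t : ℝ => ψ t with hT
    have hTψ : ∀ t : ℝ, T (ψ t) = t := Function.leftInverse_invFun hinj
    -- Near `ψ x` the factor is `1 / |g|`, which turns the coefficient into the constant sign `δ`;
    -- away from it the factor is `1`, so that it is positive and continuous on all of `A`.
    set c : X → ℝ := fun p => χ p / |g (T p)| + (1 - χ p) with hc
    have hcpos : ∀ p ∈ A, 0 < c p := fun p hp => by
      by_cases h0 : χ p = 0
      · simp [hc, h0]
      · have hpV : p ∈ M.bdry → _ := not_not.1 fun h => h0 (hχ0 p h).self_of_nhds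
        obtain ⟨t, rfl, -⟩ := hpV (hA hp)
        have h1 := abs_pos.2 (hg t hp).2
        have h2 := hχ01 (ψ t)
        have h3 : 0 < χ (ψ t) := lt_of_le_of_ne h2.1 (Ne.symm h0)
        simp only [hc, hTψ]
        have := div_pos h3 h1
        linarith
    have hcc : ContinuousOn c A := fun p hp => by
      by_cases hpV : p ∈ M.bdry → ∃ t : ℝ, ψ t = p ∧ (t ≠ x → ψ t ∈ A ∧ 0 < δ * g t)
      · obtain ⟨t, rfl, -⟩ := hpV (hA hp)
        have hev1 : ∀ᶠ p in 𝓝[M.bdry] (ψ t), ∃ t : ℝ, ψ t = p := by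
          rw [← hψ.map_nhds_real, eventually_map]
          exact Eventually.of_forall fun t => ⟨t, rfl⟩
        have hev2 := hev1.filter_mono (nhdsWithin_mono _ hA)
        have hTc : ContinuousWithinAt T A (ψ t) := by
          have h1 : ContinuousWithinAt T M.bdry (ψ t) := by
            rw [continuousWithinAt_bdry_iff hψ Subset.rfl self_mem_nhdsWithin]
            simp only [hTψ]
            exact continuousAt_id
          exact h1.mono hA
        have hgc : ContinuousWithinAt (fun p => (g (T p) : ℂ)) A (ψ t) := by
          have h2 : ContinuousWithinAt (fun p => (⟨ψ (T p), e (T p)⟩ : TotalSpace F E)) A (ψ t) :=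
            heR.continuousAt.comp_continuousWithinAt hTc
          refine h2.ratio_total ?_ (he0 _)
          refine (hw _ hp).congr_of_eventuallyEq ?_ ?_
          · filter_upwards [hev2, self_mem_nhdsWithin] with p hp hpA
            obtain ⟨u, rfl⟩ := hp
            rw [hTψ, ← (hg u hpA).1]
          · rw [hTψ, ← (hg t hp).1]
        have hgc' : ContinuousWithinAt (fun p => g (T p)) A (ψ t) := by
          simpa [Function.comp_def] using
            Complex.continuous_re.continuousAt.comp_continuousWithinAt hgc
        refine ContinuousWithinAt.add (ContinuousWithinAt.div hχc.continuousWithinAt hgc'.abs ?_)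
          (continuousWithinAt_const.sub hχc.continuousWithinAt)
        rw [hTψ]
        exact abs_ne_zero.2 (hg t hp).2
      · have h1 := hχ0 p hpV
        refine ContinuousAt.continuousWithinAt ?_
        refine continuousAt_const.congr (f := fun _ => (1 : ℝ)) ?_
        filter_upwards [h1] with p' hp'
        simp [hc, hp']
    set w' : ∀ p, E p := Function.update (fun p => (c p : ℂ) • w p) (ψ x) ((δ : ℂ) • e x) with hw'
    have hw'A : ∀ p ∈ A, w' p = (c p : ℂ) • w p := fun p hp => by
      rw [hw', Function.update_of_ne]
      rintro rfl
      exact hxA hp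
    have hw'x : w' (ψ x) = (δ : ℂ) • e x := by rw [hw', Function.update_self]
    have hδ0 : δ ≠ 0 := by rintro rfl; simp at hδ
    refine ⟨w', hLift w' c hcc fun p hp => ⟨hcpos p hp, hw'A p hp⟩,
      ⟨c, hcc, fun p hp => ⟨hcpos p hp, hw'A p hp⟩⟩, ?_, ?_⟩
    · rintro p (rfl | hp)
      · rw [continuousWithinAt_bdry_iff hψ hinsb hAx]
        have h1 : ContinuousAt (fun t : ℝ => (⟨ψ t, (δ : ℂ) • e t⟩ : TotalSpace F E)) x := by
          rw [← continuousWithinAt_univ]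
          exact continuousWithinAt_const.smul_total heR.continuousWithinAt
        refine h1.congr ?_
        have hχ1' : ∀ᶠ t : ℝ in 𝓝 x, χ (ψ t) = 1 :=
          ((hψ.contMDiff.continuous.comp Complex.continuous_ofReal).continuousAt
            (x := x)).eventually hχ1
        filter_upwards [hAev, eventually_nhdsWithin_iff.1 hδg, hχ1'] with t h2 h3 h4
        rcases eq_or_ne t x with rfl | htx
        · rw [hw'x]
        · have h5 := h2 htx
          have h6 := (hg t h5).2
          have h7 : δ = g t / |g t| := by
            have h8 := h3 htx
            have h9 : |δ * g t| = δ * g t := abs_of_pos h8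
            rw [abs_mul, hδ, one_mul] at h9
            rw [h9]
            rw [div_mul_cancel_right₀ h6]
            rcases eq_or_eq_neg_of_abs_eq hδ with rfl | rfl <;> norm_num
          rw [hw'A _ h5, (hg t h5).1, smul_smul, hc]
          simp only [h4, hTψ, sub_self, add_zero]
          congr 2
          rw [h7]
          push_cast
          rw [one_div, mul_comm, div_eq_mul_inv]
      · have hne : p ≠ ψ x := by rintro rfl; exact hxA hp
        rw [ContinuousWithinAt, nhdsWithin_insert_of_ne hne]
        have h1 : ContinuousWithinAt (fun p => (⟨p, (c p : ℂ) • w p⟩ : TotalSpace F E)) A p :=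
          (Complex.continuous_ofReal.continuousAt.comp_continuousWithinAt (hcc p hp)).smul_total
            (hw p hp)
        exact h1.congr (fun p' hp' => by rw [hw'A p' hp']) (by rw [hw'A p hp])
    · rw [hw'x]
      exact smul_ne_zero (Complex.ofReal_ne_zero.2 hδ0) (he0 _)

end Legality

/-! ### Liftings as real coefficient functions -/

section Liftings

set_option linter.unusedSectionVars false
variable {X : Type*} [TopologicalSpace X] [ChartedSpace ℂ X] [IsManifold 𝓘(ℂ) ω X]
  {I B : Type*} [Fintype I] [Fintype B] {r : ℕ} {M : MarkedDisk X I B} {a : I → ℕ} {b : B → ℕ}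
  {S : X → Type*} [∀ p, AddCommGroup (S p)] [∀ p, Module ℂ (S p)]
  [TopologicalSpace (TotalSpace ℂ S)] [∀ p, TopologicalSpace (S p)]
  [FiberBundle ℂ S] [VectorBundle ℂ ℂ S] [ContMDiffVectorBundle ω ℂ S 𝓘(ℂ)]

/-- `v` is a positive multiple of `v'`. -/
def PosRatio {V : Type*} [AddCommGroup V] [Module ℂ V] (v v' : V) : Prop :=
  ∃ c : ℝ, 0 < c ∧ v = (c : ℂ) • v'

theorem posRatio_smul_iff {V : Type*} [AddCommGroup V] [Module ℂ V] {e : V} (he : e ≠ 0) {h h' : ℝ}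
    (h0 : h' ≠ 0) : PosRatio ((h : ℂ) • e) ((h' : ℂ) • e) ↔ 0 < h * h' := by
  constructor
  · rintro ⟨c, hc, h1⟩
    rw [smul_smul] at h1
    have h2 : (h : ℂ) = c * h' := smul_left_injective ℂ he h1
    have h3 : h = c * h' := by exact_mod_cast h2
    rw [h3, mul_assoc]
    exact mul_pos hc (mul_self_pos.2 h0)
  · intro hh
    refine ⟨h / h', ?_, ?_⟩
    · rw [div_eq_mul_inv, ← mul_pos_iff_of_pos_right (mul_self_pos.2 h0)]
      rwa [mul_assoc, ← mul_assoc h'⁻¹, inv_mul_cancel₀ h0, one_mul]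
    · rw [smul_smul]
      push_cast
      rw [div_mul_cancel₀ _ (Complex.ofReal_ne_zero.2 h0)]

/-- The ratio of continuous nonvanishing sections is automatically continuous, so equivalence can be
tested point by point. -/
theorem sectionEquiv_iff {F : Type*} [NormedAddCommGroup F] [NormedSpace ℂ F] {E : X → Type*}
    [∀ p, AddCommGroup (E p)] [∀ p, Module ℂ (E p)] [TopologicalSpace (TotalSpace F E)]
    [∀ p, TopologicalSpace (E p)] [FiberBundle F E] [VectorBundle ℂ F E] {A : Set X}
    {s s' : ∀ p, E p} (hs : ContinuousOn (fun p => (⟨p, s p⟩ : TotalSpace F E)) A)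
    (hs' : ContinuousOn (fun p => (⟨p, s' p⟩ : TotalSpace F E)) A) (h0 : ∀ p ∈ A, s' p ≠ 0) :
    SectionEquiv A s s' ↔ ∀ p ∈ A, PosRatio (s p) (s' p) := by
  constructor
  · rintro ⟨c, -, hc⟩ p hp
    exact ⟨c p, hc p hp⟩
  · intro h
    have hex : ∀ p, ∃ c : ℝ, p ∈ A → 0 < c ∧ s p = (c : ℂ) • s' p := fun p => by
      by_cases hp : p ∈ A
      · obtain ⟨c, hc⟩ := h p hp
        exact ⟨c, fun _ => hc⟩
      · exact ⟨0, fun h => absurd h hp⟩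
    choose c hc using hex
    refine ⟨c, fun p hp => ?_, hc⟩
    have h1 : ContinuousWithinAt (fun p => (c p : ℂ)) A p :=
      (hs' p hp).ratio_total ((hs p hp).congr (fun p' hp' => by rw [← (hc p' hp').2])
        (by rw [← (hc p hp).2])) (h0 p hp)
    simpa [Function.comp_def] using Complex.continuous_re.continuousAt.comp_continuousWithinAt h1

theorem IsBdryChart.map_nhdsWithin_real {ψ : ℂ → X} (hψ : IsBdryChart M ψ) {A : Set X}
    (hA : A ⊆ M.bdry) (x : ℝ) :
    map (fun t : ℝ => ψ t) (𝓝[(fun t : ℝ => ψ t) ⁻¹' A] x) = 𝓝[A] (ψ x) := by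
  rw [nhdsWithin, map_inf_principal_preimage, hψ.map_nhds_real, nhdsWithin, nhdsWithin, inf_assoc,
    inf_principal, inter_eq_right.2 hA]

theorem MarkedDisk.IsPositive.smul {p : X} {η : CanonicalFiber X p} (h : M.IsPositive p η) {c : ℝ}
    (hc : 0 < c) : M.IsPositive p ((c : ℂ) • η) := fun u hu => by
  obtain ⟨d, hd, hη⟩ := h u hu
  refine ⟨c * d, mul_pos hc hd, ?_⟩
  rw [Complex.ofReal_mul, ← hη]
  rfl

namespace TwistedSpin

variable {P : TwistedSpin r M a b S} {ψ : ℂ → X} {F : ℂ → ℂ} {σ : ∀ z, S (ψ z)} {A : Set X}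

section Frames

theorem IsRealFrame.ne_zero (hσ : P.IsRealFrame ψ F σ) (z : ℂ) : σ z ≠ 0 := (hσ.frame.2 z trivial).1

theorem IsRealFrame.continuous (hσ : P.IsRealFrame ψ F σ) :
    Continuous fun z => (⟨ψ z, σ z⟩ : TotalSpace ℂ S) := continuousOn_univ.1 hσ.frame.1

theorem IsRealFrame.totalMap_real (hσ : P.IsRealFrame ψ F σ) (c : ℂ) (t : ℝ) :
    totalMap M.φ P.inv ⟨ψ t, c • σ t⟩ = ⟨ψ t, starRingEnd ℂ c • σ t⟩ := by
  refine P.totalMap_smul c ?_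
  have := hσ.inv t
  rwa [Complex.conj_ofReal] at this

theorem IsRealFrame.ofReal_re (hψ : IsBdryChart M ψ) (hσ : P.IsRealFrame ψ F σ) (t : ℝ) :
    ((F t).re : ℂ) = F t := by
  have h1 := hσ.totalMap_real 1 t
  have h2 := P.rVal_inv hψ.toIsParam hψ.conj (z := t) (v := σ t) (v' := σ (starRingEnd ℂ (t : ℂ)))
    (hσ.inv t)
  rw [(hσ.frame.2 _ trivial).2, (hσ.frame.2 _ trivial).2, Complex.conj_ofReal] at h2
  exact Complex.conj_eq_iff_re.1 h2.symm

/-- The dictionary used throughout: as the frame is invariant, invariance of `v` makes its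
coefficient real, and positivity of `τ(v^r)` becomes a sign condition on `h ^ r * F`. -/
theorem IsRealFrame.exists_coeff (hr : 0 < r) (hψ : IsBdryChart M ψ) (hσ : P.IsRealFrame ψ F σ)
    {v : ∀ p, S p} (hv : P.IsLiftingS A v) :
    ∃ h : ℝ → ℝ, ∀ t : ℝ, ψ t ∈ A → v (ψ t) = (h t : ℂ) • σ t ∧ h t ≠ 0 ∧
      0 < h t ^ r * (F t).re := by
  have hex : ∀ t : ℝ, ∃ h : ℝ, ψ t ∈ A → v (ψ t) = (h : ℂ) • σ t ∧ h ≠ 0 ∧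
      0 < h ^ r * (F t).re := fun t => by
    by_cases ht : ψ t ∈ A
    · obtain ⟨c, hc⟩ := exists_smul_eq_of_ne_zero (hσ.ne_zero t) (v (ψ t))
      have h1 : totalMap M.φ P.inv ⟨ψ t, v (ψ t)⟩ = ⟨ψ t, v (ψ t)⟩ := by
        have h2 : M.φ (ψ t) = ψ t := (hψ.mem_bdry_iff t).2 ⟨t, rfl⟩
        refine Eq.trans ?_ (congrArg (fun p => (⟨p, v p⟩ : TotalSpace ℂ S)) h2)
        rw [totalMap]
        exact congrArg _ (hv.2.1 _ ht)
      rw [hc, hσ.totalMap_real] at h1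
      have h2 : starRingEnd ℂ c = c :=
        smul_left_injective ℂ (hσ.ne_zero t) (eq_of_heq (TotalSpace.mk.inj h1).2)
      obtain ⟨h, rfl⟩ := Complex.conj_eq_iff_real.1 h2
      obtain ⟨d, hd, h3⟩ := (hψ.isPositive_iff t _).1 (hv.2.2 _ ht)
      have h4 : rVal P.τ (ψ t) (v (ψ t)) (vel ψ t) = d := h3
      rw [hc, rVal_smul, (hσ.frame.2 _ trivial).2, ← hσ.ofReal_re hψ] at h4
      have h5 : h ^ r * (F t).re = d := by exact_mod_cast h4
      refine ⟨h, fun _ => ⟨hc, ?_, h5 ▸ hd⟩⟩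
      rintro rfl
      rw [zero_pow hr.ne', zero_mul] at h5
      exact hd.ne h5
    · exact ⟨0, fun h => absurd h ht⟩
  choose h hh using hex
  exact ⟨h, hh⟩

theorem IsRealFrame.continuousWithinAt_coeff (hψ : IsBdryChart M ψ) (hσ : P.IsRealFrame ψ F σ)
    {v : ∀ p, S p} (hv : ContinuousOn (fun p => (⟨p, v p⟩ : TotalSpace ℂ S)) A) {h : ℝ → ℝ}
    (hh : ∀ t : ℝ, ψ t ∈ A → v (ψ t) = (h t : ℂ) • σ t) {t : ℝ} (ht : ψ t ∈ A) :
    ContinuousWithinAt h ((fun t : ℝ => ψ t) ⁻¹' A) t := by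
  have hψc : Continuous fun t : ℝ => ψ t := hψ.contMDiff.continuous.comp Complex.continuous_ofReal
  have h1 : ContinuousWithinAt (fun t : ℝ => (⟨ψ t, σ t⟩ : TotalSpace ℂ S))
      ((fun t : ℝ => ψ t) ⁻¹' A) t :=
    (hσ.continuous.comp Complex.continuous_ofReal).continuousWithinAt
  have h2 : ContinuousWithinAt (fun t : ℝ => (h t : ℂ)) ((fun t : ℝ => ψ t) ⁻¹' A) t := by
    refine h1.ratio_total ?_ (hσ.ne_zero t)
    refine (ContinuousWithinAt.comp (f := fun t : ℝ => ψ t) (hv _ ht) hψc.continuousWithinAt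
      (mapsTo_preimage _ _)).congr (fun t' ht' => ?_) ?_
    · rw [Function.comp_apply, hh t' ht']
    · rw [Function.comp_apply, hh t ht]
  simpa [Function.comp_def] using Complex.continuous_re.continuousAt.comp_continuousWithinAt h2

/-- `v` is given near `p` by a continuous coefficient with respect to a real frame. -/
structure IsLiftingNear (P : TwistedSpin r M a b S) (A : Set X) (v : ∀ p, S p) (p : X)
    (ψ : ℂ → X) (F : ℂ → ℂ) (σ : ∀ z, S (ψ z)) (x : ℝ) (h : ℝ → ℝ) : Prop where
  chart : IsBdryChart M ψ
  frame : P.IsRealFrame ψ F σ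
  eq : ψ x = p
  cont : ContinuousWithinAt h ((fun t : ℝ => ψ t) ⁻¹' A) x
  coeff : ∀ᶠ t : ℝ in 𝓝 x, ψ t ∈ A → v (ψ t) = (h t : ℂ) • σ t
  pos : 0 < h x ^ r * (F x).re

/-- The converse direction of the dictionary: liftings can be built from continuous real
coefficients, with a different frame around each point. -/
theorem isLiftingS_of_local (hA : A ⊆ M.bdry) {v : ∀ p, S p}
    (h : ∀ p ∈ A, ∃ ψ F σ x h, P.IsLiftingNear A v p ψ F σ x h) : P.IsLiftingS A v := by
  refine ⟨fun p hp => ?_, fun p hp => ?_, fun p hp => ?_⟩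
  all_goals
    obtain ⟨ψ, F, σ, x, h, hψ, hσ, rfl, hc, hv, hpos⟩ := h p hp
    have hvx := hv.self_of_nhds hp
  · rw [ContinuousWithinAt, ← hψ.map_nhdsWithin_real hA, tendsto_map'_iff]
    have h1 : ContinuousWithinAt (fun t : ℝ => (⟨ψ t, (h t : ℂ) • σ t⟩ : TotalSpace ℂ S))
        ((fun t : ℝ => ψ t) ⁻¹' A) x :=
      (Complex.continuous_ofReal.continuousAt.comp_continuousWithinAt hc).smul_total
        (hσ.continuous.comp Complex.continuous_ofReal).continuousWithinAt
    rw [hvx]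
    refine h1.tendsto.congr' ?_
    filter_upwards [nhdsWithin_le_nhds hv, self_mem_nhdsWithin] with t h2 h3
    rw [Function.comp_apply, h2 h3]
  · have h1 := hσ.totalMap_real (h x) x
    rw [← hvx, Complex.conj_ofReal, ← hvx] at h1
    have h2 : M.φ (ψ x) = ψ x := hA hp
    have h3 : (⟨M.φ (ψ x), v (M.φ (ψ x))⟩ : TotalSpace ℂ S) = ⟨ψ x, v (ψ x)⟩ :=
      congrArg (fun p => (⟨p, v p⟩ : TotalSpace ℂ S)) h2
    exact eq_of_heq (TotalSpace.mk.inj (h1.trans h3.symm)).2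
  · rw [hψ.isPositive_iff]
    refine ⟨_, hpos, ?_⟩
    change rVal P.τ (ψ x) (v (ψ x)) (vel ψ x) = _
    rw [hvx, rVal_smul, (hσ.frame.2 _ trivial).2, ← hσ.ofReal_re hψ]
    push_cast
    rfl

theorem IsLiftingS.smul (hA : A ⊆ M.bdry) {v v' : ∀ p, S p} (hv : P.IsLiftingS A v) {c : X → ℝ}
    (hc : ContinuousOn c A) (h : ∀ p ∈ A, 0 < c p ∧ v' p = (c p : ℂ) • v p) :
    P.IsLiftingS A v' := by
  refine ⟨fun p hp => ?_, fun p hp => ?_, fun p hp => ?_⟩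
  · refine ContinuousWithinAt.congr (f := fun p => (⟨p, (c p : ℂ) • v p⟩ : TotalSpace ℂ S)) ?_
      (fun p' hp' => by rw [(h p' hp').2]) (by rw [(h p hp).2])
    exact (Complex.continuous_ofReal.continuousAt.comp_continuousWithinAt (hc p hp)).smul_total
      (hv.1 p hp)
  · have h1 : M.φ p = p := hA hp
    have h2 : M.φ p ∈ A := h1.symm ▸ hp
    rw [(h p hp).2, (h _ h2).2, map_smulₛₗ, hv.2.1 p hp, congrArg c h1, Complex.conj_ofReal]
  · rw [(h p hp).2, rPow_smul, ← Complex.ofReal_pow]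
    exact (hv.2.2 p hp).smul (pow_pos (h p hp).1 r)

/-- The lifting `w` of `J` pairs positively with the lifting `v` of `S`. -/
structure Paired (P : TwistedSpin r M a b S) (A : Set X) (w : ∀ p, JFiber S p)
    (v : ∀ p, S p) : Prop where
  liftJ : P.IsLiftingJ A w
  liftS : P.IsLiftingS A v
  pos : ∀ p ∈ A, M.IsPositive p (w p (v p))

theorem IsLiftingJ.exists_paired {w : ∀ p, JFiber S p} (hw : P.IsLiftingJ A w) :
    ∃ v, P.Paired A w v := by
  obtain ⟨v, hv, h⟩ := hw.2.2
  exact ⟨v, hw, hv, h⟩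

theorem IsLiftingJ.smul (hA : A ⊆ M.bdry) {w w' : ∀ p, JFiber S p} (hw : P.IsLiftingJ A w)
    {c : X → ℝ} (hc : ContinuousOn c A) (h : ∀ p ∈ A, 0 < c p ∧ w' p = (c p : ℂ) • w p) :
    P.IsLiftingJ A w' := by
  obtain ⟨v, hv, hwv⟩ := hw.2.2
  refine ⟨fun p hp => ?_, fun p hp s u => ?_, v, hv, fun p hp => ?_⟩
  · refine ContinuousWithinAt.congr (f := fun p => (⟨p, (c p : ℂ) • w p⟩ :
      TotalSpace (ℂ →L[ℂ] (ℂ →L[ℂ] ℂ)) (JFiber S))) ?_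
      (fun p' hp' => by rw [(h p' hp').2]) (by rw [(h p hp).2])
    exact (Complex.continuous_ofReal.continuousAt.comp_continuousWithinAt (hc p hp)).smul_total
      (hw.1 p hp)
  · have h1 : M.φ p = p := hA hp
    have h2 : M.φ p ∈ A := h1.symm ▸ hp
    rw [(h p hp).2, (h _ h2).2]
    have h3 := congrArg (fun x : ℂ => (c p : ℂ) * x) (hw.2.1 p hp s u)
    have h4 : starRingEnd ℂ ((c p : ℂ) * w p s u) = (c p : ℂ) * starRingEnd ℂ (w p s u) := by
      rw [map_mul, Complex.conj_ofReal]
    rw [congrArg c h1]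
    exact h3.trans h4.symm
  · rw [(h p hp).2]
    exact (hwv p hp).smul (h p hp).1

theorem IsRealFrame.jFrame_smul_val (hψ : IsBdryChart M ψ) (hσ : P.IsRealFrame ψ F σ)
    (g c d z : ℂ) : ((g • jFrame ψ σ z) (c • σ z) (d * vel ψ z : ℂ) : ℂ) = g * (c * d) := by
  have h1 : (g • jFrame ψ σ z) (c • σ z) = (g * c) • coform ψ z := by
    rw [map_smul, smul_apply, jFrame_apply (hσ.ne_zero z), smul_smul, mul_comm]
  have h2 : (((g * c) • coform ψ z : ℂ →L[ℂ] ℂ) (d * vel ψ z : ℂ) : ℂ) =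
      (g * c) * (d * coform ψ z (vel ψ z)) :=
    congrArg (fun x => (g * c) * x) ((coform ψ z : ℂ →L[ℂ] ℂ).map_smul d (vel ψ z))
  rw [coform_vel hψ.toIsParam, mul_one, mul_assoc] at h2
  exact (congrArg (fun η : ℂ →L[ℂ] ℂ => η (d * vel ψ z)) h1).trans h2

/-- The pairing of the two coefficients is `g * h` times the coordinate differential, so the
coefficient of `w` in the dual frame has the same sign as that of `v`. This is why `J` behaves like
`S`. -/
theorem Paired.exists_coeff (hψ : IsBdryChart M ψ) (hσ : P.IsRealFrame ψ F σ)
    {w : ∀ p, JFiber S p} {v : ∀ p, S p} (hwv : P.Paired A w v) {h : ℝ → ℝ}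
    (hh : ∀ t : ℝ, ψ t ∈ A → v (ψ t) = (h t : ℂ) • σ t ∧ h t ≠ 0) :
    ∃ g : ℝ → ℝ, ∀ t : ℝ, ψ t ∈ A → w (ψ t) = (g t : ℂ) • jFrame ψ σ t ∧ 0 < g t * h t := by
  have hex : ∀ t : ℝ, ∃ g : ℝ, ψ t ∈ A → w (ψ t) = (g : ℂ) • jFrame ψ σ t ∧ 0 < g * h t :=
    fun t => by
    by_cases ht : ψ t ∈ A
    · have h1 := eq_smul_jFrame hψ.toIsParam (hσ.ne_zero t) (w (ψ t))
      set g : ℂ := w (ψ t) (σ t) (vel ψ t) with hg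
      obtain ⟨d, hd, h2⟩ := (hψ.isPositive_iff t _).1 (hwv.pos _ ht)
      rw [(hh t ht).1, h1] at h2
      have h3 := hσ.jFrame_smul_val hψ g (h t) 1 t
      rw [one_mul, mul_one] at h3
      have h4 : g * (h t : ℂ) = d := h3.symm.trans h2
      refine ⟨d / h t, fun _ => ⟨?_, ?_⟩⟩
      · rw [h1]
        congr 1
        push_cast
        rw [eq_div_iff (Complex.ofReal_ne_zero.2 (hh t ht).2), h4]
      · rwa [div_mul_cancel₀ _ (hh t ht).2]
    · exact ⟨0, fun h => absurd h ht⟩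
  choose g hg using hex
  exact ⟨g, hg⟩

end Frames

end TwistedSpin

end Liftings

/-! ### Correspondence between liftings of `S` and of `J` -/

section Pairing

set_option linter.unusedSectionVars false
variable {X : Type*} [TopologicalSpace X] [ChartedSpace ℂ X] [IsManifold 𝓘(ℂ) ω X]
  {I B : Type*} [Fintype I] [Fintype B] {r : ℕ} {M : MarkedDisk X I B} {a : I → ℕ} {b : B → ℕ}
  {S : X → Type*} [∀ p, AddCommGroup (S p)] [∀ p, Module ℂ (S p)]
  [TopologicalSpace (TotalSpace ℂ S)] [∀ p, TopologicalSpace (S p)]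
  [FiberBundle ℂ S] [VectorBundle ℂ ℂ S] [ContMDiffVectorBundle ω ℂ S 𝓘(ℂ)]

theorem MarkedDisk.divisor_eq_zero {p : X} (hp : p ∈ M.openBdry) : M.divisor a b p = 0 := by
  classical
  have h1 : ∀ i, M.z i ≠ p := fun i h => (M.z_mem i).2 (h ▸ hp.1)
  have h2 : ∀ i, M.φ (M.z i) ≠ p := fun i h => by
    have h3 : M.φ p = p := hp.1
    rw [← h, M.involutive] at h3
    exact (M.z_mem i).2 h3.symm
  have h3 : ∀ j, M.x j ≠ p := fun j h => hp.2 ⟨j, h⟩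
  simp [MarkedDisk.divisor, h1, h2, h3]

theorem MarkedDisk.divisor_x (j : B) : M.divisor a b (M.x j) = b j := by
  classical
  have h0 := M.x_mem j
  have h1 : ∀ i, M.z i ≠ M.x j := fun i h => (M.z_mem i).2 (by rw [h, h0])
  have h2 : ∀ i, M.φ (M.z i) ≠ M.x j := fun i h => by
    have h3 := h0
    rw [← h, M.involutive] at h3
    exact (M.z_mem i).2 h3.symm
  simp [MarkedDisk.divisor, h1, h2, M.x_injective.eq_iff]

theorem MarkedDisk.insert_mem_nhdsWithin [T2Space X] (j : B) :
    insert (M.x j) M.openBdry ∈ 𝓝[M.bdry] (M.x j) := by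
  have h1 : (range M.x \ {M.x j})ᶜ ∈ 𝓝 (M.x j) :=
    ((finite_range M.x).subset sdiff_subset).isClosed.isOpen_compl.mem_nhds fun h => h.2 rfl
  filter_upwards [nhdsWithin_le_nhds h1, self_mem_nhdsWithin] with p hp hpb
  by_cases hpj : p = M.x j
  · exact Or.inl hpj
  · exact Or.inr ⟨hpb, fun h => hp ⟨h, hpj⟩⟩

/-- The fibre over a general `p` is not syntactically the fibre over some `ψ t`, so the value is
chosen by an equality in the total space, with `0` off the real line of the chart. -/
theorem exists_section_extending {ψ : ℂ → X} (hψ : Function.Injective ψ) (f : ∀ t : ℝ, S (ψ t)) :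
    ∃ v : ∀ p, S p, ∀ t : ℝ, v (ψ t) = f t := by
  have h : ∀ p, ∃ u : S p, ∀ t : ℝ, ψ t = p → (⟨p, u⟩ : TotalSpace ℂ S) = ⟨ψ t, f t⟩ := fun p => by
    by_cases hp : ∃ t : ℝ, ψ t = p
    · obtain ⟨t, rfl⟩ := hp
      refine ⟨f t, fun t' ht' => ?_⟩
      obtain rfl : t' = t := Complex.ofReal_injective (hψ ht')
      rfl
    · exact ⟨0, fun t ht => absurd ⟨t, ht⟩ hp⟩
  choose v hv using h
  exact ⟨v, fun t => eq_of_heq (TotalSpace.mk.inj (hv _ t rfl)).2⟩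

namespace TwistedSpin

variable {P : TwistedSpin r M a b S} {A : Set X}

theorem exists_bdryFrame (P : TwistedSpin r M a b S) (hr : 0 < r) [T2Space X] [CompactSpace X]
    {q : X} (hq : q ∈ M.bdry) :
    ∃ ψ F σ, IsBdryChart M ψ ∧ ψ (0 : ℝ) = q ∧ P.IsRealFrame ψ F σ ∧
      ∀ z, AnalyticAt ℂ F z ∧ analyticOrderAt F z = (M.divisor a b (ψ z) : ℕ∞) := by
  classical
  obtain ⟨-, ψ, -, h0, -, hψ⟩ := M.exists_bdryCharts hq
  obtain ⟨ε, σ, hε, hσ⟩ := P.exists_isRealFrame_divisorProd hr hψ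
  have hε0 : (ε : ℂ) ≠ 0 := by rcases hε with rfl | rfl <;> norm_num
  have h1 : ∀ z, AnalyticAt ℂ (divisorProd M a b (paramFactor ψ)) z :=
    analyticAt_divisorProd M a b fun p z => (paramFactor_spec hψ.injective p z).1
  refine ⟨ψ, _, σ, hψ, by simpa using h0, hσ, fun z => ⟨analyticAt_const.mul (h1 z), ?_⟩⟩
  refine (analyticOrderAt_mul analyticAt_const (h1 z)).trans ?_
  rw [analyticAt_const.analyticOrderAt_eq_zero.2 hε0, zero_add]
  exact analyticOrderAt_divisorProd M a b (fun p => (paramFactor_spec hψ.injective p z).1)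
      fun p => by rw [(paramFactor_spec hψ.injective p z).2]

variable [T2Space X] [CompactSpace X]

/-- The form sending `v` to `τ(v^r)` pairs with `v` positively by the definition of a lifting. Its
coefficient in the dual frame is `h ^ r * F / h`, which is real and continuous. -/
theorem IsLiftingS.exists_paired (hr : 0 < r) (hA : A ⊆ M.bdry) {v : ∀ p, S p}
    (hv : P.IsLiftingS A v) : ∃ w, P.Paired A w v := by
  set w : ∀ p, JFiber S p := fun p => (fiberDual (v p)).smulRight (rPow P.τ p (v p)) with hw
  have hv0 : ∀ p ∈ A, v p ≠ 0 := fun p hp => by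
    obtain ⟨ψ, F, σ, hψ, rfl, hσ, -⟩ := P.exists_bdryFrame hr (hA hp)
    obtain ⟨h, hh⟩ := hσ.exists_coeff hr hψ hv
    rw [(hh 0 hp).1]
    exact smul_ne_zero (Complex.ofReal_ne_zero.2 (hh 0 hp).2.1) (hσ.ne_zero _)
  have hwv : ∀ p ∈ A, w p (v p) = rPow P.τ p (v p) := fun p hp => by
    rw [hw]
    dsimp only
    rw [ContinuousLinearMap.smulRight_apply, fiberDual_self (hv0 p hp), one_smul]
  have key : ∀ p ∈ A, ∃ (ψ : ℂ → X) (F : ℂ → ℂ) (σ : ∀ z, S (ψ z)) (g : ℝ → ℝ),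
      IsBdryChart M ψ ∧ P.IsRealFrame ψ F σ ∧ ψ (0 : ℝ) = p ∧
      ContinuousWithinAt g ((fun t : ℝ => ψ t) ⁻¹' A) 0 ∧
      ∀ t : ℝ, ψ t ∈ A → w (ψ t) = (g t : ℂ) • jFrame ψ σ t := fun p hp => by
    obtain ⟨ψ, F, σ, hψ, rfl, hσ, hF⟩ := P.exists_bdryFrame hr (hA hp)
    obtain ⟨h, hh⟩ := hσ.exists_coeff hr hψ hv
    have hc := hσ.continuousWithinAt_coeff hψ hv.1 (fun t ht => (hh t ht).1) hp
    have hFc : Continuous fun t : ℝ => (F t).re :=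
      Complex.continuous_re.comp ((continuous_iff_continuousAt.2 fun z =>
        (hF z).1.continuousAt).comp Complex.continuous_ofReal)
    refine ⟨ψ, F, σ, fun t => h t ^ r * (F t).re / h t, hψ, hσ, rfl,
      ((hc.pow r).mul hFc.continuousWithinAt).div hc (hh 0 hp).2.1, fun t ht => ?_⟩
    refine ContinuousLinearMap.ext fun s => ?_
    obtain ⟨c, rfl⟩ := exists_smul_eq_of_ne_zero (hv0 _ ht) s
    rw [map_smul, map_smul, hwv _ ht]
    congr 1
    rw [eq_smul_coform hψ.toIsParam t (rPow P.τ (ψ t) (v (ψ t))), (hh t ht).1, smul_apply, map_smul,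
      jFrame_apply (hσ.ne_zero _), smul_smul]
    congr 1
    change rVal P.τ (ψ t) _ (vel ψ t) = _
    rw [rVal_smul, (hσ.frame.2 _ trivial).2, ← hσ.ofReal_re hψ]
    push_cast
    rw [div_mul_cancel₀ _ (Complex.ofReal_ne_zero.2 (hh t ht).2.1)]
  have hpos : ∀ p ∈ A, M.IsPositive p (w p (v p)) := fun p hp => by
    rw [hwv p hp]
    exact hv.2.2 p hp
  refine ⟨w, ⟨fun p hp => ?_, fun p hp s u => ?_, v, hv, hpos⟩, hv, hpos⟩
  all_goals obtain ⟨ψ, F, σ, g, hψ, hσ, rfl, hgc, hg⟩ := key p hp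
  · rw [ContinuousWithinAt, ← hψ.map_nhdsWithin_real hA, tendsto_map'_iff]
    have h1 : ContinuousWithinAt (fun t : ℝ => (⟨ψ t, (g t : ℂ) • jFrame ψ σ t⟩ :
        TotalSpace (ℂ →L[ℂ] (ℂ →L[ℂ] ℂ)) (JFiber S))) ((fun t : ℝ => ψ t) ⁻¹' A) 0 :=
      (Complex.continuous_ofReal.continuousAt.comp_continuousWithinAt hgc).smul_total
        ((continuous_jFrame hψ.toIsParam hσ.continuous hσ.ne_zero).comp
          Complex.continuous_ofReal).continuousWithinAt
    rw [hg 0 hp]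
    refine h1.tendsto.congr' ?_
    filter_upwards [self_mem_nhdsWithin] with t ht
    rw [Function.comp_apply, hg t ht]
  · obtain ⟨c, rfl⟩ := exists_smul_eq_of_ne_zero (hσ.ne_zero _) s
    have hex : ∀ u : ℂ, ∃ d : ℂ, u = d * vel ψ (0 : ℝ) := fun u =>
      ⟨u * (vel ψ (0 : ℝ))⁻¹, by
        rw [mul_assoc, inv_mul_cancel₀ (hψ.vel_ne_zero _), mul_one]⟩
    obtain ⟨d, hd⟩ := hex u
    subst hd
    have h1 := conjDeriv_vel M.antiholomorphic hψ.toIsParam hψ.conj (0 : ℝ) d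
    rw [Complex.conj_ofReal] at h1
    have h2 : (w (ψ (0 : ℝ)) (c • σ (0 : ℝ)) (d * vel ψ (0 : ℝ) : ℂ) : ℂ) = g 0 * (c * d) := by
      rw [hg 0 hp]
      exact hσ.jFrame_smul_val hψ _ _ _ _
    have h3 : (w (ψ (0 : ℝ)) (starRingEnd ℂ c • σ (0 : ℝ))
        (starRingEnd ℂ d * vel ψ (0 : ℝ) : ℂ) : ℂ) = g 0 * (starRingEnd ℂ c * starRingEnd ℂ d) := by
      rw [hg 0 hp]
      exact hσ.jFrame_smul_val hψ _ _ _ _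
    -- Evaluation is regarded as a function on the total space so that the equation for `totalMap`
    -- can be substituted despite the change of base point.
    let G : TotalSpace ℂ S → ℂ → ℂ := fun q u => w q.1 q.2 u
    have h4 : G (totalMap M.φ P.inv ⟨ψ (0 : ℝ), c • σ (0 : ℝ)⟩) (conjDeriv M.φ (ψ (0 : ℝ))
        (d * vel ψ (0 : ℝ) : ℂ)) = g 0 * (starRingEnd ℂ c * starRingEnd ℂ d) := by
      rw [hσ.totalMap_real]
      exact (congrArg (G _) h1).trans h3
    refine Eq.trans h4 ?_
    refine Eq.trans ?_ (congrArg (starRingEnd ℂ) h2).symm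
    rw [map_mul, map_mul, Complex.conj_ofReal]

theorem IsLiftingS.ne_zero (hr : 0 < r) (hA : A ⊆ M.bdry) {v : ∀ p, S p} (hv : P.IsLiftingS A v)
    {p : X} (hp : p ∈ A) : v p ≠ 0 := by
  obtain ⟨ψ, F, σ, hψ, rfl, hσ, -⟩ := P.exists_bdryFrame hr (hA hp)
  obtain ⟨h, hh⟩ := hσ.exists_coeff hr hψ hv
  rw [(hh 0 hp).1]
  exact smul_ne_zero (Complex.ofReal_ne_zero.2 (hh 0 hp).2.1) (hσ.ne_zero _)

theorem Paired.ne_zero (hr : 0 < r) (hA : A ⊆ M.bdry) {w : ∀ p, JFiber S p} {v : ∀ p, S p}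
    (h : P.Paired A w v) {p : X} (hp : p ∈ A) : w p ≠ 0 := by
  obtain ⟨ψ, F, σ, hψ, rfl, hσ, -⟩ := P.exists_bdryFrame hr (hA hp)
  obtain ⟨h', hh⟩ := hσ.exists_coeff hr hψ h.liftS
  obtain ⟨g, hg⟩ := h.exists_coeff hψ hσ fun t ht => ⟨(hh t ht).1, (hh t ht).2.1⟩
  rw [(hg 0 hp).1]
  exact smul_ne_zero (Complex.ofReal_ne_zero.2 (left_ne_zero_of_mul (hg 0 hp).2.ne'))
    (jFrame_ne_zero hψ.toIsParam (hσ.ne_zero _))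

theorem IsLiftingS.sectionEquiv_iff (hr : 0 < r) (hA : A ⊆ M.bdry) {v v' : ∀ p, S p}
    (hv : P.IsLiftingS A v) (hv' : P.IsLiftingS A v') :
    SectionEquiv A v v' ↔ ∀ p ∈ A, PosRatio (v p) (v' p) :=
  _root_.sectionEquiv_iff hv.1 hv'.1 fun _ hp => hv'.ne_zero hr hA hp

theorem Paired.sectionEquiv_iff (hr : 0 < r) (hA : A ⊆ M.bdry) {w w' : ∀ p, JFiber S p}
    {v v' : ∀ p, S p} (h : P.Paired A w v) (h' : P.Paired A w' v') :
    SectionEquiv A w w' ↔ SectionEquiv A v v' := by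
  rw [h.liftS.sectionEquiv_iff hr hA h'.liftS,
    _root_.sectionEquiv_iff h.liftJ.1 h'.liftJ.1 fun _ hp => h'.ne_zero hr hA hp]
  refine forall₂_congr fun p hp => ?_
  obtain ⟨ψ, F, σ, hψ, rfl, hσ, -⟩ := P.exists_bdryFrame hr (hA hp)
  obtain ⟨k, hk⟩ := hσ.exists_coeff hr hψ h.liftS
  obtain ⟨k', hk'⟩ := hσ.exists_coeff hr hψ h'.liftS
  obtain ⟨g, hg⟩ := h.exists_coeff hψ hσ fun t ht => ⟨(hk t ht).1, (hk t ht).2.1⟩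
  obtain ⟨g', hg'⟩ := h'.exists_coeff hψ hσ fun t ht => ⟨(hk' t ht).1, (hk' t ht).2.1⟩
  have h1 := (hg 0 hp).2
  have h2 := (hg' 0 hp).2
  rw [(hk 0 hp).1, (hk' 0 hp).1, (hg 0 hp).1, (hg' 0 hp).1,
    posRatio_smul_iff (hσ.ne_zero _) (hk' 0 hp).2.1,
    posRatio_smul_iff (jFrame_ne_zero hψ.toIsParam (hσ.ne_zero _)) (left_ne_zero_of_mul h2.ne')]
  have h3 : 0 < (g 0 * g' 0) * (k 0 * k' 0) := by
    have := mul_pos h1 h2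
    linarith [mul_mul_mul_comm (g 0) (k 0) (g' 0) (k' 0)]
  exact ⟨fun h4 => pos_of_mul_pos_right h3 h4.le, fun h4 => pos_of_mul_pos_left h3 h4.le⟩

theorem isLegalS_iff (hA : A ⊆ M.openBdry) {j : B}
    (hAx : insert (M.x j) A ∈ 𝓝[M.bdry] (M.x j)) {ψ : ℂ → X} {F : ℂ → ℂ} {σ : ∀ z, S (ψ z)}
    (hψ : IsBdryChart M ψ) (hσ : P.IsRealFrame ψ F σ) {x : ℝ} (hx : ψ x = M.x j) {v : ∀ p, S p}
    (hv : P.IsLiftingS A v) {h : ℝ → ℝ}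
    (hh : ∀ t : ℝ, ψ t ∈ A → v (ψ t) = (h t : ℂ) • σ t ∧ h t ≠ 0) :
    P.IsLegalS A v j ↔ ¬ EvSign (𝓝[≠] x) h := by
  rw [IsLegalS, ← hx]
  rw [← hx] at hAx
  exact not_congr (isIllegal_iff hψ (hA.trans sdiff_subset) hAx (fun h => (hA h).2 ⟨j, hx.symm⟩)
    hσ.continuous hσ.ne_zero (fun v => exists_smul_eq_of_ne_zero (hσ.ne_zero _) v) hh hv.1
    fun w' c hc h => hv.smul (hA.trans sdiff_subset) hc h)

theorem Paired.isLegal_iff (hr : 0 < r) (hA : A ⊆ M.openBdry) {j : B}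
    (hAx : insert (M.x j) A ∈ 𝓝[M.bdry] (M.x j)) {w : ∀ p, JFiber S p} {v : ∀ p, S p}
    (hwv : P.Paired A w v) : P.IsLegalJ A w j ↔ P.IsLegalS A v j := by
  obtain ⟨ψ, F, σ, hψ, hx, hσ, -⟩ := P.exists_bdryFrame hr (q := M.x j) (M.x_mem j)
  obtain ⟨h, hh⟩ := hσ.exists_coeff hr hψ hwv.liftS
  have hh' : ∀ t : ℝ, ψ t ∈ A → v (ψ t) = (h t : ℂ) • σ t ∧ h t ≠ 0 :=
    fun t ht => ⟨(hh t ht).1, (hh t ht).2.1⟩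
  obtain ⟨g, hg⟩ := hwv.exists_coeff hψ hσ hh'
  rw [isLegalS_iff hA hAx hψ hσ hx hwv.liftS hh', IsLegalJ, ← hx]
  rw [← hx] at hAx
  have hxA : ψ (0 : ℝ) ∉ A := fun h => (hA h).2 ⟨j, hx.symm⟩
  rw [isIllegal_iff hψ (hA.trans sdiff_subset) hAx hxA
    (continuous_jFrame hψ.toIsParam hσ.continuous hσ.ne_zero)
    (fun z => jFrame_ne_zero hψ.toIsParam (hσ.ne_zero z))
    (fun w => ⟨_, eq_smul_jFrame hψ.toIsParam (hσ.ne_zero _) w⟩)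
    (fun t ht => ⟨(hg t ht).1, left_ne_zero_of_mul (hg t ht).2.ne'⟩) hwv.liftJ.1
    fun w' c hc h => hwv.liftJ.smul (hA.trans sdiff_subset) hc h]
  have hev : ∀ᶠ t : ℝ in 𝓝[≠] 0, ψ t ∈ A := by
    rw [← hψ.map_nhds_real, mem_map] at hAx
    filter_upwards [nhdsWithin_le_nhds hAx, self_mem_nhdsWithin] with t ht htx
    exact (mem_insert_iff.1 ht).resolve_left fun h =>
      htx (Complex.ofReal_injective (hψ.injective h))
  refine not_congr ⟨fun h1 => h1.congr_sign ?_, fun h1 => h1.congr_sign ?_⟩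
  · filter_upwards [hev] with t ht using (hg t ht).2
  · filter_upwards [hev] with t ht using by rw [mul_comm]; exact (hg t ht).2

end TwistedSpin

end Pairing

/-! ### Parity of the boundary twists, and the case of odd `r` -/

section Parity

theorem EvSign.of_mul_left {α : Type*} {l : Filter α} {h g : α → ℝ} (hh : EvSign l h)
    (hg : EvSign l (fun x => h x * g x)) : EvSign l g := by
  refine (hh.mul hg).congr_sign ?_
  have h1 : ∀ᶠ x in l, h x * g x ≠ 0 := by
    rcases hg with h2 | h2
    · filter_upwards [h2] with x hx using hx.ne'
    · filter_upwards [h2] with x hx using hx.ne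
  filter_upwards [h1] with x hx
  nlinarith [mul_self_pos.2 hx]

theorem evSign_pow_iff {x : ℝ} {n : ℕ} : EvSign (𝓝[≠] x) (fun t => (t - x) ^ n) ↔ Even n := by
  constructor
  · intro h
    by_contra hn
    rw [Nat.not_even_iff_odd] at hn
    rcases h with h | h
    · have h1 := h.filter_mono (nhdsLT_le_nhdsNE x)
      obtain ⟨t, ht, htx⟩ := (h1.and self_mem_nhdsWithin).exists
      rw [hn.pow_pos_iff] at ht
      have htx : t < x := htx
      linarith
    · have h1 := h.filter_mono (nhdsGT_le_nhdsNE x)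
      obtain ⟨t, ht, htx⟩ := (h1.and self_mem_nhdsWithin).exists
      rw [hn.pow_neg_iff] at ht
      have htx : x < t := htx
      linarith
  · intro hn
    refine Or.inl ?_
    filter_upwards [self_mem_nhdsWithin] with t ht
    exact hn.pow_pos (sub_ne_zero.2 ht)

/-- A holomorphic function which is real on the real line changes sign at a real zero according
to the parity of its order. -/
theorem evSign_analytic {F : ℂ → ℂ} {x : ℝ} {n : ℕ} (hF : AnalyticAt ℂ F x)
    (hn : analyticOrderAt F x = n) (hreal : ∀ t : ℝ, ((F t).re : ℂ) = F t) :
    EvSign (𝓝[≠] x) (fun t : ℝ => (F t).re * (t - x) ^ n) := by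
  obtain ⟨g, hg, hg0, hFg⟩ := (hF.analyticOrderAt_eq_natCast).1 hn
  have hFg' : ∀ᶠ t : ℝ in 𝓝 x, F t = ((t : ℂ) - x) ^ n • g t :=
    (Complex.continuous_ofReal.tendsto x).eventually hFg
  have hgc : Tendsto (fun t : ℝ => g t) (𝓝[≠] x) (𝓝 (g x)) :=
    (hg.continuousAt.tendsto.comp (Complex.continuous_ofReal.tendsto x)).mono_left
      nhdsWithin_le_nhds
  have hgr : ∀ᶠ t : ℝ in 𝓝[≠] x, (g t).im = 0 ∧ (F t).re = (t - x) ^ n * (g t).re := by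
    filter_upwards [nhdsWithin_le_nhds hFg', self_mem_nhdsWithin] with t ht htx
    have h1 : F t = (((t - x) ^ n : ℝ) : ℂ) * g t := by rw [ht, smul_eq_mul]; push_cast; rfl
    have h2 : (t - x) ^ n ≠ 0 := pow_ne_zero _ (sub_ne_zero.2 htx)
    have h3 : (F t).im = 0 := by rw [← hreal t, Complex.ofReal_im]
    rw [h1, Complex.im_ofReal_mul] at h3
    exact ⟨(mul_eq_zero.1 h3).resolve_left h2, by rw [h1, Complex.re_ofReal_mul]⟩
  have him : (g x).im = 0 := by
    have h1 := (Complex.continuous_im.tendsto _).comp hgc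
    refine tendsto_nhds_unique h1 (tendsto_const_nhds.congr' ?_)
    filter_upwards [hgr] with t ht using ht.1.symm
  have hre : (g x).re ≠ 0 := fun h => hg0 (Complex.ext h him)
  have hs := evSign_of_tendsto ((Complex.continuous_re.tendsto _).comp hgc) hre
  refine hs.congr_sign ?_
  have hne : ∀ᶠ t : ℝ in 𝓝[≠] x, (g t).re ≠ 0 :=
    ((Complex.continuous_re.tendsto _).comp hgc).eventually_ne hre
  filter_upwards [hgr, hne, self_mem_nhdsWithin] with t h1 h2 h3
  rw [h1.2, Function.comp_apply]
  have h4 := mul_self_pos.2 (mul_ne_zero (pow_ne_zero n (sub_ne_zero.2 (show t ≠ x from h3))) h2)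
  linarith

section Parity
set_option linter.unusedSectionVars false
variable {X : Type*} [TopologicalSpace X] [ChartedSpace ℂ X] [IsManifold 𝓘(ℂ) ω X]
  {I B : Type*} [Fintype I] [Fintype B] {r : ℕ} {M : MarkedDisk X I B} {a : I → ℕ} {b : B → ℕ}
  {S : X → Type*} [∀ p, AddCommGroup (S p)] [∀ p, Module ℂ (S p)]
  [TopologicalSpace (TotalSpace ℂ S)] [∀ p, TopologicalSpace (S p)]
  [FiberBundle ℂ S] [VectorBundle ℂ ℂ S] [ContMDiffVectorBundle ω ℂ S 𝓘(ℂ)]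

namespace TwistedSpin

variable {P : TwistedSpin r M a b S} {A : Set X}

theorem eventually_mem_of_insert {ψ : ℂ → X} (hψ : IsBdryChart M ψ) {x : ℝ}
    (hAx : insert (ψ x) A ∈ 𝓝[M.bdry] (ψ x)) : ∀ᶠ t : ℝ in 𝓝[≠] x, ψ t ∈ A := by
  rw [← hψ.map_nhds_real, mem_map] at hAx
  filter_upwards [nhdsWithin_le_nhds hAx, self_mem_nhdsWithin] with t ht htx
  exact (mem_insert_iff.1 ht).resolve_left fun h =>
    htx (Complex.ofReal_injective (hψ.injective h))

variable [T2Space X] [CompactSpace X]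

/-- An even power is nonnegative, so `F` is positive on both sides of the marked point, while its
sign there varies like that of `(t - x) ^ b j`. -/
theorem IsLiftingS.even_twist (hr : 0 < r) (hre : Even r) {v : ∀ p, S p}
    (hv : P.IsLiftingS M.openBdry v) (j : B) : Even (b j) := by
  obtain ⟨ψ, F, σ, hψ, hx, hσ, hF⟩ := P.exists_bdryFrame hr (q := M.x j) (M.x_mem j)
  obtain ⟨h, hh⟩ := hσ.exists_coeff hr hψ hv
  have hA := M.insert_mem_nhdsWithin j
  rw [← hx] at hA
  have h1 := evSign_analytic (hF (0 : ℝ)).1 (by rw [(hF _).2, hx, M.divisor_x]) (hσ.ofReal_re hψ)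
  rw [← evSign_pow_iff (x := 0)]
  refine EvSign.of_mul_left (Or.inl ?_) h1
  filter_upwards [eventually_mem_of_insert hψ hA] with t ht
  exact pos_of_mul_pos_right (hh t ht).2.2 (hre.pow_nonneg _)

/-- For odd `r` the sign of a coefficient is thus dictated by the frame; uniqueness, legality and
existence of liftings all rest on this. -/
theorem pos_mul_of_odd (hr : Odd r) {h f : ℝ} (hp : 0 < h ^ r * f) : 0 < h * f := by
  obtain ⟨k, rfl⟩ := hr
  rw [pow_succ, mul_assoc] at hp
  exact pos_of_mul_pos_right hp ((even_two_mul k).pow_nonneg _)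

/-- Near the marked point `h` has the sign of `F`, and `F` changes sign there exactly when its order
of vanishing `b j` is odd. -/
theorem IsLiftingS.isLegal_iff_of_odd (hr : Odd r) (hA : A ⊆ M.openBdry) {j : B}
    (hAx : insert (M.x j) A ∈ 𝓝[M.bdry] (M.x j)) {v : ∀ p, S p} (hv : P.IsLiftingS A v) :
    P.IsLegalS A v j ↔ Odd (b j) := by
  obtain ⟨ψ, F, σ, hψ, hx, hσ, hF⟩ := P.exists_bdryFrame hr.pos (q := M.x j) (M.x_mem j)
  obtain ⟨h, hh⟩ := hσ.exists_coeff hr.pos hψ hv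
  rw [isLegalS_iff hA hAx hψ hσ hx hv fun t ht => ⟨(hh t ht).1, (hh t ht).2.1⟩,
    ← Nat.not_even_iff_odd, ← evSign_pow_iff (x := 0)]
  rw [← hx] at hAx
  have h1 := evSign_analytic (hF (0 : ℝ)).1 (by rw [(hF _).2, hx, M.divisor_x]) (hσ.ofReal_re hψ)
  have h2 : ∀ᶠ t : ℝ in 𝓝[≠] 0, 0 < h t * (F t).re := by
    filter_upwards [eventually_mem_of_insert hψ hAx] with t ht
    exact pos_mul_of_odd hr (hh t ht).2.2
  refine not_congr ⟨fun h3 => (h3.congr_sign h2).of_mul_left h1, fun h3 => ?_⟩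
  refine EvSign.congr_sign (h := fun t : ℝ => (F t).re) (h3.of_mul_left ?_) ?_
  · simpa only [mul_comm] using h1
  · simpa only [mul_comm] using h2

theorem IsLiftingS.sectionEquiv_of_odd (hr : Odd r) (hA : A ⊆ M.bdry) {v v' : ∀ p, S p}
    (hv : P.IsLiftingS A v) (hv' : P.IsLiftingS A v') : SectionEquiv A v v' := by
  rw [hv.sectionEquiv_iff hr.pos hA hv']
  intro p hp
  obtain ⟨ψ, F, σ, hψ, rfl, hσ, -⟩ := P.exists_bdryFrame hr.pos (hA hp)
  obtain ⟨h, hh⟩ := hσ.exists_coeff hr.pos hψ hv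
  obtain ⟨h', hh'⟩ := hσ.exists_coeff hr.pos hψ hv'
  rw [(hh 0 hp).1, (hh' 0 hp).1, posRatio_smul_iff (hσ.ne_zero _) (hh' 0 hp).2.1]
  have h1 := pos_mul_of_odd hr (hh 0 hp).2.2
  have h2 := pos_mul_of_odd hr (hh' 0 hp).2.2
  have h3 : 0 < (h 0 * h' 0) * ((F (0 : ℝ)).re * (F (0 : ℝ)).re) := by
    have := mul_pos h1 h2
    rwa [mul_mul_mul_comm] at this
  exact pos_of_mul_pos_left h3 (mul_self_nonneg _)

/-- Liftings over the members of an open cover can be glued if `r` is odd. -/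
theorem compatible_of_cover (hr : Odd r) {ι : Type*} [Fintype ι] {U : ι → Set X}
    (hU : ∀ i, IsOpen (U i)) (hcov : M.bdry ⊆ ⋃ i, U i)
    (hl : ∀ i, ∃ v, P.IsLiftingS (M.openBdry ∩ U i) v) : P.Compatible := by
  choose v hv using hl
  have hcl : IsClosed M.bdry := isClosed_eq M.antiholomorphic.1 continuous_id
  obtain ⟨ρ, hρ⟩ := PartitionOfUnity.exists_isSubordinate hcl U hU hcov
  -- All local coefficients have the sign of `F`, so a convex combination of them has this sign too
  -- and cannot vanish.
  refine ⟨fun p => ∑ i, (ρ i p : ℂ) • v i p, isLiftingS_of_local sdiff_subset fun p hp => ?_⟩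
  obtain ⟨ψ, F, σ, hψ, rfl, hσ, -⟩ := P.exists_bdryFrame hr.pos hp.1
  have hψc : Continuous fun t : ℝ => ψ t := hψ.contMDiff.continuous.comp Complex.continuous_ofReal
  choose h hh using fun i => hσ.exists_coeff hr.pos hψ (hv i)
  have hzero : ∀ i p, p ∉ U i → ρ i p = 0 := fun i p hp => by
    by_contra h0
    exact hp (hρ i (subset_tsupport _ h0))
  have hρv : ∀ (i) (t : ℝ), ψ t ∈ M.openBdry →
      (ρ i (ψ t) : ℂ) • v i (ψ t) = ((ρ i (ψ t) * h i t : ℝ) : ℂ) • σ t := fun i t ht => by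
    by_cases htU : ψ t ∈ U i
    · rw [(hh i t ⟨ht, htU⟩).1, smul_smul, Complex.ofReal_mul]
    · rw [hzero i _ htU]
      simp
  refine ⟨ψ, F, σ, 0, fun t => ∑ i, ρ i (ψ t) * h i t, hψ, hσ, rfl, ?_, ?_, ?_⟩
  · refine tendsto_finsetSum _ fun i _ => ?_
    change ContinuousWithinAt (fun t : ℝ => ρ i (ψ t) * h i t) _ _
    by_cases hpU : ψ (0 : ℝ) ∈ U i
    · have h1 := hσ.continuousWithinAt_coeff hψ (hv i).1 (fun t ht => (hh i t ht).1) ⟨hp, hpU⟩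
      rw [preimage_inter, continuousWithinAt_inter
        (((hU i).preimage hψc).mem_nhds hpU)] at h1
      exact ((ρ i).continuous.comp hψc).continuousWithinAt.mul h1
    · have h1 : ∀ᶠ t : ℝ in 𝓝 0, ψ t ∉ tsupport (ρ i) :=
        ((isClosed_tsupport (ρ i)).isOpen_compl.preimage hψc).mem_nhds fun h => hpU (hρ i h)
      refine ContinuousAt.continuousWithinAt (continuousAt_const.congr (f := fun _ => (0 : ℝ)) ?_)
      filter_upwards [h1] with t ht
      rw [image_eq_zero_of_notMem_tsupport ht, zero_mul]
  · refine Eventually.of_forall fun t ht => ?_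
    rw [Complex.ofReal_sum, Finset.sum_smul]
    exact Finset.sum_congr rfl fun i _ => hρv i t ht
  · have h1 : ∀ i, 0 ≤ ρ i (ψ (0 : ℝ)) * (h i 0 * (F (0 : ℝ)).re) := fun i => by
      by_cases hpU : ψ (0 : ℝ) ∈ U i
      · exact mul_nonneg (ρ.nonneg i _) (pos_mul_of_odd hr (hh i 0 ⟨hp, hpU⟩).2.2).le
      · rw [hzero i _ hpU, zero_mul]
    have h2 : ∑ i, ρ i (ψ (0 : ℝ)) = 1 := by
      rw [← finsum_eq_sum_of_fintype]
      exact ρ.sum_eq_one hp.1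
    have h3 : 0 < (∑ i, ρ i (ψ (0 : ℝ)) * h i 0) * (F (0 : ℝ)).re := by
      rw [Finset.sum_mul]
      simp only [mul_assoc]
      obtain ⟨i, -, hi⟩ := Finset.exists_ne_zero_of_sum_ne_zero (h2.trans_ne one_ne_zero)
      refine Finset.sum_pos' (fun i _ => h1 i) ⟨i, Finset.mem_univ _, ?_⟩
      have hpU : ψ (0 : ℝ) ∈ U i := by
        by_contra h0
        exact hi (hzero i _ h0)
      exact mul_pos (lt_of_le_of_ne (ρ.nonneg i _) (Ne.symm hi))
        (pos_mul_of_odd hr (hh i 0 ⟨hp, hpU⟩).2.2)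
    obtain ⟨k, rfl⟩ := hr
    rw [pow_succ, mul_assoc]
    exact mul_pos ((even_two_mul k).pow_pos (left_ne_zero_of_mul h3.ne')) h3

theorem compatible_of_odd (P : TwistedSpin r M a b S) (hr : Odd r) : P.Compatible := by
  have hcl : IsClosed M.bdry := isClosed_eq M.antiholomorphic.1 continuous_id
  choose ψ F σ hψ hx hσ hF using fun q : M.bdry => P.exists_bdryFrame hr.pos q.2
  obtain ⟨t, ht⟩ := hcl.isCompact.elim_finite_subcover (fun q : M.bdry => range (ψ q))
    (fun q => (hψ q).isOpenEmbedding.isOpen_range)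
    fun q hq => mem_iUnion.2 ⟨⟨q, hq⟩, _, hx ⟨q, hq⟩⟩
  refine compatible_of_cover hr (ι := t) (U := fun q => range (ψ q))
    (fun q => (hψ q).isOpenEmbedding.isOpen_range) (ht.trans ?_) fun q => ?_
  · refine iUnion₂_subset fun q hq => ?_
    exact subset_iUnion (fun q : t => range (ψ q)) ⟨q, hq⟩
  -- Locally `F` itself serves as the coefficient: `F ^ r * F` is an even power, hence positive
  -- where `F` does not vanish.
  obtain ⟨v, hv⟩ := exists_section_extending (hψ q).injective
    fun x => (((F q x).re : ℝ) : ℂ) • σ q x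
  refine ⟨v, isLiftingS_of_local (inter_subset_left.trans sdiff_subset) ?_⟩
  rintro p ⟨hp, z, rfl⟩
  obtain ⟨x, rfl⟩ := ((hψ q).mem_bdry_iff z).1 hp.1
  refine ⟨ψ q, F q, σ q, x, fun x => (F q x).re, hψ q, hσ q, rfl, ?_,
    Eventually.of_forall fun t _ => hv t, ?_⟩
  · exact (Complex.continuous_re.comp ((continuous_iff_continuousAt.2 fun z =>
      (hF q z).1.continuousAt).comp Complex.continuous_ofReal)).continuousWithinAt
  · rw [← pow_succ]
    refine (hr.add_one).pow_pos fun h0 => ?_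
    have h1 := (hF q x).2
    rw [M.divisor_eq_zero hp, Nat.cast_zero, (hF q x).1.analyticOrderAt_eq_zero,
      ← (hσ q).ofReal_re (hψ q), h0] at h1
    exact h1 rfl

end TwistedSpin

end Parity

end Parity

/-! ### Rotating the involution by `ξ` -/

section Twisting
set_option linter.unusedSectionVars false
variable {X : Type*} [TopologicalSpace X] [ChartedSpace ℂ X] [IsManifold 𝓘(ℂ) ω X]
  {I B : Type*} [Fintype I] [Fintype B] {r : ℕ} {M : MarkedDisk X I B} {a : I → ℕ} {b : B → ℕ}
  {S : X → Type*} [∀ p, AddCommGroup (S p)] [∀ p, Module ℂ (S p)]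
  [TopologicalSpace (TotalSpace ℂ S)] [∀ p, TopologicalSpace (S p)]
  [FiberBundle ℂ S] [VectorBundle ℂ ℂ S] [ContMDiffVectorBundle ω ℂ S 𝓘(ℂ)]

namespace TwistedSpin

theorem norm_eq_one_of_pow_eq_neg_one (hr : 0 < r) {ξ : ℂ} (hξ : ξ ^ r = -1) : ‖ξ‖ = 1 := by
  have h1 : ‖ξ‖ ^ r = 1 := by rw [← norm_pow, hξ, norm_neg, norm_one]
  exact (pow_eq_one_iff_of_nonneg (norm_nonneg ξ) hr.ne').1 h1

theorem totalMap_smul_inv {φ : X → X} (inv : ∀ p, S p →ₛₗ[starRingEnd ℂ] S (φ p)) (c : ℂ)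
    (q : TotalSpace ℂ S) :
    totalMap φ (fun p => c • inv p) q = ⟨(totalMap φ inv q).1, c • (totalMap φ inv q).2⟩ := rfl

/-- Rotating the involution of a twisted spin structure by a phase `c` with `c ^ r = 1`. -/
def rotate (P : TwistedSpin r M a b S) {c : ℂ} (hc : c * starRingEnd ℂ c = 1) (hcr : c ^ r = 1) :
    TwistedSpin r M a b S where
  a_lt := P.a_lt
  b_lt := P.b_lt
  τ := P.τ
  τ_order := P.τ_order
  inv := fun p => c • P.inv p
  inv_involutive := fun q => by
    have h1 := P.totalMap_smul c (P.inv_involutive q)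
    rw [totalMap_smul_inv, totalMap_smul_inv]
    refine (congrArg (fun q : TotalSpace ℂ S => (⟨q.1, c • q.2⟩ : TotalSpace ℂ S)) h1).trans ?_
    dsimp only
    rw [smul_smul, hc, one_smul]
  inv_antiholomorphic := fun U s hU hs => by
    have hex : ∀ p, ∃ u : S p, totalMap M.φ P.inv ⟨M.φ p, s (M.φ p)⟩ = ⟨p, u⟩ := fun p => by
      have h1 : (totalMap M.φ P.inv ⟨M.φ p, s (M.φ p)⟩).1 = p := M.involutive p
      generalize totalMap M.φ P.inv ⟨M.φ p, s (M.φ p)⟩ = q at h1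
      subst h1
      exact ⟨_, rfl⟩
    choose t ht using hex
    have h1 := P.inv_antiholomorphic U s hU hs
    simp only [ht] at h1
    refine (ContMDiffOn.const_smul_section (a := c) h1).congr fun p _ => ?_
    rw [totalMap_smul_inv, ht]
    rfl
  τ_inv := fun p v u => by
    rw [← P.τ_inv]
    refine congrArg (fun η : CanonicalFiber X (M.φ p) => η (conjDeriv M.φ p u)) ?_
    rw [LinearMap.smul_apply, rPow_smul, hcr, one_smul]

theorem rPow_neg (τ : ∀ p, (⨂[ℂ]^r (S p)) →ₗ[ℂ] CanonicalFiber X p) (p : X) (v : S p) :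
    rPow (-τ) p v = -rPow τ p v := rfl

theorem rPowCoeff_neg (τ : ∀ p, (⨂[ℂ]^r (S p)) →ₗ[ℂ] CanonicalFiber X p) (s : ∀ p, S p) (p : X) :
    rPowCoeff (-τ) s p = -rPowCoeff τ s p := rfl

/-- The twisted spin structure with the opposite isomorphism. -/
def negate (P : TwistedSpin r M a b S) : TwistedSpin r M a b S where
  a_lt := P.a_lt
  b_lt := P.b_lt
  τ := -P.τ
  τ_order := fun U s hU hs hs0 p hp => by
    obtain ⟨h1, h2⟩ := P.τ_order U s hU hs hs0 p hp
    rw [rPowCoeff_neg, analyticOrderAt_neg]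
    exact ⟨h1.neg, h2⟩
  inv := P.inv
  inv_involutive := P.inv_involutive
  inv_antiholomorphic := P.inv_antiholomorphic
  τ_inv := fun p v u => by
    rw [rPow_neg, rPow_neg]
    refine (congrArg Neg.neg (P.τ_inv p v u)).trans ?_
    exact (map_neg (starRingEnd ℂ) _).symm

/-- As the involution is conjugate-linear and `‖ξ‖ = 1`, conjugating it by `ξ` multiplies it by `ξ ^
2`, whose `r`th power is `1`; so `τ` remains compatible. Multiplication by `ξ` changes `τ` by `ξ ^ r
= -1`. -/
theorem exists_rotated (P : TwistedSpin r M a b S) (hr : 0 < r) {ξ : ℂ} (hξ : ξ ^ r = -1) :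
    ∃ P' N : TwistedSpin r M a b S, P'.τ = P.τ ∧ (∀ p v, P'.inv p v = ξ • P.inv p (ξ⁻¹ • v)) ∧
      N.τ = -P.τ ∧ N.inv = P.inv ∧ ∃ f : TwistedSpin.Iso N P', ∀ p v, f.f p v = ξ • v := by
  have hn := norm_eq_one_of_pow_eq_neg_one hr hξ
  have hξ0 : ξ ≠ 0 := norm_ne_zero_iff.1 (hn.trans_ne one_ne_zero)
  have h1 : ξ * starRingEnd ℂ ξ = 1 := by
    rw [Complex.mul_conj, Complex.normSq_eq_norm_sq, hn]; norm_num
  have hconj : starRingEnd ℂ ξ = ξ⁻¹ := eq_inv_of_mul_eq_one_right h1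
  have hc : ξ ^ 2 * starRingEnd ℂ (ξ ^ 2) = 1 := by rw [map_pow, ← mul_pow, h1, one_pow]
  have hcr : (ξ ^ 2) ^ r = 1 := by rw [← pow_mul, mul_comm, pow_mul, hξ, neg_one_sq]
  have hinv : ∀ p v, (P.rotate hc hcr).inv p v = ξ • P.inv p (ξ⁻¹ • v) := fun p v => by
    rw [map_smulₛₗ, smul_smul, map_inv₀, hconj, inv_inv, ← sq]
    rfl
  refine ⟨P.rotate hc hcr, P.negate, rfl, hinv, rfl, rfl, ⟨fun p => LinearEquiv.smulOfNeZero ℂ _ ξ hξ0,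
    fun U s hU hs => ?_, fun p v => ?_, fun p v => ?_⟩, fun p v => rfl⟩
  · exact ContMDiffOn.const_smul_section (a := ξ) hs
  · rw [hinv]
    change ξ • P.inv p v = ξ • P.inv p (ξ⁻¹ • ξ • v)
    rw [smul_smul, inv_mul_cancel₀ hξ0, one_smul]
  · change rPow P.τ p (ξ • v) = - rPow P.τ p v
    rw [rPow_smul, hξ]
    exact neg_one_smul ℂ (rPow P.τ p v : ℂ →L[ℂ] ℂ)

/-- Invariance for the rotated involution holds for `ξ • σ`, whose normalization is multiplied by `ξ
^ r = -1`. The rotation thus exchanges the two possible signs of a real frame. -/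
theorem IsRealFrame.rotated {P P' : TwistedSpin r M a b S} {ψ : ℂ → X} {F : ℂ → ℂ}
    {σ : ∀ z, S (ψ z)} (hσ : P.IsRealFrame ψ F σ) (hr : 0 < r) {ξ : ℂ} (hξ : ξ ^ r = -1)
    (hτ : P'.τ = P.τ) (hinv : ∀ p v, P'.inv p v = ξ • P.inv p (ξ⁻¹ • v)) :
    P'.IsRealFrame ψ (fun z => -F z) (fun z => ξ • σ z) := by
  have hn := norm_eq_one_of_pow_eq_neg_one hr hξ
  have hξ0 : ξ ≠ 0 := norm_ne_zero_iff.1 (hn.trans_ne one_ne_zero)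
  refine ⟨?_, fun z => ?_⟩
  · rw [hτ]
    simpa only [hξ, neg_one_mul] using hσ.frame.smul hξ0
  · rw [totalMap, hinv, smul_smul, inv_mul_cancel₀ hξ0, one_smul]
    exact congrArg (fun q : TotalSpace ℂ S => (⟨q.1, ξ • q.2⟩ : TotalSpace ℂ S)) (hσ.inv z)

end TwistedSpin

end Twisting

/-! ### Continuous roots on the punctured plane, and signs of real functions -/

section SignsAndRoots

theorem eq_of_pow_eq_of_isPreconnected {α : Type*} [TopologicalSpace α] {V : Set α}
    (hV : IsPreconnected V) {f : α → ℂ} (hf : ContinuousOn f V) {r : ℕ} (hr : 0 < r) {w : ℂ}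
    (hw : ∀ z ∈ V, f z ^ r = w) {x y : α} (hx : x ∈ V) (hy : y ∈ V) : f x = f y := by
  have hfin : Set.Finite {z : ℂ | z ^ r = w} := by
    refine (Polynomial.nthRoots r w).toFinset.finite_toSet.subset fun z hz => ?_
    rw [Finset.mem_coe, Multiset.mem_toFinset, Polynomial.mem_nthRoots hr]
    exact hz
  exact hV.constant_of_mapsTo hfin.isDiscrete hf hw hx hy

/-- A continuous `r`th root of `ε u ^ n` on the punctured plane is a multiple of a power. -/
theorem exists_eq_mul_pow_of_pow_eq {C : ℂ → ℂ} (hC : ContinuousOn C {0}ᶜ) {r n : ℕ} (hr : 0 < r)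
    {ε : ℂ} (hε : ε ≠ 0) (h : ∀ u, u ≠ 0 → C u ^ r = ε * u ^ n) :
    ∃ (k : ℕ) (c : ℂ), n = r * k ∧ c ^ r = ε ∧ ∀ u, u ≠ 0 → C u = c * u ^ k := by
  have hr0 : (r : ℂ) ≠ 0 := Nat.cast_ne_zero.2 hr.ne'
  have hdvd : r ∣ n := by
    -- A winding number argument: along the unit circle `C` times this factor is a continuous `r`th
    -- root of the constant `ε`, hence constant, and comparing `θ = 0` with `θ = 2π` gives `exp
    -- (-2πi n / r) = 1`.
    set E : ℝ → ℂ := fun θ => Complex.exp (-(n * (θ * Complex.I)) / r) with hE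
    set D : ℝ → ℂ := fun θ => C (Complex.exp (θ * Complex.I)) * E θ with hD
    have hDc : Continuous D := by
      refine Continuous.mul ?_ (by fun_prop)
      exact hC.comp_continuous (by fun_prop) fun θ => Complex.exp_ne_zero _
    have hDr : ∀ θ, D θ ^ r = ε := fun θ => by
      rw [hD, hE]
      dsimp only
      rw [mul_pow, h _ (Complex.exp_ne_zero _), ← Complex.exp_nat_mul, ← Complex.exp_nat_mul,
        mul_div_cancel₀ _ hr0, mul_assoc, ← Complex.exp_add, add_neg_cancel, Complex.exp_zero,
        mul_one]
    have h1 : D 0 = D (2 * Real.pi) := eq_of_pow_eq_of_isPreconnected isPreconnected_univ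
      hDc.continuousOn hr (fun θ _ => hDr θ) (mem_univ _) (mem_univ _)
    have h2 : C 1 ≠ 0 := fun h0 => by
      have := h 1 one_ne_zero
      rw [h0, zero_pow hr.ne', one_pow, mul_one] at this
      exact hε this.symm
    have h3 : E (2 * Real.pi) = 1 := by
      rw [hD] at h1
      dsimp only at h1
      push_cast at h1
      rw [Complex.exp_two_pi_mul_I] at h1
      simp only [zero_mul, Complex.exp_zero] at h1
      have h4 : E 0 = 1 := by simp [hE]
      rw [h4] at h1
      exact (mul_left_cancel₀ h2 h1).symm
    rw [hE] at h3
    dsimp only at h3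
    rw [Complex.exp_eq_one_iff] at h3
    obtain ⟨l, hl⟩ := h3
    have hpi : (2 * Real.pi * Complex.I : ℂ) ≠ 0 := Complex.two_pi_I_ne_zero
    have h5 : -(n : ℂ) = l * r := by
      rw [div_eq_iff hr0] at hl
      push_cast at hl
      refine mul_right_cancel₀ hpi ?_
      linear_combination hl
    have h6 : (n : ℤ) = r * (-l) := by
      have : ((n : ℤ) : ℂ) = ((r * (-l) : ℤ) : ℂ) := by
        push_cast
        linear_combination -h5
      exact_mod_cast this
    exact Int.natCast_dvd_natCast.1 ⟨_, h6⟩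
  obtain ⟨k, rfl⟩ := hdvd
  have hpc : IsPreconnected ({0}ᶜ : Set ℂ) :=
    (isConnected_compl_singleton_of_one_lt_rank (by simp) (0 : ℂ)).isPreconnected
  have hquot : ContinuousOn (fun u => C u / u ^ k) {0}ᶜ :=
    hC.div (continuousOn_id.pow k) fun u hu => pow_ne_zero _ hu
  have hpow : ∀ u ∈ ({0}ᶜ : Set ℂ), (C u / u ^ k) ^ r = ε := fun u hu => by
    have hu' : u ≠ 0 := hu
    rw [div_pow, h u hu, ← pow_mul, mul_comm k, mul_div_assoc, div_self (pow_ne_zero _ hu'), mul_one]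
  refine ⟨k, C 1, rfl, by simpa using h 1 one_ne_zero, fun u hu => ?_⟩
  have h1 := eq_of_pow_eq_of_isPreconnected hpc hquot hr hpow (x := u) (y := 1) hu one_ne_zero
  simp only [one_pow, div_one] at h1
  rw [← h1, div_mul_cancel₀ _ (pow_ne_zero _ hu)]

/-- A function on the real line with locally constant sign has constant sign. -/
theorem eventually_pos_or_neg {G : ℝ → ℝ} (h : ∀ t, EvSign (𝓝[≠] t) G) :
    (∀ t, ∀ᶠ u in 𝓝[≠] t, 0 < G u) ∨ (∀ t, ∀ᶠ u in 𝓝[≠] t, G u < 0) := by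
  -- A condition on punctured neighbourhoods of `t` is open in `t`, so connectedness of the line
  -- applies although `G` need not be continuous.
  have hopen : ∀ Q : ℝ → Prop, IsOpen {t | ∀ᶠ u in 𝓝[≠] t, Q u} := fun Q => by
    rw [isOpen_iff_mem_nhds]
    intro t ht
    have h1 := eventually_nhdsWithin_iff.1 (eventually_eventually_nhdsWithin.2 ht)
    filter_upwards [h1] with y hy
    rcases eq_or_ne y t with rfl | hyt
    · exact ht
    · have h2 := hy hyt
      rw [isOpen_compl_singleton.nhdsWithin_eq hyt] at h2
      exact h2.filter_mono nhdsWithin_le_nhds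
  have hdisj : ∀ t, (∀ᶠ u in 𝓝[≠] t, 0 < G u) → (∀ᶠ u in 𝓝[≠] t, G u < 0) → False :=
    fun t h1 h2 => by
    obtain ⟨u, h3, h4⟩ := (h1.and h2).exists
    exact lt_asymm h3 h4
  by_contra hcon
  push Not at hcon
  obtain ⟨⟨t₁, h1⟩, ⟨t₂, h2⟩⟩ := hcon
  obtain ⟨t, -, h3, h4⟩ := isPreconnected_univ _ _ (hopen fun u => 0 < G u) (hopen fun u => G u < 0)
    (fun t _ => h t) ⟨t₂, trivial, (h t₂).resolve_right (by simpa using h2)⟩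
    ⟨t₁, trivial, (h t₁).resolve_left (by simpa using h1)⟩
  exact hdisj t h3 h4

/-- Either `h` or `(t - x) h` has constant sign near `x`, if `h` is continuous and nonvanishing
off `x`. -/
theorem evSign_or_evSign_sub_mul {h : ℝ → ℝ} {x : ℝ}
    (hh : ∀ᶠ t in 𝓝[≠] x, ContinuousAt h t ∧ h t ≠ 0) :
    EvSign (𝓝[≠] x) h ∨ EvSign (𝓝[≠] x) (fun t => (t - x) * h t) := by
  rw [eventually_nhdsWithin_iff, Metric.eventually_nhds_iff_ball] at hh
  obtain ⟨δ, hδ, hh⟩ := hh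
  rw [Real.ball_eq_Ioo] at hh
  have hsign : ∀ s : Set ℝ, IsPreconnected s → s ⊆ Ioo (x - δ) (x + δ) → x ∉ s →
      (∀ t ∈ s, 0 < h t) ∨ (∀ t ∈ s, h t < 0) := fun s hs hsub hxs => by
    have h1 : ∀ t ∈ s, ContinuousAt h t ∧ h t ≠ 0 := fun t ht =>
      hh t (hsub ht) fun h2 => hxs (h2 ▸ ht)
    have hc : ContinuousOn h s := fun t ht => (h1 t ht).1.continuousWithinAt
    by_contra hcon
    push Not at hcon
    obtain ⟨⟨t₁, ht₁, h2⟩, ⟨t₂, ht₂, h3⟩⟩ := hcon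
    obtain ⟨t, ht, h4⟩ := hs.intermediate_value ht₁ ht₂ hc ⟨h2, h3⟩
    exact (h1 t ht).2 h4
  have hl := hsign (Ioo (x - δ) x) isPreconnected_Ioo
    (Ioo_subset_Ioo_right (by linarith)) (by simp)
  have hr := hsign (Ioo x (x + δ)) isPreconnected_Ioo
    (Ioo_subset_Ioo_left (by linarith)) (by simp)
  have hev : ∀ᶠ t in 𝓝[≠] x, t ∈ Ioo (x - δ) x ∨ t ∈ Ioo x (x + δ) := by
    filter_upwards [nhdsWithin_le_nhds (Ioo_mem_nhds (by linarith : x - δ < x)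
      (by linarith : x < x + δ)), self_mem_nhdsWithin] with t ht htx
    rcases lt_or_gt_of_ne (show t ≠ x from htx) with h1 | h1
    exacts [Or.inl ⟨ht.1, h1⟩, Or.inr ⟨h1, ht.2⟩]
  rcases hl with hl | hl <;> rcases hr with hr | hr
  · exact Or.inl (Or.inl (hev.mono fun t ht => ht.elim (hl t) (hr t)))
  · refine Or.inr (Or.inr (hev.mono fun t ht => ?_))
    rcases ht with ht | ht
    · exact mul_neg_of_neg_of_pos (by linarith [ht.2]) (hl t ht)
    · exact mul_neg_of_pos_of_neg (by linarith [ht.1]) (hr t ht)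
  · refine Or.inr (Or.inl (hev.mono fun t ht => ?_))
    rcases ht with ht | ht
    · exact mul_pos_of_neg_of_neg (by linarith [ht.2]) (hl t ht)
    · exact mul_pos (by linarith [ht.1]) (hr t ht)
  · exact Or.inl (Or.inr (hev.mono fun t ht => ht.elim (hl t) (hr t)))

end SignsAndRoots

/-! ### The divisor seen from infinity, and frames over the whole sphere -/

section GlobalFrames
set_option linter.unusedSectionVars false
variable {X : Type*} [TopologicalSpace X] [ChartedSpace ℂ X] [IsManifold 𝓘(ℂ) ω X]
  {I B : Type*} [Fintype I] [Fintype B] {r : ℕ} {M : MarkedDisk X I B} {a : I → ℕ} {b : B → ℕ}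
  {S : X → Type*} [∀ p, AddCommGroup (S p)] [∀ p, Module ℂ (S p)]
  [TopologicalSpace (TotalSpace ℂ S)] [∀ p, TopologicalSpace (S p)]
  [FiberBundle ℂ S] [VectorBundle ℂ ℂ S] [ContMDiffVectorBundle ω ℂ S 𝓘(ℂ)]

/-- Without fixed points the preferred half is the complement of its closed conjugate, hence open
and closed, hence empty or everything; either contradicts the decomposition into two halves. -/
theorem MarkedDisk.bdry_nonempty [ConnectedSpace X] (M : MarkedDisk X I B) : M.bdry.Nonempty := by
  by_contra hne
  rw [not_nonempty_iff_eq_empty] at hne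
  have himg : M.φ '' M.half = M.φ ⁻¹' M.half :=
    congrFun (image_eq_preimage_of_inverse M.involutive M.involutive) _
  have hcl : IsClosed (M.φ '' M.half) := himg ▸ M.isClosed_half.preimage M.antiholomorphic.1
  have hinter : M.half ∩ M.φ '' M.half = ∅ := M.half_inter.trans hne
  have hcompl : M.half = (M.φ '' M.half)ᶜ := by
    ext p
    have h1 : p ∈ M.half ∪ M.φ '' M.half := M.half_union ▸ mem_univ p
    exact ⟨fun h2 h3 => (hinter ▸ (⟨h2, h3⟩ : p ∈ M.half ∩ M.φ '' M.half) : p ∈ (∅ : Set X)),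
      fun h2 => h1.resolve_right h2⟩
  have hopen : IsOpen M.half := hcompl ▸ hcl.isOpen_compl
  rcases isClopen_iff.1 ⟨M.isClosed_half, hopen⟩ with h | h
  · have h1 := M.half_union
    rw [h, image_empty, union_self] at h1
    exact empty_ne_univ h1
  · rw [h, image_univ, M.involutive.surjective.range_eq, univ_inter] at hinter
    exact empty_ne_univ hinter.symm

theorem MarkedDisk.openBdry_nonempty [ConnectedSpace X] (M : MarkedDisk X I B) :
    M.openBdry.Nonempty := by
  obtain ⟨q, hq⟩ := M.bdry_nonempty
  obtain ⟨-, ψ, -, -, -, hψ⟩ := M.exists_bdryCharts hq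
  have hinf : (range fun t : ℝ => ψ t).Infinite :=
    infinite_range_of_injective (hψ.injective.comp Complex.ofReal_injective)
  obtain ⟨p, ⟨t, rfl⟩, hp⟩ := (hinf.sdiff (finite_range M.x)).nonempty
  exact ⟨_, (hψ.mem_bdry_iff t).2 ⟨t, rfl⟩, hp⟩

/-- Homogeneity: each linear factor occurs with its twist as exponent, so the total degree is the
exponent of `c`. It is the contribution of the divisor to the degree of `S`. -/
theorem divisorProd_mul (M : MarkedDisk X I B) (a : I → ℕ) (b : B → ℕ) {g g' : X → ℂ → ℂ}
    {c y z : ℂ} (hz : ∀ i, g' (M.z i) y = c * g (M.z i) z)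
    (hz' : ∀ i, g' (M.φ (M.z i)) y = c * g (M.φ (M.z i)) z)
    (hx : ∀ j, g' (M.x j) y = c * g (M.x j) z) :
    divisorProd M a b g' y = c ^ (2 * ∑ i, a i + ∑ j, b j) * divisorProd M a b g z := by
  simp only [divisorProd, hz, hz', hx, mul_pow, Finset.prod_mul_distrib, Finset.prod_pow_eq_pow_sum]
  ring

open Classical in
/-- The linear factor vanishing at `p`, in the parametrization opposite to `ψ`. -/
def oppositeFactor (ψ : ℂ → X) (p : X) (y : ℂ) : ℂ :=
  if h : ∃ w, ψ w = p then h.choose * y + 1 else y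

theorem oppositeFactor_apply {ψ : ℂ → X} (hψ : Function.Injective ψ) (w y : ℂ) :
    oppositeFactor ψ (ψ w) y = w * y + 1 := by
  have h : ∃ w', ψ w' = ψ w := ⟨w, rfl⟩
  rw [oppositeFactor, dif_pos h, hψ h.choose_spec]

theorem oppositeFactor_of_notMem {ψ : ℂ → X} {p : X} (hp : p ∉ range ψ) (y : ℂ) :
    oppositeFactor ψ p y = y := dif_neg hp

/-- The factor `z - w` at `z = -1 / y`, multiplied by `-y` to clear the pole. The multiplier is the
same for all points of the finite chart, as homogeneity requires. -/
theorem oppositeFactor_eq {ψ : ℂ → X} (hψ : Function.Injective ψ) {p : X} (hp : p ∈ range ψ) {y : ℂ}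
    (hy : y ≠ 0) : oppositeFactor ψ p y = -y * paramFactor ψ p (-y⁻¹) := by
  obtain ⟨w, rfl⟩ := hp
  rw [oppositeFactor_apply hψ, paramFactor_apply hψ]
  field_simp
  ring

open Classical in
theorem oppositeFactor_spec {ψ₀ ψ₁ : ℂ → X} (h : IsSpherePair univ ψ₀ ψ₁) (p : X) (y : ℂ) :
    AnalyticAt ℂ (oppositeFactor ψ₀ p) y ∧
      analyticOrderAt (oppositeFactor ψ₀ p) y = if p = ψ₁ y then 1 else 0 := by
  by_cases hp : p ∈ range ψ₀
  · obtain ⟨w, rfl⟩ := hp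
    have h1 : oppositeFactor ψ₀ (ψ₀ w) = fun y => w * y + 1 :=
      funext fun y => oppositeFactor_apply h.param₀.injective w y
    rw [h1]
    refine ⟨(analyticAt_const.mul analyticAt_id).add analyticAt_const, ?_⟩
    rw [analyticOrderAt_affine (Or.inr one_ne_zero)]
    refine if_congr ?_ rfl rfl
    rcases eq_or_ne y 0 with rfl | hy
    · simp only [mul_zero, zero_add, one_ne_zero, false_iff]
      exact fun h2 => h.notMem ⟨w, h2⟩
    · rw [h.glue y hy, h.param₀.injective.eq_iff]
      constructor
      · intro h2
        refine mul_right_cancel₀ hy ?_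
        rw [neg_mul, inv_mul_cancel₀ hy]
        exact eq_neg_of_add_eq_zero_left h2
      · rintro rfl
        field_simp
        ring
  · have h1 : oppositeFactor ψ₀ p = fun y => 1 * y + 0 := by
      funext y; rw [oppositeFactor_of_notMem hp]; ring
    rw [h1]
    refine ⟨(analyticAt_const.mul analyticAt_id).add analyticAt_const, ?_⟩
    rw [analyticOrderAt_affine (Or.inl one_ne_zero)]
    refine if_congr ?_ rfl rfl
    have h2 : p = ψ₁ 0 := by
      have h3 : p ∈ range ψ₀ ∪ {ψ₁ 0} := h.cover ▸ mem_univ p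
      exact h3.resolve_left hp
    rw [h2, h.param₁.injective.eq_iff, one_mul, add_zero, eq_comm]

theorem oppositeFactor_conj {ψ : ℂ → X} (hψ : IsBdryChart M ψ) (p : X) (z : ℂ) :
    oppositeFactor ψ (M.φ p) (starRingEnd ℂ z) = starRingEnd ℂ (oppositeFactor ψ p z) := by
  by_cases hp : p ∈ range ψ
  · obtain ⟨w, rfl⟩ := hp
    rw [hψ.conj, oppositeFactor_apply hψ.injective, oppositeFactor_apply hψ.injective, map_add,
      map_mul, map_one]
  · rw [oppositeFactor_of_notMem hp, oppositeFactor_of_notMem]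
    rintro ⟨w, hw⟩
    apply hp
    rw [← M.involutive p, ← hw, hψ.conj]
    exact ⟨_, rfl⟩

/-- On the real line conjugate pairs of factors multiply to squared norms, and the boundary factors
are nonzero reals raised to even powers. -/
theorem divisorProd_paramFactor_pos {ψ : ℂ → X} (hψ : IsBdryChart M ψ) (hb : ∀ j, Even (b j))
    {t : ℝ} (ht : ψ t ∈ M.openBdry) : 0 < (divisorProd M a b (paramFactor ψ) t).re := by
  have hφ : ∀ p, paramFactor ψ (M.φ p) t = starRingEnd ℂ (paramFactor ψ p t) := fun p => by
    rw [← paramFactor_conj hψ, Complex.conj_ofReal]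
  have hne : ∀ p, p ≠ ψ t → paramFactor ψ p t ≠ 0 := fun p hp => by
    by_cases h : p ∈ range ψ
    · obtain ⟨w, rfl⟩ := h
      rw [paramFactor_apply hψ.injective, sub_ne_zero]
      rintro rfl
      exact hp rfl
    · rw [paramFactor_of_notMem h]
      exact one_ne_zero
  have hx : ∀ j, ∃ c : ℝ, c ≠ 0 ∧ paramFactor ψ (M.x j) t = c := fun j => by
    have h1 := hφ (M.x j)
    rw [M.x_mem] at h1
    obtain ⟨c, hc⟩ := Complex.conj_eq_iff_real.1 h1.symm
    refine ⟨c, ?_, hc⟩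
    rintro rfl
    exact hne _ (fun h2 => ht.2 ⟨j, h2⟩) (by rw [hc, Complex.ofReal_zero])
  choose c hc0 hc using hx
  have hz : ∀ i, 0 < Complex.normSq (paramFactor ψ (M.z i) t) := fun i => by
    refine Complex.normSq_pos.2 (hne _ fun h => (M.z_mem i).2 ?_)
    rw [h]
    exact ht.1
  have key : divisorProd M a b (paramFactor ψ) t =
      (((∏ i, Complex.normSq (paramFactor ψ (M.z i) t) ^ a i) * ∏ j, c j ^ b j : ℝ) : ℂ) := by
    rw [divisorProd, ← Finset.prod_mul_distrib]
    simp only [hφ, ← mul_pow, Complex.mul_conj, hc]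
    push_cast
    rfl
  rw [key, Complex.ofReal_re]
  exact mul_pos (Finset.prod_pos fun i _ => pow_pos (hz i) _)
    (Finset.prod_pos fun j _ => (hb j).pow_pos (hc0 j))

/-- The derivative of `-1 / y` is `y ^ (-2)`; this accounts for the summand `2` in the degree
formula. -/
theorem IsSpherePair.vel_eq {K : Set X} {ψ₀ ψ₁ : ℂ → X} (h : IsSpherePair K ψ₀ ψ₁) {y : ℂ}
    (hy : y ≠ 0) : vel ψ₁ y = (y ^ 2)⁻¹ * vel ψ₀ (-y⁻¹) := by
  have h1 : ψ₁ =ᶠ[𝓝 y] ψ₀ ∘ fun y => -y⁻¹ := by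
    filter_upwards [isOpen_ne.mem_nhds hy] with z hz using h.glue z hz
  rw [vel_comp_of_eventuallyEq (h.param₀.mdifferentiableAt _)
    (analyticAt_neg_inv hy).differentiableAt h1, deriv.fun_neg, deriv_inv]
  simp

namespace TwistedSpin

/-- Real frames of `S` over the two standard charts of the sphere, with `ψ₁ 0` an unmarked boundary
point, and with transition function a power of the coordinate. -/
structure GlobalFrame (P : TwistedSpin r M a b S) (ψ₀ ψ₁ : ℂ → X) (e : B → ℝ) (k : ℕ) (ε : ℝ)
    (F₀ F₁ : ℂ → ℂ) (σ₀ : ∀ z, S (ψ₀ z)) (σ₁ : ∀ z, S (ψ₁ z)) : Prop where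
  pair : IsSpherePair univ ψ₀ ψ₁
  chart₀ : IsBdryChart M ψ₀
  chart₁ : IsBdryChart M ψ₁
  x_eq : ∀ j, ψ₀ (e j) = M.x j
  frame₀ : P.IsRealFrame ψ₀ F₀ σ₀
  frame₁ : P.IsRealFrame ψ₁ F₁ σ₁
  glue : ∀ y : ℝ, y ≠ 0 → (⟨ψ₁ y, σ₁ y⟩ : TotalSpace ℂ S) =
    ⟨ψ₀ ((-y⁻¹ : ℝ) : ℂ), (((-y) ^ k : ℝ) : ℂ) • σ₀ ((-y⁻¹ : ℝ) : ℂ)⟩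
  pos₀ : (∀ j, Even (b j)) → ∀ t : ℝ, ψ₀ t ∈ M.openBdry → 0 < ε * (F₀ t).re
  pos₁ : 0 < ε * (F₁ 0).re

theorem IsRealFrame.smul_real {P : TwistedSpin r M a b S} {ψ : ℂ → X} {F : ℂ → ℂ}
    {σ : ∀ z, S (ψ z)} (hσ : P.IsRealFrame ψ F σ) {c : ℝ} (hc : c ≠ 0) :
    P.IsRealFrame ψ (fun z => (c : ℂ) ^ r * F z) (fun z => (c : ℂ) • σ z) := by
  refine ⟨hσ.frame.smul (Complex.ofReal_ne_zero.2 hc), fun z => ?_⟩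
  rw [P.totalMap_smul _ (hσ.inv z), Complex.conj_ofReal]

end TwistedSpin

end GlobalFrames

/-! ### The transition function and its degree -/

section GlobalFrameExistence
set_option linter.unusedSectionVars false
variable {X : Type*} [TopologicalSpace X] [ChartedSpace ℂ X] [IsManifold 𝓘(ℂ) ω X]
  {I B : Type*} [Fintype I] [Fintype B] {r : ℕ} {M : MarkedDisk X I B} {a : I → ℕ} {b : B → ℕ}
  {S : X → Type*} [∀ p, AddCommGroup (S p)] [∀ p, Module ℂ (S p)]
  [TopologicalSpace (TotalSpace ℂ S)] [∀ p, TopologicalSpace (S p)]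
  [FiberBundle ℂ S] [VectorBundle ℂ ℂ S] [ContMDiffVectorBundle ω ℂ S 𝓘(ℂ)]

namespace TwistedSpin

/-- The transition function between real frames over the two standard charts. -/
theorem exists_transition (P : TwistedSpin r M a b S) (hr : 0 < r) {ψ₀ ψ₁ : ℂ → X} {K : Set X}
    (h : IsSpherePair K ψ₀ ψ₁)
    {f₀ f₁ : ℂ → ℂ} {m : ℕ} (hf : ∀ y, y ≠ 0 → f₁ y = (-y) ^ m * f₀ (-y⁻¹))
    (hne : ∀ y, y ≠ 0 → ∀ᶠ w in 𝓝[≠] y, f₁ w ≠ 0) {ε₀ ε₁ : ℝ} (hε₀ : ε₀ ≠ 0) (hε₁ : ε₁ ≠ 0)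
    {σ₀ : ∀ z, S (ψ₀ z)} {σ₁ : ∀ z, S (ψ₁ z)}
    (hσ₀ : P.IsRealFrame ψ₀ (fun z => (ε₀ : ℂ) * f₀ z) σ₀)
    (hσ₁ : P.IsRealFrame ψ₁ (fun z => (ε₁ : ℂ) * f₁ z) σ₁) :
    ∃ (k : ℕ) (c : ℝ), m + 2 = r * k ∧ c ^ r = ε₁ / ε₀ ∧ ∀ y : ℂ, y ≠ 0 →
      (⟨ψ₁ y, σ₁ y⟩ : TotalSpace ℂ S) = ⟨ψ₀ (-y⁻¹), ((c : ℂ) * (-y) ^ k) • σ₀ (-y⁻¹)⟩ := by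
  have hex : ∀ y, ∃ c : ℂ, y ≠ 0 →
      (⟨ψ₁ y, σ₁ y⟩ : TotalSpace ℂ S) = ⟨ψ₀ (-y⁻¹), c • σ₀ (-y⁻¹)⟩ := fun y => by
    by_cases hy : y = 0
    · exact ⟨0, fun h => absurd hy h⟩
    · have h1 : (⟨ψ₁ y, σ₁ y⟩ : TotalSpace ℂ S).1 = ψ₀ (-y⁻¹) := h.glue y hy
      generalize (⟨ψ₁ y, σ₁ y⟩ : TotalSpace ℂ S) = q at h1
      obtain ⟨p, v⟩ := q
      dsimp only at h1
      subst h1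
      obtain ⟨c, rfl⟩ := exists_smul_eq_of_ne_zero (hσ₀.ne_zero (-y⁻¹)) v
      exact ⟨c, fun _ => rfl⟩
  choose c hc using hex
  have hcc : ContinuousOn c {0}ᶜ := fun y hy => by
    have h1 : ContinuousWithinAt (fun y => (⟨ψ₀ (-y⁻¹), σ₀ (-y⁻¹)⟩ : TotalSpace ℂ S)) {0}ᶜ y :=
      (hσ₀.continuous.continuousAt.comp (f := fun y : ℂ => -y⁻¹)
        (analyticAt_neg_inv hy).continuousAt).continuousWithinAt
    refine h1.ratio_total ?_ (hσ₀.ne_zero _)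
    exact hσ₁.continuous.continuousWithinAt.congr (fun y hy => (hc y hy).symm) (hc y hy).symm
  -- Comparison of the two normalizations: the exponent `m` comes from the divisor and the
  -- additional `2` from the velocities.
  have hpow : ∀ y, y ≠ 0 → f₁ y ≠ 0 → c y ^ r = ((ε₁ / ε₀ : ℝ) : ℂ) * (-y) ^ (m + 2) :=
    fun y hy h0 => by
    have h1 := (hσ₁.frame.2 y trivial).2
    rw [rVal_congr P.τ (hc y hy), rVal_smul, h.vel_eq hy, rVal_mul,
      (hσ₀.frame.2 _ trivial).2] at h1
    dsimp only at h1
    rw [hf y hy] at h0 h1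
    have h2 := right_ne_zero_of_mul h0
    have h3 : (ε₀ : ℂ) ≠ 0 := Complex.ofReal_ne_zero.2 hε₀
    generalize f₀ (-y⁻¹) = w at h1 h2
    push_cast
    rw [pow_add, neg_sq]
    refine mul_right_cancel₀ (mul_ne_zero h3 h2) ?_
    rw [div_mul_eq_mul_div, div_mul_eq_mul_div, ← mul_assoc _ (ε₀ : ℂ) w, eq_div_iff h3]
    have h4 : (y ^ 2)⁻¹ * y ^ 2 = 1 := inv_mul_cancel₀ (pow_ne_zero 2 hy)
    linear_combination (ε₀ * y ^ 2 : ℂ) * h1 - (c y ^ r * ε₀ * w * ε₀) * h4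
  have hpow' : ∀ y, y ≠ 0 → c y ^ r = ((ε₁ / ε₀ : ℝ) : ℂ) * (-y) ^ (m + 2) := fun y hy => by
    have h1 : Tendsto (fun w => c w ^ r) (𝓝[≠] y) (𝓝 (c y ^ r)) :=
      ((hcc.continuousAt (isOpen_ne.mem_nhds hy)).pow r).tendsto.mono_left nhdsWithin_le_nhds
    have h2 : Tendsto (fun w : ℂ => ((ε₁ / ε₀ : ℝ) : ℂ) * (-w) ^ (m + 2)) (𝓝[≠] y)
        (𝓝 (((ε₁ / ε₀ : ℝ) : ℂ) * (-y) ^ (m + 2))) :=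
      (Continuous.tendsto (by fun_prop) y).mono_left nhdsWithin_le_nhds
    refine tendsto_nhds_unique h1 (h2.congr' ?_)
    filter_upwards [hne y hy, nhdsWithin_le_nhds (isOpen_ne.mem_nhds hy)] with w h2 h3
    exact (hpow w h3 h2).symm
  obtain ⟨k, c₀, hk, hc₀, hck⟩ := exists_eq_mul_pow_of_pow_eq (C := fun u => c (-u))
    (hcc.comp continuous_neg.continuousOn fun u hu => neg_ne_zero.2 hu) hr
    (ε := ((ε₁ / ε₀ : ℝ) : ℂ)) (n := m + 2) (Complex.ofReal_ne_zero.2 (div_ne_zero hε₁ hε₀))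
    fun u hu => by rw [hpow' _ (neg_ne_zero.2 hu), neg_neg]
  have hc₀1 : c (-1 : ℝ) = c₀ := by
    have := hck 1 one_ne_zero
    rw [one_pow, mul_one] at this
    rw [← this]
    norm_num
  -- At the real point `y = -1` both frames are invariant, so their ratio, which is the constant
  -- `c₀`, is real.
  have hreal : starRingEnd ℂ c₀ = c₀ := by
    have h1 := hc (-1 : ℝ) (by norm_num)
    have h2 := hσ₁.totalMap_real 1 (-1)
    rw [map_one, one_smul] at h2
    have h3 : (-((-1 : ℝ) : ℂ)⁻¹) = (1 : ℝ) := by norm_num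
    rw [h1, h3, hσ₀.totalMap_real, hc₀1] at h2
    exact smul_left_injective ℂ (hσ₀.ne_zero _) (eq_of_heq (TotalSpace.mk.inj h2).2)
  obtain ⟨c₁, rfl⟩ := Complex.conj_eq_iff_real.1 hreal
  refine ⟨k, c₁, hk, by exact_mod_cast hc₀, fun y hy => ?_⟩
  have h1 := hck (-y) (neg_ne_zero.2 hy)
  rw [neg_neg] at h1
  rw [hc y hy, h1]

/-- The point at infinity is an unmarked boundary point, so the whole divisor lies in the finite
chart and the comparison at infinity sees only its degree. -/
theorem exists_globalFrame [ConnectedSpace X] (P : TwistedSpin r M a b S) (hr : 0 < r)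
    (hre : Even r) :
    ∃ ψ₀ ψ₁ e k ε F₀ F₁ σ₀ σ₁, P.GlobalFrame ψ₀ ψ₁ e k ε F₀ F₁ σ₀ σ₁ ∧ (ε = 1 ∨ ε = -1) ∧
      2 * ∑ i, a i + ∑ j, b j + 2 = r * k := by
  classical
  obtain ⟨q, hq⟩ := M.openBdry_nonempty
  obtain ⟨ψ₀, ψ₁, hpair, hψq, hψ₀, hψ₁⟩ := M.exists_bdryCharts hq.1
  rw [PreconnectedSpace.connectedComponent_eq_univ] at hpair
  have hmem : ∀ p, p ≠ q → p ∈ range ψ₀ := fun p hp => by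
    have h3 : p ∈ range ψ₀ ∪ {ψ₁ 0} := hpair.cover ▸ mem_univ p
    exact h3.resolve_right fun h => hp (h.trans hψq)
  have hx : ∀ j, M.x j ∈ range ψ₀ := fun j => hmem _ fun h => hq.2 ⟨j, h⟩
  have hz : ∀ i, M.z i ∈ range ψ₀ := fun i => hmem _ fun h => (M.z_mem i).2 (h ▸ hq.1)
  have hz' : ∀ i, M.φ (M.z i) ∈ range ψ₀ := fun i => hmem _ fun h => by
    have h3 : M.φ q = q := hq.1
    rw [← h, M.involutive] at h3
    exact (M.z_mem i).2 h3.symm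
  have he : ∀ j, ∃ t : ℝ, ψ₀ t = M.x j := fun j => by
    obtain ⟨w, hw⟩ := hx j
    obtain ⟨t, rfl⟩ := (hψ₀.mem_bdry_iff w).1 (by rw [hw]; exact M.x_mem j)
    exact ⟨t, hw⟩
  choose e he using he
  set f₀ := divisorProd M a b (paramFactor ψ₀) with hf₀
  set f₁ := divisorProd M a b (oppositeFactor ψ₀) with hf₁
  have hf₁a : ∀ z, AnalyticAt ℂ f₁ z :=
    analyticAt_divisorProd M a b fun p z => (oppositeFactor_spec hpair p z).1
  have hf₁o : ∀ z, analyticOrderAt f₁ z = (M.divisor a b (ψ₁ z) : ℕ∞) := fun z =>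
    analyticOrderAt_divisorProd M a b (fun p => (oppositeFactor_spec hpair p z).1)
      fun p => by rw [(oppositeFactor_spec hpair p z).2]
  have hf₁c : ∀ z, f₁ (starRingEnd ℂ z) = starRingEnd ℂ (f₁ z) :=
    divisorProd_conj M a b (oppositeFactor_conj hψ₀)
  obtain ⟨ε₀, σ₀, hε₀, hσ₀⟩ := P.exists_isRealFrame_divisorProd hr hψ₀
  obtain ⟨ε₁, σ₁, hε₁, hσ₁⟩ := P.exists_isRealFrame hr hψ₁ hf₁a hf₁o hf₁c
  have hne : ∀ z, ∀ᶠ w in 𝓝[≠] z, f₁ w ≠ 0 := fun z => by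
    refine (hf₁a z).eventually_eq_zero_or_eventually_ne_zero.resolve_left fun h => ?_
    rw [← analyticOrderAt_eq_top, hf₁o z] at h
    exact ENat.natCast_ne_top _ h
  have hne0 : ∀ {ε : ℝ}, ε = 1 ∨ ε = -1 → ε ≠ 0 := by
    rintro ε (rfl | rfl) <;> norm_num
  obtain ⟨k, c, hk, hcr, hglue⟩ := P.exists_transition hr hpair (f₀ := f₀) (f₁ := f₁)
    (fun y hy => divisorProd_mul M a b (fun i => oppositeFactor_eq hψ₀.injective (hz i) hy)
      (fun i => oppositeFactor_eq hψ₀.injective (hz' i) hy)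
      fun j => oppositeFactor_eq hψ₀.injective (hx j) hy) (fun y _ => hne y) (hne0 hε₀) (hne0 hε₁)
    hσ₀ hσ₁
  have hc0 : c ≠ 0 := by
    rintro rfl
    rw [zero_pow hr.ne'] at hcr
    exact div_ne_zero (hne0 hε₁) (hne0 hε₀) hcr.symm
  -- The ratio of the two signs is an even power of a real number, hence positive.
  have hεε : ε₁ = ε₀ := by
    have h1 : 0 < ε₁ / ε₀ := hcr ▸ hre.pow_pos hc0
    rcases hε₀ with rfl | rfl <;> rcases hε₁ with rfl | rfl
    all_goals first | rfl | norm_num at h1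
  subst hεε
  have hcr1 : c ^ r = 1 := hcr.trans (div_self (hne0 hε₁))
  have hcinv : (c⁻¹ : ℝ) ^ r = 1 := by rw [inv_pow, hcr1, inv_one]
  have hcinv' : ((c⁻¹ : ℝ) : ℂ) ^ r = 1 := by rw [← Complex.ofReal_pow, hcinv, Complex.ofReal_one]
  -- Since `c ^ r = 1`, dividing `σ₁` by `c` leaves its normalization unchanged and makes the
  -- transition exactly `(-y) ^ k`.
  have hσ₁' := hσ₁.smul_real (inv_ne_zero hc0)
  simp only [hcinv', one_mul] at hσ₁'
  have hsq : ε₁ * ε₁ = 1 := by rcases hε₁ with rfl | rfl <;> norm_num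
  refine ⟨ψ₀, ψ₁, e, k, ε₁, _, _, σ₀, _, ⟨hpair, hψ₀, hψ₁, he, hσ₀, hσ₁', fun y hy => ?_,
    fun hb t ht => ?_, ?_⟩, hε₁, hk⟩
  · have hy' : (y : ℂ) ≠ 0 := Complex.ofReal_ne_zero.2 hy
    refine (congrArg (fun q : TotalSpace ℂ S =>
      (⟨q.1, ((c⁻¹ : ℝ) : ℂ) • q.2⟩ : TotalSpace ℂ S)) (hglue y hy')).trans ?_
    dsimp only
    rw [smul_smul, ← mul_assoc, ← Complex.ofReal_mul, inv_mul_cancel₀ hc0, Complex.ofReal_one,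
      one_mul]
    have h1 : ((-y⁻¹ : ℝ) : ℂ) = -(y : ℂ)⁻¹ := by push_cast; rfl
    rw [h1]
    push_cast
    rfl
  · rw [Complex.re_ofReal_mul, ← mul_assoc, hsq, one_mul]
    exact divisorProd_paramFactor_pos hψ₀ hb ht
  · have h1 : ∀ p, p ∈ range ψ₀ → oppositeFactor ψ₀ p 0 = 1 := by
      rintro _ ⟨w, rfl⟩
      rw [oppositeFactor_apply hψ₀.injective, mul_zero, zero_add]
    have h2 : f₁ 0 = 1 := by
      rw [hf₁, divisorProd]
      simp only [h1 _ (hz _), h1 _ (hz' _), h1 _ (hx _), one_pow, Finset.prod_const_one, mul_one]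
    rw [h2, mul_one, Complex.ofReal_re, hsq]
    exact one_pos

end TwistedSpin

end GlobalFrameExistence

/-! ### Sign changes along the boundary circle for even `r` -/

section Alternation
set_option linter.unusedSectionVars false
variable {X : Type*} [TopologicalSpace X] [ChartedSpace ℂ X] [IsManifold 𝓘(ℂ) ω X]
  {I B : Type*} [Fintype I] [Fintype B] {r : ℕ} {M : MarkedDisk X I B} {a : I → ℕ} {b : B → ℕ}
  {S : X → Type*} [∀ p, AddCommGroup (S p)] [∀ p, Module ℂ (S p)]
  [TopologicalSpace (TotalSpace ℂ S)] [∀ p, TopologicalSpace (S p)]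
  [FiberBundle ℂ S] [VectorBundle ℂ ℂ S] [ContMDiffVectorBundle ω ℂ S 𝓘(ℂ)]

theorem evSign_prod {ι : Type*} {D : Finset ι} {e : ι → ℝ} {x : ℝ} (h : ∀ j ∈ D, x ≠ e j) :
    EvSign (𝓝[≠] x) (fun t => ∏ j ∈ D, (t - e j)) := by
  have hc : Continuous fun t : ℝ => ∏ j ∈ D, (t - e j) := by fun_prop
  exact evSign_of_tendsto ((hc.tendsto x).mono_left nhdsWithin_le_nhds)
    (Finset.prod_ne_zero_iff.2 fun j hj => sub_ne_zero.2 (h j hj))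

theorem EvSign.neg_iff {α : Type*} {l : Filter α} {h : α → ℝ} :
    EvSign l (fun x => -h x) ↔ EvSign l h := by
  simp only [EvSign, neg_pos, neg_neg_iff_pos]
  exact or_comm

theorem prod_neg_inv_sub {ι : Type*} (D : Finset ι) (e : ι → ℝ) {y : ℝ} (hy : y ≠ 0) :
    ∏ j ∈ D, (-y⁻¹ - e j) = (-y⁻¹) ^ D.card * ∏ j ∈ D, (1 + e j * y) := by
  rw [← Finset.prod_const, ← Finset.prod_mul_distrib]
  refine Finset.prod_congr rfl fun j _ => ?_
  field_simp
  ring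

namespace TwistedSpin

variable {P : TwistedSpin r M a b S} {A : Set X}

theorem IsLiftingS.neg (hr : Even r) {v : ∀ p, S p} (hv : P.IsLiftingS A v) :
    P.IsLiftingS A (-v) := by
  have h1 : (-v : ∀ p, S p) = fun p => (-1 : ℂ) • v p := by
    funext p
    rw [Pi.neg_apply, neg_one_smul]
  refine ⟨fun p hp => ?_, fun p hp => ?_, fun p hp => ?_⟩
  · rw [h1]
    exact continuousWithinAt_const.smul_total (hv.1 p hp)
  · rw [Pi.neg_apply, Pi.neg_apply, map_neg, hv.2.1 p hp]
  · rw [h1]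
    dsimp only
    rw [rPow_smul, hr.neg_one_pow, one_smul]
    exact hv.2.2 p hp

variable [T2Space X] [CompactSpace X]

theorem IsLiftingS.isLegal_neg_iff (hr : 0 < r) (hre : Even r) (hA : A ⊆ M.openBdry) {j : B}
    (hAx : insert (M.x j) A ∈ 𝓝[M.bdry] (M.x j)) {v : ∀ p, S p} (hv : P.IsLiftingS A v) :
    P.IsLegalS A (-v) j ↔ P.IsLegalS A v j := by
  obtain ⟨ψ, F, σ, hψ, hx, hσ, hF⟩ := P.exists_bdryFrame hr (q := M.x j) (M.x_mem j)
  obtain ⟨h, hh⟩ := hσ.exists_coeff hr hψ hv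
  rw [isLegalS_iff hA hAx hψ hσ hx hv fun t ht => ⟨(hh t ht).1, (hh t ht).2.1⟩,
    isLegalS_iff hA hAx hψ hσ hx (hv.neg hre) (h := fun t => -h t) fun t ht =>
      ⟨by rw [Pi.neg_apply, (hh t ht).1, Complex.ofReal_neg, neg_smul], neg_ne_zero.2 (hh t ht).2.1⟩,
    EvSign.neg_iff]

theorem AlternatesS.neg (hr : 0 < r) (hre : Even r) {D : Finset B} {v : ∀ p, S p}
    (hv : P.AlternatesS D v) : P.AlternatesS D (-v) :=
  ⟨hv.1.neg hre, fun j => (hv.1.isLegal_neg_iff hr hre Subset.rfl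
    (M.insert_mem_nhdsWithin j)).trans (hv.2 j)⟩

/-- Coefficients of a section with respect to the frames of a global frame. -/
structure IsCoeff (M : MarkedDisk X I B) {ψ₀ ψ₁ : ℂ → X} (e : B → ℝ) (k : ℕ)
    (σ₀ : ∀ z, S (ψ₀ z)) (σ₁ : ∀ z, S (ψ₁ z)) (v : ∀ p, S p) (h₀ h₁ : ℝ → ℝ) : Prop where
  eq₀ : ∀ t : ℝ, (∀ j, t ≠ e j) → v (ψ₀ t) = (h₀ t : ℂ) • σ₀ t
  ne₀ : ∀ t : ℝ, (∀ j, t ≠ e j) → h₀ t ≠ 0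
  cont₀ : ∀ t : ℝ, (∀ j, t ≠ e j) → ContinuousAt h₀ t
  eq₁ : v (ψ₁ (0 : ℝ)) = (h₁ 0 : ℂ) • σ₁ (0 : ℝ)
  ne₁ : h₁ 0 ≠ 0
  cont₁ : ContinuousAt h₁ 0
  glue : ∀ᶠ y in 𝓝[≠] (0 : ℝ), (∀ j, -y⁻¹ ≠ e j) ∧ h₀ (-y⁻¹) = h₁ y * (-y) ^ k

namespace GlobalFrame

variable {ψ₀ ψ₁ : ℂ → X} {e : B → ℝ} {k : ℕ} {ε : ℝ} {F₀ F₁ : ℂ → ℂ} {σ₀ : ∀ z, S (ψ₀ z)}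
  {σ₁ : ∀ z, S (ψ₁ z)}

theorem e_injective (h : P.GlobalFrame ψ₀ ψ₁ e k ε F₀ F₁ σ₀ σ₁) : Function.Injective e :=
  fun i j hij => M.x_injective (by rw [← h.x_eq, ← h.x_eq, hij])

theorem mem_openBdry_iff (h : P.GlobalFrame ψ₀ ψ₁ e k ε F₀ F₁ σ₀ σ₁) (t : ℝ) :
    ψ₀ t ∈ M.openBdry ↔ ∀ j, t ≠ e j := by
  constructor
  · rintro ht j rfl
    exact ht.2 ⟨j, (h.x_eq j).symm⟩
  · intro ht
    refine ⟨(h.chart₀.mem_bdry_iff t).2 ⟨t, rfl⟩, ?_⟩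
    rintro ⟨j, hj⟩
    rw [← h.x_eq] at hj
    exact ht j (Complex.ofReal_injective (h.chart₀.injective hj)).symm

theorem infty_mem_openBdry (h : P.GlobalFrame ψ₀ ψ₁ e k ε F₀ F₁ σ₀ σ₁) :
    ψ₁ (0 : ℝ) ∈ M.openBdry := by
  refine ⟨(h.chart₁.mem_bdry_iff _).2 ⟨0, rfl⟩, ?_⟩
  rintro ⟨j, hj⟩
  refine h.pair.notMem ⟨e j, ?_⟩
  rw [h.x_eq, hj, Complex.ofReal_zero]

theorem exists_real (h : P.GlobalFrame ψ₀ ψ₁ e k ε F₀ F₁ σ₀ σ₁) {p : X} (hp : p ∈ M.openBdry) :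
    (∃ t : ℝ, (∀ j, t ≠ e j) ∧ ψ₀ t = p) ∨ ψ₁ (0 : ℝ) = p := by
  have h3 : p ∈ range ψ₀ ∪ {ψ₁ 0} := h.pair.cover ▸ mem_univ p
  rcases h3 with ⟨w, rfl⟩ | h3
  · obtain ⟨t, rfl⟩ := (h.chart₀.mem_bdry_iff w).1 hp.1
    exact Or.inl ⟨t, (h.mem_openBdry_iff t).1 hp, rfl⟩
  · refine Or.inr ?_
    rw [Complex.ofReal_zero]
    exact h3.symm

theorem isOpen_unmarked (e : B → ℝ) : IsOpen {t : ℝ | ∀ j, t ≠ e j} := by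
  have h1 : {t : ℝ | ∀ j, t ≠ e j} = (range e)ᶜ := by
    ext t
    simp [eq_comm]
  rw [h1]
  exact (finite_range e).isClosed.isOpen_compl

theorem eventually_unmarked (e : B → ℝ) : ∀ᶠ y in 𝓝[≠] (0 : ℝ), ∀ j, -y⁻¹ ≠ e j := by
  refine eventually_all.2 fun j => ?_
  have h1 : Tendsto (fun y : ℝ => 1 + e j * y) (𝓝[≠] 0) (𝓝 1) := by
    have : Continuous fun y : ℝ => 1 + e j * y := by fun_prop
    simpa using (this.tendsto 0).mono_left (nhdsWithin_le_nhds (s := {0}ᶜ))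
  filter_upwards [h1.eventually_ne one_ne_zero, self_mem_nhdsWithin] with y h2 h3 h4
  apply h2
  have h3 : y ≠ 0 := h3
  rw [← h4, neg_mul, inv_mul_cancel₀ h3, add_neg_cancel]

theorem coeff_glue (h : P.GlobalFrame ψ₀ ψ₁ e k ε F₀ F₁ σ₀ σ₁) (v : ∀ p, S p) {y : ℝ} (hy : y ≠ 0)
    (c₀ c₁ : ℝ) (h₀ : v (ψ₀ ((-y⁻¹ : ℝ) : ℂ)) = (c₀ : ℂ) • σ₀ ((-y⁻¹ : ℝ) : ℂ)) :
    v (ψ₁ y) = (c₁ : ℂ) • σ₁ y ↔ c₀ = c₁ * (-y) ^ k := by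
  have h1 : ψ₁ y = ψ₀ ((-y⁻¹ : ℝ) : ℂ) := congrArg TotalSpace.proj (h.glue y hy)
  have h2 : (⟨ψ₁ y, v (ψ₁ y)⟩ : TotalSpace ℂ S) = ⟨ψ₀ ((-y⁻¹ : ℝ) : ℂ), v (ψ₀ ((-y⁻¹ : ℝ) : ℂ))⟩ :=
    congrArg (fun p => (⟨p, v p⟩ : TotalSpace ℂ S)) h1
  have h3 : (⟨ψ₁ y, (c₁ : ℂ) • σ₁ y⟩ : TotalSpace ℂ S) =
      ⟨ψ₀ ((-y⁻¹ : ℝ) : ℂ), ((c₁ * (-y) ^ k : ℝ) : ℂ) • σ₀ ((-y⁻¹ : ℝ) : ℂ)⟩ := by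
    refine (congrArg (fun q : TotalSpace ℂ S =>
      (⟨q.1, (c₁ : ℂ) • q.2⟩ : TotalSpace ℂ S)) (h.glue y hy)).trans ?_
    dsimp only
    rw [smul_smul, ← Complex.ofReal_mul]
  rw [h₀] at h2
  constructor
  · intro h4
    rw [h4] at h2
    have h5 := smul_left_injective ℂ (h.frame₀.ne_zero _)
      (eq_of_heq (TotalSpace.mk.inj (h2.symm.trans h3)).2)
    exact Complex.ofReal_injective h5
  · rintro rfl
    exact eq_of_heq (TotalSpace.mk.inj (h2.trans h3.symm)).2

theorem exists_isCoeff (h : P.GlobalFrame ψ₀ ψ₁ e k ε F₀ F₁ σ₀ σ₁) (hr : 0 < r) {v : ∀ p, S p}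
    (hv : P.IsLiftingS M.openBdry v) : ∃ h₀ h₁ : ℝ → ℝ, IsCoeff M e k σ₀ σ₁ v h₀ h₁ ∧
      0 < h₁ 0 ^ r * (F₁ 0).re := by
  obtain ⟨h₀, hh₀⟩ := h.frame₀.exists_coeff hr h.chart₀ hv
  obtain ⟨h₁, hh₁⟩ := h.frame₁.exists_coeff hr h.chart₁ hv
  have hc₁ := h.frame₁.continuousWithinAt_coeff h.chart₁ hv.1 (fun t ht => (hh₁ t ht).1)
    h.infty_mem_openBdry
  have hev : ∀ᶠ y : ℝ in 𝓝[≠] 0, ψ₁ y ∈ M.openBdry ∧ (∀ j, -y⁻¹ ≠ e j) ∧ y ≠ 0 := by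
    filter_upwards [eventually_unmarked e, self_mem_nhdsWithin] with y hy hy0
    have h1 : ψ₁ y = ψ₀ ((-y⁻¹ : ℝ) : ℂ) := congrArg TotalSpace.proj (h.glue y hy0)
    exact ⟨h1 ▸ (h.mem_openBdry_iff _).2 hy, hy, hy0⟩
  have hmem : (fun t : ℝ => ψ₁ t) ⁻¹' M.openBdry ∈ 𝓝 (0 : ℝ) := by
    filter_upwards [eventually_nhdsWithin_iff.1 hev] with y hy
    rcases eq_or_ne y 0 with rfl | hy0
    · exact h.infty_mem_openBdry
    · exact (hy hy0).1
  refine ⟨h₀, h₁, ⟨fun t ht => (hh₀ t ((h.mem_openBdry_iff t).2 ht)).1,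
    fun t ht => (hh₀ t ((h.mem_openBdry_iff t).2 ht)).2.1, fun t ht => ?_,
    (hh₁ 0 h.infty_mem_openBdry).1, (hh₁ 0 h.infty_mem_openBdry).2.1,
    hc₁.continuousAt hmem, ?_⟩, ?_⟩
  · have h1 := h.frame₀.continuousWithinAt_coeff h.chart₀ hv.1 (fun t ht => (hh₀ t ht).1)
      ((h.mem_openBdry_iff t).2 ht)
    refine h1.continuousAt (mem_of_superset ((isOpen_unmarked e).mem_nhds ht) fun u hu => ?_)
    exact (h.mem_openBdry_iff u).2 hu
  · filter_upwards [hev] with y hy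
    exact ⟨hy.2.1, (h.coeff_glue v hy.2.2 _ _ (hh₀ _ ((h.mem_openBdry_iff _).2 hy.2.1)).1).1
      (hh₁ y hy.1).1⟩
  · simpa using (hh₁ 0 h.infty_mem_openBdry).2.2

/-- At infinity `F₁` has the sign of `ε`, and no even power of a real coefficient can correct a
negative sign. -/
theorem eps_pos (h : P.GlobalFrame ψ₀ ψ₁ e k ε F₀ F₁ σ₀ σ₁) (hr : 0 < r) (hre : Even r)
    (hP : P.Compatible) : 0 < ε := by
  obtain ⟨v, hv⟩ := hP
  obtain ⟨h₀, h₁, -, h1⟩ := h.exists_isCoeff hr hv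
  exact pos_of_mul_pos_left h.pos₁ (pos_of_mul_pos_right h1 (hre.pow_nonneg _)).le

theorem isLegal_iff (h : P.GlobalFrame ψ₀ ψ₁ e k ε F₀ F₁ σ₀ σ₁) {v : ∀ p, S p}
    (hv : P.IsLiftingS M.openBdry v) {h₀ : ℝ → ℝ}
    (hh : ∀ t : ℝ, (∀ j, t ≠ e j) → v (ψ₀ t) = (h₀ t : ℂ) • σ₀ t ∧ h₀ t ≠ 0) (j : B) :
    P.IsLegalS M.openBdry v j ↔ ¬ EvSign (𝓝[≠] (e j)) h₀ :=
  isLegalS_iff Subset.rfl (M.insert_mem_nhdsWithin j) h.chart₀ h.frame₀ (h.x_eq j) hv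
    fun t ht => hh t ((h.mem_openBdry_iff t).1 ht)

/-- A lifting alternating precisely at `D` changes sign on the real line precisely at the points
of `D`. -/
theorem exists_sign (h : P.GlobalFrame ψ₀ ψ₁ e k ε F₀ F₁ σ₀ σ₁) {D : Finset B} {v : ∀ p, S p}
    (hv : P.AlternatesS D v) {h₀ h₁ : ℝ → ℝ} (hc : IsCoeff M e k σ₀ σ₁ v h₀ h₁) :
    ∃ δ : ℝ, (δ = 1 ∨ δ = -1) ∧ ∀ t, (∀ j, t ≠ e j) → 0 < δ * ((∏ j ∈ D, (t - e j)) * h₀ t) := by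
  classical
  have hprod : ∀ t, (∀ j, t ≠ e j) → ∏ j ∈ D, (t - e j) ≠ 0 := fun t ht =>
    Finset.prod_ne_zero_iff.2 fun j _ => sub_ne_zero.2 (ht j)
  have hpc : Continuous fun t : ℝ => ∏ j ∈ D, (t - e j) := by fun_prop
  have hreg : ∀ t, (∀ j, t ≠ e j) → ContinuousAt (fun t => (∏ j ∈ D, (t - e j)) * h₀ t) t :=
    fun t ht => hpc.continuousAt.mul (hc.cont₀ t ht)
  -- Multiplication by the product over `D` cancels the sign changes of `h₀`: what remains has
  -- locally, hence globally, constant sign.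
  have hev : ∀ t, EvSign (𝓝[≠] t) (fun t => (∏ j ∈ D, (t - e j)) * h₀ t) := fun t => by
    by_cases ht : ∀ j, t ≠ e j
    · exact evSign_of_tendsto ((hreg t ht).tendsto.mono_left nhdsWithin_le_nhds)
        (mul_ne_zero (hprod t ht) (hc.ne₀ t ht))
    push Not at ht
    obtain ⟨j, rfl⟩ := ht
    have hlegal := h.isLegal_iff hv.1 (fun t ht => ⟨hc.eq₀ t ht, hc.ne₀ t ht⟩) j
    rw [hv.2 j] at hlegal
    by_cases hj : j ∈ D
    · have h1 : ∀ᶠ t in 𝓝[≠] (e j), ContinuousAt h₀ t ∧ h₀ t ≠ 0 := by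
        have h2 : ∀ᶠ t in 𝓝 (e j), ∀ i, i ≠ j → t ≠ e i := eventually_all.2 fun i => by
          by_cases hij : i = j
          · exact Eventually.of_forall fun t h3 => absurd hij h3
          · filter_upwards [isOpen_ne.mem_nhds (h.e_injective.ne (Ne.symm hij))] with t ht _ using ht
        filter_upwards [nhdsWithin_le_nhds h2, self_mem_nhdsWithin] with t h3 h4
        have h5 : ∀ i, t ≠ e i := fun i => by
          by_cases hij : i = j
          · rw [hij]; exact h4
          · exact h3 i hij
        exact ⟨hc.cont₀ t h5, hc.ne₀ t h5⟩
      -- At a legal point `h₀` has no constant sign, so it changes sign there and one factor `t - e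
      -- j` compensates.
      have h2 := (evSign_or_evSign_sub_mul h1).resolve_left (hlegal.1 hj)
      have h3 := (evSign_prod (D := D.erase j) (e := e) (x := e j) fun i hi h4 =>
        Finset.ne_of_mem_erase hi (h.e_injective h4).symm).mul h2
      refine (congrArg (EvSign (𝓝[≠] (e j))) (funext fun t => ?_)).mp h3
      rw [← mul_assoc, mul_comm (∏ i ∈ D.erase j, (t - e i)), Finset.mul_prod_erase D (fun i => t - e i) hj]
    · have h1 := not_not.1 fun h2 => hj (hlegal.2 h2)
      exact (evSign_prod fun i hi h4 => hj (by rw [h.e_injective h4]; exact hi)).mul h1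
  rcases eventually_pos_or_neg hev with h1 | h1
  · refine ⟨1, Or.inl rfl, fun t ht => ?_⟩
    rw [one_mul]
    refine lt_of_le_of_ne ?_ (mul_ne_zero (hprod t ht) (hc.ne₀ t ht)).symm
    exact ge_of_tendsto ((hreg t ht).tendsto.mono_left nhdsWithin_le_nhds)
      ((h1 t).mono fun u hu => hu.le)
  · refine ⟨-1, Or.inr rfl, fun t ht => ?_⟩
    rw [neg_one_mul, neg_pos]
    refine lt_of_le_of_ne ?_ (mul_ne_zero (hprod t ht) (hc.ne₀ t ht))
    exact le_of_tendsto ((hreg t ht).tendsto.mono_left nhdsWithin_le_nhds)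
      ((h1 t).mono fun u hu => hu.le)

/-- With `t = -1 / y`, the product over `D` becomes `(-1 / y) ^ |D|` times a function that tends to
`1`, and `h₀` becomes `h₁ y * (-y) ^ k` with `h₁` nonvanishing at infinity. As their product has the
same sign on both sides of infinity, so has `(-y) ^ (|D| + k)`. -/
theorem even_card_add (h : P.GlobalFrame ψ₀ ψ₁ e k ε F₀ F₁ σ₀ σ₁) (hr : 0 < r) {D : Finset B}
    {v : ∀ p, S p} (hv : P.AlternatesS D v) : Even (D.card + k) := by
  obtain ⟨h₀, h₁, hc, -⟩ := h.exists_isCoeff hr hv.1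
  obtain ⟨δ, hδ, hsign⟩ := h.exists_sign hv hc
  have hW : Tendsto (fun y => δ * ((∏ j ∈ D, (1 + e j * y)) * h₁ y)) (𝓝[≠] 0) (𝓝 (δ * h₁ 0)) := by
    have h1 : Continuous fun y : ℝ => ∏ j ∈ D, (1 + e j * y) := by fun_prop
    have h2 := (h1.continuousAt (x := 0)).mul hc.cont₁
    have h3 := h2.tendsto.mono_left (nhdsWithin_le_nhds (s := {0}ᶜ))
    simpa using h3.const_mul δ
  have hδ0 : δ ≠ 0 := by rcases hδ with rfl | rfl <;> norm_num
  have h1 := evSign_of_tendsto hW (mul_ne_zero hδ0 hc.ne₁)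
  have h2 : EvSign (𝓝[≠] 0) (fun y : ℝ => (-y) ^ (D.card + k)) := by
    refine h1.congr_sign ?_
    filter_upwards [hc.glue, self_mem_nhdsWithin] with y hy hy0
    have hy0 : y ≠ 0 := hy0
    have h3 := hsign _ hy.1
    rw [hy.2, prod_neg_inv_sub D e hy0] at h3
    have h4 : 0 < ((-y) ^ D.card) * ((-y) ^ D.card) :=
      mul_self_pos.2 (pow_ne_zero _ (neg_ne_zero.2 hy0))
    have h5 : (-y⁻¹) ^ D.card * (-y) ^ D.card = 1 := by
      rw [← mul_pow, neg_mul_neg, inv_mul_cancel₀ hy0, one_pow]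
    have h6 := mul_pos h3 h4
    have h7 : δ * ((-y⁻¹) ^ D.card * ∏ j ∈ D, (1 + e j * y)) * (h₁ y * (-y) ^ k) *
        ((-y) ^ D.card * (-y) ^ D.card) = δ * ((∏ j ∈ D, (1 + e j * y)) * h₁ y) *
        (-y) ^ (D.card + k) := by
      rw [pow_add]
      linear_combination (δ * (∏ j ∈ D, (1 + e j * y)) * h₁ y * (-y) ^ k * (-y) ^ D.card) * h5
    linarith
  have h3 := (evSign_of_tendsto (tendsto_const_nhds (x := (-1 : ℝ) ^ (D.card + k)) (f := 𝓝[≠] 0))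
    (pow_ne_zero _ (by norm_num))).mul h2
  rw [← evSign_pow_iff (x := 0)]
  refine (congrArg (EvSign (𝓝[≠] 0)) (funext fun t => ?_)).mp h3
  rw [← mul_pow, neg_one_mul, neg_neg, sub_zero]

end GlobalFrame

end TwistedSpin

end Alternation

/-! ### Existence and uniqueness of liftings with prescribed alternation -/

section Classification
set_option linter.unusedSectionVars false
variable {X : Type*} [TopologicalSpace X] [ChartedSpace ℂ X] [IsManifold 𝓘(ℂ) ω X]
  {I B : Type*} [Fintype I] [Fintype B] {r : ℕ} {M : MarkedDisk X I B} {a : I → ℕ} {b : B → ℕ}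
  {S : X → Type*} [∀ p, AddCommGroup (S p)] [∀ p, Module ℂ (S p)]
  [TopologicalSpace (TotalSpace ℂ S)] [∀ p, TopologicalSpace (S p)]
  [FiberBundle ℂ S] [VectorBundle ℂ ℂ S] [ContMDiffVectorBundle ω ℂ S 𝓘(ℂ)]

namespace TwistedSpin

variable {P : TwistedSpin r M a b S} {A : Set X}

theorem Paired.neg (hr : Even r) {w : ∀ p, JFiber S p} {v : ∀ p, S p} (h : P.Paired A w v) :
    P.Paired A (-w) (-v) := by
  have hpos : ∀ p ∈ A, M.IsPositive p ((-w) p ((-v) p)) := fun p hp => by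
    have h1 : (-w) p ((-v) p) = w p (v p) := by
      rw [Pi.neg_apply, Pi.neg_apply, map_neg, neg_apply, neg_neg]
    rw [h1]
    exact h.pos p hp
  refine ⟨⟨fun p hp => ?_, fun p hp s u => ?_, -v, h.liftS.neg hr, hpos⟩, h.liftS.neg hr, hpos⟩
  · have h1 : (-w : ∀ p, JFiber S p) = fun p => (-1 : ℂ) • w p := by
      funext p
      exact ContinuousLinearMap.ext fun s => (neg_one_smul ℂ (w p s : ℂ →L[ℂ] ℂ)).symm
    rw [h1]
    exact continuousWithinAt_const.smul_total (h.liftJ.1 p hp)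
  · exact (congrArg Neg.neg (h.liftJ.2.1 p hp s u)).trans (map_neg (starRingEnd ℂ) _).symm

variable [T2Space X] [CompactSpace X]

theorem Paired.alternates_iff (hr : 0 < r) {D : Finset B} {w : ∀ p, JFiber S p} {v : ∀ p, S p}
    (h : P.Paired M.openBdry w v) : P.AlternatesJ D w ↔ P.AlternatesS D v :=
  ⟨fun h1 => ⟨h.liftS, fun j => (h.isLegal_iff hr Subset.rfl
      (M.insert_mem_nhdsWithin j)).symm.trans (h1.2 j)⟩,
    fun h1 => ⟨h.liftJ, fun j => (h.isLegal_iff hr Subset.rfl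
      (M.insert_mem_nhdsWithin j)).trans (h1.2 j)⟩⟩

theorem exactlyTwoNegatives_alternatesJ (hr : 0 < r) (hre : Even r) {D : Finset B}
    (h : ExactlyTwoNegatives M.openBdry (P.AlternatesS D)) :
    ExactlyTwoNegatives M.openBdry (P.AlternatesJ D) := by
  have hA : M.openBdry ⊆ M.bdry := sdiff_subset
  obtain ⟨v, hv, hnv, hne, huniq⟩ := h
  obtain ⟨w, hwv⟩ := hv.1.exists_paired hr hA
  refine ⟨w, (hwv.alternates_iff hr).2 hv, ((hwv.neg hre).alternates_iff hr).2 hnv, ?_,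
    fun w' hw' => ?_⟩
  · rwa [hwv.sectionEquiv_iff hr hA (hwv.neg hre)]
  · obtain ⟨v', hwv'⟩ := hw'.1.exists_paired
    rw [hwv'.sectionEquiv_iff hr hA hwv, hwv'.sectionEquiv_iff hr hA (hwv.neg hre)]
    exact huniq v' ((hwv'.alternates_iff hr).1 hw')

namespace GlobalFrame

variable {ψ₀ ψ₁ : ℂ → X} {e : B → ℝ} {k : ℕ} {ε : ℝ} {F₀ F₁ : ℂ → ℂ} {σ₀ : ∀ z, S (ψ₀ z)}
  {σ₁ : ∀ z, S (ψ₁ z)}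

/-- The product over `D` has the required sign changes but the wrong growth at infinity. Dividing by
the positive function `(1 + t ^ 2) ^ n` with `2 n = |D| + k` makes it match the transition `(-y) ^
k`; evenness of `|D| + k` is what makes `n` an integer. -/
theorem exists_alternates (h : P.GlobalFrame ψ₀ ψ₁ e k ε F₀ F₁ σ₀ σ₁) (hre : Even r) (hε : 0 < ε)
    (hb : ∀ j, Even (b j)) {D : Finset B} (hD : Even (D.card + k)) :
    ∃ v, P.AlternatesS D v := by
  classical
  obtain ⟨n, hn⟩ := hD
  set h₀ : ℝ → ℝ := fun t => (∏ j ∈ D, (t - e j)) / (1 + t ^ 2) ^ n with hh₀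
  set h₁ : ℝ → ℝ := fun y => (∏ j ∈ D, (1 + e j * y)) / (1 + y ^ 2) ^ n with hh₁
  have hden : ∀ t : ℝ, 0 < (1 + t ^ 2) ^ n := fun t => by positivity
  have hc₀ : Continuous h₀ := Continuous.div (by fun_prop) (by fun_prop) fun t => (hden t).ne'
  have hc₁ : Continuous h₁ := Continuous.div (by fun_prop) (by fun_prop) fun t => (hden t).ne'
  have hne₀ : ∀ t, (∀ j, t ≠ e j) → h₀ t ≠ 0 := fun t ht =>
    div_ne_zero (Finset.prod_ne_zero_iff.2 fun j _ => sub_ne_zero.2 (ht j)) (hden t).ne'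
  have h₁0 : h₁ 0 = 1 := by simp [hh₁]
  have hrel : ∀ y, y ≠ 0 → h₀ (-y⁻¹) = h₁ y * (-y) ^ k := fun y hy => by
    have h5 : (-y⁻¹) ^ D.card * (-y) ^ D.card = 1 := by
      rw [← mul_pow, neg_mul_neg, inv_mul_cancel₀ hy, one_pow]
    have h6 : (1 + (-y⁻¹) ^ 2) ^ n * (y ^ 2) ^ n = (1 + y ^ 2) ^ n := by
      rw [← mul_pow]
      congr 1
      field_simp
      ring
    have h7 : (y ^ 2) ^ n = (-y) ^ D.card * (-y) ^ k := by
      rw [← pow_add, hn, ← two_mul, pow_mul, neg_sq]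
    simp only [hh₀, hh₁]
    rw [prod_neg_inv_sub D e hy, div_mul_eq_mul_div, div_eq_div_iff (hden _).ne' (hden _).ne', ← h6,
      h7]
    linear_combination ((∏ j ∈ D, (1 + e j * y)) * (1 + (-y⁻¹) ^ 2) ^ n * (-y) ^ k) * h5
  obtain ⟨v₀, hv₀⟩ := exists_section_extending h.chart₀.injective fun t => ((h₀ t : ℝ) : ℂ) • σ₀ t
  -- The only boundary point missed by the finite chart gets the coefficient `h₁ 0 = 1`.
  set v : ∀ p, S p := Function.update v₀ (ψ₁ (0 : ℝ)) (σ₁ (0 : ℝ)) with hv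
  have hve : ∀ t : ℝ, v (ψ₀ t) = ((h₀ t : ℝ) : ℂ) • σ₀ t := fun t => by
    rw [hv, Function.update_of_ne, hv₀]
    intro h1
    refine h.pair.notMem ⟨t, ?_⟩
    rw [h1, Complex.ofReal_zero]
  have hve₁ : ∀ y : ℝ, v (ψ₁ y) = ((h₁ y : ℝ) : ℂ) • σ₁ y := fun y => by
    rcases eq_or_ne y 0 with rfl | hy
    · rw [hv, Function.update_self, h₁0, Complex.ofReal_one, one_smul]
    · exact (h.coeff_glue v hy _ _ (hve _)).2 (hrel y hy)
  have hlift : P.IsLiftingS M.openBdry v := by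
    refine isLiftingS_of_local sdiff_subset fun p hp => ?_
    rcases h.exists_real hp with ⟨t, ht, rfl⟩ | rfl
    · refine ⟨ψ₀, F₀, σ₀, t, h₀, h.chart₀, h.frame₀, rfl, hc₀.continuousWithinAt,
        Eventually.of_forall fun t _ => hve t, ?_⟩
      exact mul_pos (hre.pow_pos (hne₀ t ht)) (pos_of_mul_pos_right (h.pos₀ hb t hp) hε.le)
    · refine ⟨ψ₁, F₁, σ₁, 0, h₁, h.chart₁, h.frame₁, rfl, hc₁.continuousWithinAt,
        Eventually.of_forall fun t _ => hve₁ t, ?_⟩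
      rw [h₁0, one_pow, one_mul, Complex.ofReal_zero]
      exact pos_of_mul_pos_right h.pos₁ hε.le
  refine ⟨v, hlift, fun j => ?_⟩
  rw [h.isLegal_iff hlift fun t ht => ⟨hve t, hne₀ t ht⟩]
  have hiff : EvSign (𝓝[≠] (e j)) h₀ ↔ EvSign (𝓝[≠] (e j)) (fun t => ∏ i ∈ D, (t - e i)) := by
    have h1 : ∀ t, 0 < h₀ t ↔ 0 < ∏ i ∈ D, (t - e i) := fun t => div_pos_iff_of_pos_right (hden t)
    have h2 : ∀ t, h₀ t < 0 ↔ ∏ i ∈ D, (t - e i) < 0 := fun t => by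
      rw [← neg_pos, ← neg_div, div_pos_iff_of_pos_right (hden t), neg_pos]
    simp only [EvSign, h1, h2]
  rw [hiff]
  constructor
  · intro h1
    by_contra hj
    exact h1 (evSign_prod fun i hi h4 => hj (by rw [h.e_injective h4]; exact hi))
  · intro hj h1
    have h2 : EvSign (𝓝[≠] (e j)) (fun t => ∏ i ∈ D.erase j, (t - e i)) :=
      evSign_prod fun i hi h4 => Finset.ne_of_mem_erase hi (h.e_injective h4).symm
    have h3 : EvSign (𝓝[≠] (e j)) (fun t => (t - e j) ^ 1) := by
      refine h2.of_mul_left ?_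
      refine (congrArg (EvSign (𝓝[≠] (e j))) (funext fun t => ?_)).mp h1
      rw [pow_one, mul_comm, Finset.mul_prod_erase D (fun i => t - e i) hj]
    rw [evSign_pow_iff] at h3
    exact absurd h3 (by decide)

/-- Both coefficients have the sign of the same product over `D` up to constants `δ` and `δ'`, so
their ratio has the constant sign `δ' * δ`. At infinity this follows by continuity, as neither
coefficient vanishes there. -/
theorem sectionEquiv_or_neg (h : P.GlobalFrame ψ₀ ψ₁ e k ε F₀ F₁ σ₀ σ₁) (hr : 0 < r)
    (hre : Even r) {D : Finset B} {v v' : ∀ p, S p} (hv : P.AlternatesS D v)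
    (hv' : P.AlternatesS D v') :
    SectionEquiv M.openBdry v' v ∨ SectionEquiv M.openBdry v' (-v) := by
  have hA : M.openBdry ⊆ M.bdry := sdiff_subset
  obtain ⟨h₀, h₁, hc, -⟩ := h.exists_isCoeff hr hv.1
  obtain ⟨h₀', h₁', hc', -⟩ := h.exists_isCoeff hr hv'.1
  obtain ⟨δ, hδ, hs⟩ := h.exists_sign hv hc
  obtain ⟨δ', hδ', hs'⟩ := h.exists_sign hv' hc'
  have key : ∀ γ : ℝ, γ = δ' * δ → ∀ p ∈ M.openBdry, ∃ (c c' : ℝ) (u : S p), u ≠ 0 ∧ c ≠ 0 ∧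
      v p = (c : ℂ) • u ∧ v' p = (c' : ℂ) • u ∧ 0 < γ * (c' * c) := by
    rintro γ rfl p hp
    have hpos : ∀ t, (∀ j, t ≠ e j) → 0 < δ' * δ * (h₀' t * h₀ t) := fun t ht => by
      have h1 := mul_pos (hs' t ht) (hs t ht)
      have h2 : δ' * ((∏ j ∈ D, (t - e j)) * h₀' t) * (δ * ((∏ j ∈ D, (t - e j)) * h₀ t)) =
          δ' * δ * (h₀' t * h₀ t) * ((∏ j ∈ D, (t - e j)) * (∏ j ∈ D, (t - e j))) := by ring
      rw [h2] at h1
      exact pos_of_mul_pos_left h1 (mul_self_nonneg _)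
    rcases h.exists_real hp with ⟨t, ht, rfl⟩ | rfl
    · exact ⟨h₀ t, h₀' t, σ₀ t, h.frame₀.ne_zero _, hc.ne₀ t ht, hc.eq₀ t ht, hc'.eq₀ t ht, hpos t ht⟩
    · refine ⟨h₁ 0, h₁' 0, σ₁ (0 : ℝ), h.frame₁.ne_zero _, hc.ne₁, hc.eq₁, hc'.eq₁, ?_⟩
      have hγ : δ' * δ ≠ 0 := by
        rcases hδ with rfl | rfl <;> rcases hδ' with rfl | rfl <;> norm_num
      refine lt_of_le_of_ne ?_ (mul_ne_zero hγ (mul_ne_zero hc'.ne₁ hc.ne₁)).symm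
      have h1 : Tendsto (fun y => δ' * δ * (h₁' y * h₁ y)) (𝓝[≠] 0) (𝓝 (δ' * δ * (h₁' 0 * h₁ 0))) :=
        ((hc'.cont₁.mul hc.cont₁).tendsto.const_mul _).mono_left nhdsWithin_le_nhds
      refine ge_of_tendsto h1 ?_
      filter_upwards [hc.glue, hc'.glue] with y h2 h3
      have h4 := hpos _ h2.1
      rw [h2.2, h3.2] at h4
      have h5 : δ' * δ * (h₁' y * (-y) ^ k * (h₁ y * (-y) ^ k)) =
          δ' * δ * (h₁' y * h₁ y) * ((-y) ^ k * (-y) ^ k) := by ring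
      rw [h5] at h4
      exact (pos_of_mul_pos_left h4 (mul_self_nonneg _)).le
  have hδδ : δ' * δ = 1 ∨ δ' * δ = -1 := by
    rcases hδ with rfl | rfl <;> rcases hδ' with rfl | rfl <;> norm_num
  rcases hδδ with h1 | h1
  · refine Or.inl ((hv'.1.sectionEquiv_iff hr hA hv.1).2 fun p hp => ?_)
    obtain ⟨c, c', u, hu, hc0, h2, h3, h4⟩ := key 1 h1.symm p hp
    rw [h2, h3, posRatio_smul_iff hu hc0]
    linarith
  · refine Or.inr ((hv'.1.sectionEquiv_iff hr hA (hv.1.neg hre)).2 fun p hp => ?_)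
    obtain ⟨c, c', u, hu, hc0, h2, h3, h4⟩ := key (-1) h1.symm p hp
    rw [Pi.neg_apply, h2, h3, ← neg_smul, ← Complex.ofReal_neg,
      posRatio_smul_iff hu (neg_ne_zero.2 hc0)]
    linarith

theorem not_sectionEquiv_neg (h : P.GlobalFrame ψ₀ ψ₁ e k ε F₀ F₁ σ₀ σ₁) (hr : 0 < r)
    {v : ∀ p, S p} (hv : P.IsLiftingS M.openBdry v) : ¬ SectionEquiv M.openBdry v (-v) := by
  rintro ⟨c, -, hc⟩
  obtain ⟨h1, h2⟩ := hc _ h.infty_mem_openBdry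
  have h3 := hv.ne_zero hr sdiff_subset h.infty_mem_openBdry
  rw [Pi.neg_apply, smul_neg, ← neg_smul] at h2
  have h4 : (1 : ℂ) = -(c (ψ₁ (0 : ℝ)) : ℂ) := smul_left_injective ℂ h3 ((one_smul ℂ _).trans h2)
  have h5 : (1 : ℝ) = -c (ψ₁ (0 : ℝ)) := by exact_mod_cast h4
  linarith

theorem rotated {P' : TwistedSpin r M a b S} (h : P.GlobalFrame ψ₀ ψ₁ e k ε F₀ F₁ σ₀ σ₁)
    (hr : 0 < r) {ξ : ℂ} (hξ : ξ ^ r = -1) (hτ : P'.τ = P.τ)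
    (hinv : ∀ p v, P'.inv p v = ξ • P.inv p (ξ⁻¹ • v)) :
    P'.GlobalFrame ψ₀ ψ₁ e k (-ε) (fun z => -F₀ z) (fun z => -F₁ z) (fun z => ξ • σ₀ z)
      (fun z => ξ • σ₁ z) := by
  refine ⟨h.pair, h.chart₀, h.chart₁, h.x_eq, h.frame₀.rotated hr hξ hτ hinv,
    h.frame₁.rotated hr hξ hτ hinv, fun y hy => ?_, fun hb t ht => ?_, ?_⟩
  · refine (congrArg (fun q : TotalSpace ℂ S => (⟨q.1, ξ • q.2⟩ : TotalSpace ℂ S))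
      (h.glue y hy)).trans ?_
    dsimp only
    rw [smul_comm]
  · rw [Complex.neg_re, neg_mul_neg]
    exact h.pos₀ hb t ht
  · rw [Complex.neg_re, neg_mul_neg]
    exact h.pos₁

end GlobalFrame

end TwistedSpin

end Classification

end

/-! ### Assembly of the four statements -/

theorem proposition2 {X : Type*} [TopologicalSpace X] [T2Space X] [CompactSpace X]
    [ChartedSpace ℂ X] [IsManifold 𝓘(ℂ) ω X]
    {I B : Type*} [Fintype I] [Fintype B]
    (r : ℕ) (hr : 0 < r) (M : MarkedDisk X I B) (a : I → ℕ) (b : B → ℕ)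
    (S : X → Type*) [∀ p, AddCommGroup (S p)] [∀ p, Module ℂ (S p)]
    [TopologicalSpace (TotalSpace ℂ S)] [∀ p, TopologicalSpace (S p)]
    [FiberBundle ℂ S] [VectorBundle ℂ ℂ S] [ContMDiffVectorBundle ω ℂ S 𝓘(ℂ)]
    (P : TwistedSpin r M a b S) :
    -- (1) odd `r`: compatibility, and uniqueness of the lifting up to equivalence
    (Odd r →
      P.Compatible ∧
      (∀ v v', P.IsLiftingS M.openBdry v → P.IsLiftingS M.openBdry v' →
        SectionEquiv M.openBdry v v') ∧
      (∃ w, P.IsLiftingJ M.openBdry w) ∧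
      (∀ w w', P.IsLiftingJ M.openBdry w → P.IsLiftingJ M.openBdry w' →
        SectionEquiv M.openBdry w w')) ∧
    -- (2) even `r`: compatibility and parity of the boundary twists
    (Even r → P.Compatible → ∀ j, Even (b j)) ∧
    (Even r → ConnectedSpace X → (∀ j, Even (b j)) →
      (Nonempty B ∨ ∃ k : ℕ, Even k ∧ 2 * ∑ i, a i + 2 = r * k) →
      ∀ ξ : ℂ, ξ ^ r = -1 →
        ∃ P' N : TwistedSpin r M a b S,
          P'.τ = P.τ ∧ (∀ p v, P'.inv p v = ξ • P.inv p (ξ⁻¹ • v)) ∧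
          N.τ = -P.τ ∧ N.inv = P.inv ∧
          (∃ f : TwistedSpin.Iso N P', ∀ p v, f.f p v = ξ • v) ∧
          (P.Compatible ∨ P'.Compatible)) ∧
    -- (3) odd `r`: legality and parity of the boundary twists
    (Odd r → ∀ (j : B) (A : Set X), M.IsOpenArc A → insert (M.x j) A ∈ 𝓝[M.bdry] (M.x j) →
      (∀ v, P.IsLiftingS A v → (P.IsLegalS A v j ↔ Odd (b j))) ∧
      (∀ w, P.IsLiftingJ A w → (P.IsLegalJ A w j ↔ Odd (b j)))) ∧
    -- (4) even `r`: the parity constraint for liftings alternating precisely at `D`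
    (Even r → ConnectedSpace X → ∀ D : Finset B,
      (((∃ v, P.AlternatesS D v) ∨ (∃ w, P.AlternatesJ D w)) →
        ∃ k : ℕ, 2 * ∑ i, a i + ∑ j, b j + 2 = r * k ∧ k ≡ D.card [MOD 2]) ∧
      (P.Compatible →
        (∃ k : ℕ, 2 * ∑ i, a i + ∑ j, b j + 2 = r * k ∧ k ≡ D.card [MOD 2]) →
        ExactlyTwoNegatives M.openBdry (P.AlternatesS D) ∧
        ExactlyTwoNegatives M.openBdry (P.AlternatesJ D))) := by
  have hA : M.openBdry ⊆ M.bdry := sdiff_subset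
  refine ⟨fun hodd => ?_, fun hre hP j => ?_, fun hre hconn hb hBk ξ hξ => ?_,
    fun hodd j A hA' hAx => ?_, fun hre hconn D => ?_⟩
  · have hP := P.compatible_of_odd hodd
    refine ⟨hP, fun v v' hv hv' => hv.sectionEquiv_of_odd hodd hA hv', ?_, fun w w' hw hw' => ?_⟩
    · obtain ⟨v, hv⟩ := hP
      obtain ⟨w, hw⟩ := hv.exists_paired hr hA
      exact ⟨w, hw.liftJ⟩
    · obtain ⟨v, hv⟩ := hw.exists_paired
      obtain ⟨v', hv'⟩ := hw'.exists_paired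
      exact (hv.sectionEquiv_iff hr hA hv').2 (hv.liftS.sectionEquiv_of_odd hodd hA hv'.liftS)
  · obtain ⟨v, hv⟩ := hP
    exact hv.even_twist hr hre j
  · classical
    obtain ⟨P', N, hτ, hinv, hN, hN', hiso⟩ := P.exists_rotated hr hξ
    refine ⟨P', N, hτ, hinv, hN, hN', hiso, ?_⟩
    obtain ⟨ψ₀, ψ₁, e, k, ε, F₀, F₁, σ₀, σ₁, hG, hε, hk⟩ := P.exists_globalFrame hr hre
    -- A set of marked points of the parity of `k` is needed: the empty set if `k` is even, one
    -- marked point if `k` is odd. Without marked points the numerical hypothesis says that `k` is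
    -- even.
    obtain ⟨D, hD⟩ : ∃ D : Finset B, Even (D.card + k) := by
      rcases Nat.even_or_odd k with hke | hko
      · exact ⟨∅, by simpa using hke⟩
      · rcases hBk with ⟨⟨j⟩⟩ | ⟨k', hk', h⟩
        · exact ⟨{j}, by rw [Finset.card_singleton, add_comm]; exact hko.add_one⟩
        · by_cases hB : Nonempty B
          · obtain ⟨j⟩ := hB
            exact ⟨{j}, by rw [Finset.card_singleton, add_comm]; exact hko.add_one⟩
          · rw [not_nonempty_iff] at hB
            have hB0 : ∑ j, b j = 0 := Finset.sum_eq_zero fun j _ => (hB.false j).elim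
            rw [hB0, add_zero, h] at hk
            obtain rfl := Nat.eq_of_mul_eq_mul_left hr hk
            exact ⟨∅, by simpa using hk'⟩
    -- The sign `ε` of the frames decides which of the two structures carries the lifting.
    rcases hε with rfl | rfl
    · obtain ⟨v, hv⟩ := hG.exists_alternates hre one_pos hb hD
      exact Or.inl ⟨v, hv.1⟩
    · obtain ⟨v, hv⟩ := (hG.rotated hr hξ hτ hinv).exists_alternates hre (by norm_num) hb hD
      exact Or.inr ⟨v, hv.1⟩
  · refine ⟨fun v hv => hv.isLegal_iff_of_odd hodd hA'.1 hAx, fun w hw => ?_⟩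
    obtain ⟨v, hwv⟩ := hw.exists_paired
    rw [hwv.isLegal_iff hr hA'.1 hAx]
    exact hwv.liftS.isLegal_iff_of_odd hodd hA'.1 hAx
  · obtain ⟨ψ₀, ψ₁, e, k, ε, F₀, F₁, σ₀, σ₁, hG, hε, hk⟩ := P.exists_globalFrame hr hre
    have hparity : Even (D.card + k) ↔ k ≡ D.card [MOD 2] := by
      rw [Nat.even_iff, Nat.ModEq]
      omega
    refine ⟨fun h => ⟨k, hk, hparity.1 ?_⟩, fun hP ⟨k', hk', hmod⟩ => ?_⟩
    · rcases h with ⟨v, hv⟩ | ⟨w, hw⟩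
      · exact hG.even_card_add hr hv
      · obtain ⟨v, hwv⟩ := hw.1.exists_paired
        exact hG.even_card_add hr ((hwv.alternates_iff hr).1 hw)
    · rw [hk] at hk'
      obtain rfl := Nat.eq_of_mul_eq_mul_left hr hk'
      obtain ⟨v₀, hv₀⟩ := id hP
      obtain ⟨v, hv⟩ := hG.exists_alternates hre (hG.eps_pos hr hre hP)
        (fun j => hv₀.even_twist hr hre j) (hparity.2 hmod)
      have h1 : ExactlyTwoNegatives M.openBdry (P.AlternatesS D) :=
        ⟨v, hv, hv.neg hr hre, hG.not_sectionEquiv_neg hr hv.1,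
          fun v' hv' => hG.sectionEquiv_or_neg hr hre hv hv'⟩
      exact ⟨h1, TwistedSpin.exactlyTwoNegatives_alternatesJ hr hre h1⟩
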